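/- Let $h:\mathbb R\to\mathbb R$ be such that $g(s)=h(s^2)s$ is continuously differentiable on $\mathbb R$ with $g'(s)=O(s^2)$ as $s\to0$, and put $g(u)=h(|u|^2)u$ for $u\in\mathbb C$. Let $\omega=\sigma^2>0$, $m\in\mathbb Z$, let $w$ be real-valued, and suppose that $u(x,t)=e^{i\omega t}e^{im\theta}w(r)$ ($(r,\theta)$ polar coordinates in $\mathbb R^2$) is a solution of class $C^2$ in $x$ of $-i\,\partial_t u=\Delta u+g(u)$ on $\mathbb R^2$, exponentially localized: $|w(r)|\le Ce^{-\kappa r}$ for all $r\ge0$, with some $C,\kappa>0$. Let $$\alpha(s)=\tfrac12\Big[g'(s)+\frac{g(s)}s\Big],\qquad \beta(s)=\tfrac12\Big[g'(s)-\frac{g(s)}s\Big]\quad(s\ne0),\qquad \alpha(0)=\beta(0)=0,$$ $$J=\begin{pmatrix}0&-1\\1&0\end{pmatrix},\qquad R=\begin{pmatrix}1&0\\0&-1\end{pmatrix},\qquad A=J\big(\Delta-\sigma^2+\alpha(w(r))+\beta(w(r))e^{2m\theta J}R\big),$$ where $A$ is regarded as an unbounded operator on $L^2(\mathbb R^2,\mathbb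 C^2)$ with domain the Sobolev space $H^2(\mathbb R^2,\mathbb C^2)$. The discrete spectrum of $A$ consists of the isolated points of the spectrum that are eigenvalues of finite multiplicity, and the essential spectrum consists of all other points of the spectrum. **Proposition.** A complex number $\lambda$ that is not in the essential spectrum of $A$ is an eigenvalue of $A$ (that is, $A\Psi=\lambda\Psi$ for some nonzero $\Psi\in H^2(\mathbb R^2,\mathbb C^2)$) if and only if for some integer $j$ there is a pair $(y_+,y_-)$ of complex-valued $C^2$ functions on $(0,\infty)$, not both identically zero, such that for all $r>0$ $$\begin{aligned}\big(i\lambda-\sigma^2+\Delta_r-r^{-2}(j+m)^2+\alpha(w(r))\big)y_+ +\beta(w(r))\,y_-&=0,\\ \big(-i\lambda-\sigma^2+\Delta_r-r^{-2}(j-m)^2+\alpha(w(r))\big)y_- +\beta(w(r))\,y_+&=0,\end{aligned}$$ where $\Delta_r=\frac{d^2}{dr^2}+\frac1r\frac{d}{dr}$, and such that $\lim_{r\to0^+}y_\pm(r)$ exist (as finite limits) and $\lim_{r\to\infty}y_\pm(r)=0$. -/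

import Mathlib

open MeasureTheory Filter Topology Set
open scoped ENNReal Laplacian SchwartzMap

noncomputable section

namespace SpinningWave

/-! ### Unbounded operators on a complex Banach space -/

section Operators

variable {X : Type*} [NormedAddCommGroup X] [NormedSpace ℂ X]

/-- `z` belongs to the resolvent set of the unbounded operator `A`: the map `A - z` from the domain
of `A` to `X` is a bijection with bounded inverse `S`. -/
def InResolventSet (A : X →ₗ.[ℂ] X) (z : ℂ) : Prop :=
  ∃ S : X →L[ℂ] X,
    (∀ f : X, ∃ hf : S f ∈ A.domain, A ⟨S f, hf⟩ - z • S f = f) ∧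
    ∀ u : A.domain, S (A u - z • (u : X)) = u

/-- The spectrum of an unbounded operator. -/
def spec (A : X →ₗ.[ℂ] X) : Set ℂ := {z | ¬ InResolventSet A z}

/-- `z` is an eigenvalue of `A`: some nonzero `u` in the domain satisfies `A u = z u`. -/
def IsEigenvalue (A : X →ₗ.[ℂ] X) (z : ℂ) : Prop :=
  ∃ u : A.domain, (u : X) ≠ 0 ∧ A u = z • (u : X)

/-- The kernel of `(A - z) ^ k`, the power being taken on its natural domain. -/
def genEigenspace (A : X →ₗ.[ℂ] X) (z : ℂ) : ℕ → Submodule ℂ X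
  | 0 => ⊥
  | k + 1 => ((genEigenspace A z k).comap (A.toFun - z • A.domain.subtype)).map A.domain.subtype

/-- The discrete spectrum: the isolated points of the spectrum that are eigenvalues of finite
(algebraic) multiplicity. -/
def specDisc (A : X →ₗ.[ℂ] X) : Set ℂ :=
  {z | IsEigenvalue A z ∧
    (∃ ε > 0, ∀ z' ∈ spec A, ‖z' - z‖ < ε → z' = z) ∧
    FiniteDimensional ℂ (⨆ k, genEigenspace A z k : Submodule ℂ X)}

/-- The essential spectrum: everything in the spectrum that is not in the discrete spectrum. -/
def specEss (A : X →ₗ.[ℂ] X) : Set ℂ := spec A \ specDisc A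

end Operators

/-! ### The nonlinearity and the standing wave -/

/-- The plane `ℝ²`. -/
abbrev Plane := EuclideanSpace ℝ (Fin 2)

/-- The space `ℂ²`. -/
abbrev C2 := EuclideanSpace ℂ (Fin 2)

/-- The polar angle of a point of the plane (with value `0` at the origin). -/
def angle (x : Plane) : ℝ := Complex.arg ⟨x 0, x 1⟩

/-- The nonlinearity `g(u) = h(|u|²) u`. -/
def nonlin (h : ℝ → ℝ) (u : ℂ) : ℂ := (h (‖u‖ ^ 2) : ℂ) * u

/-- The restriction of the nonlinearity to real arguments. -/
def realNonlin (h : ℝ → ℝ) (s : ℝ) : ℝ := h (s ^ 2) * s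

/-- `α(s) = (g'(s) + g(s)/s) / 2`, `α(0) = 0`. -/
def alpha (h : ℝ → ℝ) (s : ℝ) : ℝ :=
  if s = 0 then 0 else (deriv (realNonlin h) s + realNonlin h s / s) / 2

/-- `β(s) = (g'(s) - g(s)/s) / 2`, `β(0) = 0`. -/
def beta (h : ℝ → ℝ) (s : ℝ) : ℝ :=
  if s = 0 then 0 else (deriv (realNonlin h) s - realNonlin h s / s) / 2

/-- The profile `v₀(x) = e^{imθ} w(r)`. -/
def profile (m : ℤ) (w : ℝ → ℝ) (x : Plane) : ℂ :=
  Complex.exp (Complex.I * (m * angle x)) * (w ‖x‖ : ℂ)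

/-- The function `u(x,t) = e^{iωt} v₀(x)`. -/
def standingWave (ω : ℝ) (m : ℤ) (w : ℝ → ℝ) (t : ℝ) (x : Plane) : ℂ :=
  Complex.exp (Complex.I * (ω * t)) * profile m w x

/-- `u(x,t) = e^{iωt} e^{imθ} w(r)` is a classical, exponentially localized standing wave solution
of `-i ∂ₜ u = Δu + g(u)` on `ℝ²`, where `g(u) = h(|u|²) u` is `C¹` on the real line with
`g'(s) = O(s²)` as `s → 0`, and `ω > 0`. -/
structure IsStandingWave (h : ℝ → ℝ) (ω : ℝ) (m : ℤ) (w : ℝ → ℝ) : Prop where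
  contDiff_nonlin : ContDiff ℝ 1 (realNonlin h)
  deriv_nonlin : deriv (realNonlin h) =O[𝓝 0] fun s : ℝ => s ^ 2
  omega_pos : 0 < ω
  contDiff_profile : ContDiff ℝ 2 (profile m w)
  equation : ∀ (x : Plane) (t : ℝ),
    -Complex.I * deriv (fun s => standingWave ω m w s x) t =
      (Δ (standingWave ω m w t)) x + nonlin h (standingWave ω m w t x)
  localized : ∃ C > 0, ∃ κ > 0, ∀ r : ℝ, 0 ≤ r → |w r| ≤ C * Real.exp (-(κ * r))

/-! ### The linearized operator -/

/-- The matrix `J`. -/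
def matJ : Matrix (Fin 2) (Fin 2) ℂ := !![0, -1; 1, 0]

/-- The matrix `R`. -/
def matR : Matrix (Fin 2) (Fin 2) ℂ := !![1, 0; 0, -1]

/-- The matrix exponential `e^{tJ} = cos t + (sin t) J`. -/
def expJ (t : ℝ) : Matrix (Fin 2) (Fin 2) ℂ :=
  (Real.cos t : ℂ) • (1 : Matrix (Fin 2) (Fin 2) ℂ) + (Real.sin t : ℂ) • matJ

/-- The multiplier `α(w(r)) + β(w(r)) e^{2mθJ} R`. -/
def potential (h : ℝ → ℝ) (m : ℤ) (w : ℝ → ℝ) (x : Plane) : Matrix (Fin 2) (Fin 2) ℂ :=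
  (alpha h (w ‖x‖) : ℂ) • (1 : Matrix (Fin 2) (Fin 2) ℂ) +
    (beta h (w ‖x‖) : ℂ) • (expJ (2 * m * angle x) * matR)

/-- The complexified space `L²(ℝ², ℂ²)`. -/
abbrev L2 := Lp C2 2 (volume : Measure Plane)

/-- The Sobolev space `H²(ℝ², ℂ²)` as a subspace of `L²(ℝ², ℂ²)`. -/
def sobolevH2 : Submodule ℂ L2 where
  carrier := {u | TemperedDistribution.MemSobolev 2 2 (u : 𝓢'(Plane, C2))}
  add_mem' {u v} hu hv := by
    have := TemperedDistribution.MemSobolev.add hu hv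
    rw [← Lp.toTemperedDistributionCLM_apply, ← Lp.toTemperedDistributionCLM_apply,
      ← map_add] at this
    exact this
  zero_mem' := by
    have := TemperedDistribution.memSobolev_fun_zero Plane C2 2 2
    rw [← map_zero (Lp.toTemperedDistributionCLM C2 (volume : Measure Plane) 2)] at this
    exact this
  smul_mem' c u hu := by
    have := TemperedDistribution.MemSobolev.smul c hu
    rw [← Lp.toTemperedDistributionCLM_apply, ← map_smul] at this
    exact this

theorem exists_laplacian (u : sobolevH2) :
    ∃ f : L2, Δ ((u : L2) : 𝓢'(Plane, C2)) = (f : 𝓢'(Plane, C2)) := by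
  have h : TemperedDistribution.MemSobolev 2 2 ((u : L2) : 𝓢'(Plane, C2)) := u.2
  have h' := h.laplacian
  rw [sub_self] at h'
  exact TemperedDistribution.memSobolev_zero_iff.mp h'

theorem toTemperedDistribution_injective {f g : L2}
    (hfg : (f : 𝓢'(Plane, C2)) = (g : 𝓢'(Plane, C2))) : f = g :=
  LinearMap.ker_eq_bot.mp
    (Lp.ker_toTemperedDistributionCLM_eq_bot (F := C2) (μ := (volume : Measure Plane)) (p := 2)) hfg

/-- The distributional Laplacian as a linear map from `H²` to `L²`. -/
def lapL2 : sobolevH2 →ₗ[ℂ] L2 where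
  toFun u := (exists_laplacian u).choose
  map_add' u v := by
    apply toTemperedDistribution_injective
    rw [← (exists_laplacian (u + v)).choose_spec]
    rw [← Lp.toTemperedDistributionCLM_apply, ← Lp.toTemperedDistributionCLM_apply,
      Submodule.coe_add, map_add, map_add, Lp.toTemperedDistributionCLM_apply,
      Lp.toTemperedDistributionCLM_apply, Lp.toTemperedDistributionCLM_apply,
      Lp.toTemperedDistributionCLM_apply,
      ← (exists_laplacian u).choose_spec, ← (exists_laplacian v).choose_spec,
      ← TemperedDistribution.laplacianCLM_apply, map_add,
      TemperedDistribution.laplacianCLM_apply, TemperedDistribution.laplacianCLM_apply]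
  map_smul' c u := by
    apply toTemperedDistribution_injective
    rw [← (exists_laplacian (c • u)).choose_spec]
    rw [← Lp.toTemperedDistributionCLM_apply, ← Lp.toTemperedDistributionCLM_apply,
      Submodule.coe_smul, map_smul, map_smul, Lp.toTemperedDistributionCLM_apply,
      Lp.toTemperedDistributionCLM_apply, RingHom.id_apply,
      ← (exists_laplacian u).choose_spec,
      ← TemperedDistribution.laplacianCLM_apply, map_smul,
      TemperedDistribution.laplacianCLM_apply]

section Bounded

variable {h w : ℝ → ℝ} {ω : ℝ} {m : ℤ}

theorem measurable_angle : Measurable angle := by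
  have : Measurable fun x : Plane => (x 0 : ℂ) + (x 1 : ℂ) * Complex.I := by fun_prop
  have h2 := Complex.measurable_arg.comp this
  convert h2 using 1
  funext x
  simp [angle, Complex.mk_eq_add_mul_I]

theorem measurable_radial (hw : IsStandingWave h ω m w) :
    Measurable fun x : Plane => w ‖x‖ := by
  have e : Continuous fun x : Plane => (profile m w (WithLp.toLp 2 ![‖x‖, 0])).re := by
    have e1 : Continuous fun x : Plane => (WithLp.toLp 2 ![‖x‖, 0] : Plane) :=
      (PiLp.continuous_toLp 2 _).comp (by fun_prop)
    exact Complex.continuous_re.comp (hw.contDiff_profile.continuous.comp e1)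
  convert e.measurable using 1
  funext x
  have ha : angle (WithLp.toLp 2 ![‖x‖, 0]) = 0 := by
    simp only [angle]
    exact Complex.arg_ofReal_of_nonneg (norm_nonneg x)
  have hn : ‖(WithLp.toLp 2 ![‖x‖, 0] : Plane)‖ = ‖x‖ := by
    simp [EuclideanSpace.norm_eq]
  simp [profile, ha, hn]

theorem measurable_alpha (hw : IsStandingWave h ω m w) : Measurable (alpha h) := by
  have h1 : Measurable (realNonlin h) := hw.contDiff_nonlin.continuous.measurable
  have h2 : Measurable (deriv (realNonlin h)) := measurable_deriv _
  unfold alpha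
  exact Measurable.ite (measurableSet_singleton 0) measurable_const
    ((h2.add (h1.div measurable_id)).div_const 2)

theorem measurable_beta (hw : IsStandingWave h ω m w) : Measurable (beta h) := by
  have h1 : Measurable (realNonlin h) := hw.contDiff_nonlin.continuous.measurable
  have h2 : Measurable (deriv (realNonlin h)) := measurable_deriv _
  unfold beta
  exact Measurable.ite (measurableSet_singleton 0) measurable_const
    ((h2.sub (h1.div measurable_id)).div_const 2)

theorem exists_bound (hw : IsStandingWave h ω m w) :
    ∃ K : ℝ, ∀ r : ℝ, 0 ≤ r → |alpha h (w r)| ≤ K ∧ |beta h (w r)| ≤ K := by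
  obtain ⟨C, hC, κ, hκ, hb⟩ := hw.localized
  have hcd : Continuous (deriv (realNonlin h)) := hw.contDiff_nonlin.continuous_deriv le_rfl
  obtain ⟨K, hK⟩ := (isCompact_Icc (a := -C) (b := C)).exists_bound_of_continuousOn
    hcd.continuousOn
  refine ⟨K, fun r hr => ?_⟩
  have hwC : |w r| ≤ C := (hb r hr).trans (by
    have : Real.exp (-(κ * r)) ≤ 1 := Real.exp_le_one_iff.mpr (by nlinarith)
    nlinarith)
  have hmem : w r ∈ Icc (-C) C := abs_le.mp hwC
  have h0 : (0 : ℝ) ∈ Icc (-C) C := ⟨by linarith, hC.le⟩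
  have hd : |deriv (realNonlin h) (w r)| ≤ K := hK _ hmem
  have hK0 : 0 ≤ K := (abs_nonneg _).trans hd
  have hq : |realNonlin h (w r) / w r| ≤ K := by
    have := (convex_Icc (-C) C).norm_image_sub_le_of_norm_deriv_le
      (f := realNonlin h) (C := K)
      (fun x _ => (hw.contDiff_nonlin.differentiable one_ne_zero) x)
      (fun x hx => hK x hx) h0 hmem
    have h00 : realNonlin h 0 = 0 := by simp [realNonlin]
    rw [h00, sub_zero, sub_zero, Real.norm_eq_abs, Real.norm_eq_abs] at this
    rw [abs_div]
    exact div_le_of_le_mul₀ (abs_nonneg _) hK0 this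
  rw [abs_le] at hd hq
  constructor
  · unfold alpha
    split_ifs
    · simpa using hK0
    · rw [abs_le]; constructor <;> linarith [hd.1, hd.2, hq.1, hq.2]
  · unfold beta
    split_ifs
    · simpa using hK0
    · rw [abs_le]; constructor <;> linarith [hd.1, hd.2, hq.1, hq.2]

theorem measurable_potential (hw : IsStandingWave h ω m w) (i j : Fin 2) :
    Measurable fun x => potential h m w x i j := by
  have h1 : Measurable fun x : Plane => (alpha h (w ‖x‖) : ℂ) :=
    Complex.measurable_ofReal.comp ((measurable_alpha hw).comp (measurable_radial hw))
  have h2 : Measurable fun x : Plane => (beta h (w ‖x‖) : ℂ) :=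
    Complex.measurable_ofReal.comp ((measurable_beta hw).comp (measurable_radial hw))
  have h3 : Measurable fun x : Plane => 2 * (m : ℝ) * angle x :=
    measurable_angle.const_mul _
  have h4 : Measurable fun x : Plane => ((Real.cos (2 * m * angle x) : ℝ) : ℂ) :=
    Complex.measurable_ofReal.comp (Real.measurable_cos.comp h3)
  have h5 : Measurable fun x : Plane => ((Real.sin (2 * m * angle x) : ℝ) : ℂ) :=
    Complex.measurable_ofReal.comp (Real.measurable_sin.comp h3)
  fin_cases i <;> fin_cases j <;>
    simp [potential, expJ, matJ, matR, Matrix.mul_apply, Fin.sum_univ_two,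
      -Complex.ofReal_cos, -Complex.ofReal_sin] <;> fun_prop

theorem exists_bound_potential (hw : IsStandingWave h ω m w) :
    ∃ K : ℝ, ∀ x i j, ‖potential h m w x i j‖ ≤ K := by
  obtain ⟨K, hK⟩ := exists_bound hw
  refine ⟨K + K * 1, fun x i j => ?_⟩
  obtain ⟨ha, hb⟩ := hK ‖x‖ (norm_nonneg x)
  have hK0 : 0 ≤ K := (abs_nonneg _).trans ha
  have hc : ‖(expJ (2 * m * angle x) * matR) i j‖ ≤ 1 := by
    have hcos := Real.abs_cos_le_one (2 * m * angle x)
    have hsin := Real.abs_sin_le_one (2 * m * angle x)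
    fin_cases i <;> fin_cases j <;>
      simp [expJ, matJ, matR, Matrix.mul_apply, Fin.sum_univ_two,
        -Complex.ofReal_cos, -Complex.ofReal_sin, hcos, hsin]
  have h1 : ‖(1 : Matrix (Fin 2) (Fin 2) ℂ) i j‖ ≤ 1 := by
    fin_cases i <;> fin_cases j <;> simp
  simp only [potential, Matrix.add_apply, Matrix.smul_apply, smul_eq_mul]
  refine (norm_add_le _ _).trans (add_le_add ?_ ?_)
  · rw [norm_mul, Complex.norm_real]
    nlinarith [norm_nonneg ((1 : Matrix (Fin 2) (Fin 2) ℂ) i j), Real.norm_eq_abs (alpha h (w ‖x‖))]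
  · rw [norm_mul, Complex.norm_real]
    exact mul_le_mul hb hc (norm_nonneg _) hK0

theorem memLp_potential (hw : IsStandingWave h ω m w) (u : L2) :
    MemLp (fun x => Matrix.toEuclideanCLM (n := Fin 2) (𝕜 := ℂ) (potential h m w x) (u x)) 2
      (volume : Measure Plane) := by
  obtain ⟨K, hK⟩ := exists_bound_potential hw
  have hu : MemLp u 2 (volume : Measure Plane) := Lp.memLp u
  have huj : ∀ j : Fin 2, AEStronglyMeasurable (fun x => u x j) (volume : Measure Plane) :=
    fun j => (EuclideanSpace.proj (𝕜 := ℂ) j).continuous.comp_aestronglyMeasurable hu.1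
  have hfi : ∀ (x : Plane) (i : Fin 2),
      (Matrix.toEuclideanCLM (n := Fin 2) (𝕜 := ℂ) (potential h m w x) (u x)) i
        = ∑ j, potential h m w x i j * u x j := fun x i => by
    rw [Matrix.ofLp_toEuclideanCLM]; rfl
  refine MemLp.of_le_mul (c := 4 * K) hu ?_ (Eventually.of_forall fun x => ?_)
  · have : AEStronglyMeasurable
        (fun x => (fun i => ∑ j, potential h m w x i j * u x j : Fin 2 → ℂ)) volume := by
      refine AEMeasurable.aestronglyMeasurable (aemeasurable_pi_lambda _ fun i => ?_)
      refine Finset.aemeasurable_fun_sum _ fun j _ => ?_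
      exact (measurable_potential hw i j).aemeasurable.mul (huj j).aemeasurable
    have h2 := (PiLp.continuous_toLp 2 (fun _ : Fin 2 => ℂ)).comp_aestronglyMeasurable this
    refine h2.congr (Eventually.of_forall fun x => ?_)
    ext i
    exact (hfi x i).symm
  · set v := Matrix.toEuclideanCLM (n := Fin 2) (𝕜 := ℂ) (potential h m w x) (u x) with hv
    have hK0 : 0 ≤ K := (norm_nonneg _).trans (hK x 0 0)
    have hcomp : ∀ i, ‖v i‖ ≤ 2 * K * ‖u x‖ := fun i => by
      rw [hv, hfi]
      refine (norm_sum_le _ _).trans ?_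
      rw [Fin.sum_univ_two, norm_mul, norm_mul]
      have := mul_le_mul (hK x i 0) (PiLp.norm_apply_le (u x) 0) (norm_nonneg _) hK0
      have := mul_le_mul (hK x i 1) (PiLp.norm_apply_le (u x) 1) (norm_nonneg _) hK0
      linarith
    have hB : 0 ≤ 2 * K * ‖u x‖ := by positivity
    have h2 : ‖v‖ ^ 2 ≤ (4 * K * ‖u x‖) ^ 2 := by
      rw [EuclideanSpace.norm_sq_eq, Fin.sum_univ_two]
      have a0 := pow_le_pow_left₀ (norm_nonneg _) (hcomp 0) 2
      have a1 := pow_le_pow_left₀ (norm_nonneg _) (hcomp 1) 2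
      nlinarith [sq_nonneg (K * ‖u x‖)]
    exact le_of_sq_le_sq h2 (by positivity)

/-- Multiplication by the bounded matrix function `α(w(r)) + β(w(r)) e^{2mθJ} R` on `L²`. -/
def potentialL2 (hw : IsStandingWave h ω m w) : L2 →ₗ[ℂ] L2 where
  toFun u := (memLp_potential hw u).toLp
  map_add' u v := by
    rw [← MemLp.toLp_add]
    refine MemLp.toLp_congr _ _ ?_
    filter_upwards [Lp.coeFn_add u v] with x hx
    rw [hx]
    exact map_add _ _ _
  map_smul' c u := by
    rw [RingHom.id_apply, ← MemLp.toLp_const_smul]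
    refine MemLp.toLp_congr _ _ ?_
    filter_upwards [Lp.coeFn_smul c u] with x hx
    rw [hx]
    simp

/-- The linearized operator `A = J (Δ - σ² + α(w(r)) + β(w(r)) e^{2mθJ} R)`, `σ² = ω`, as an
unbounded operator on `L²(ℝ², ℂ²)` with domain `H²(ℝ², ℂ²)`. -/
def linearization (hw : IsStandingWave h ω m w) : L2 →ₗ.[ℂ] L2 where
  domain := sobolevH2
  toFun :=
    ((Matrix.toEuclideanCLM (n := Fin 2) (𝕜 := ℂ) matJ).compLpL 2
        (volume : Measure Plane)).toLinearMap ∘ₗ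
      (lapL2 - (ω : ℂ) • sobolevH2.subtype + potentialL2 hw ∘ₗ sobolevH2.subtype)

end Bounded

/-! ### The radial system -/

/-- The radial operator `Δ_r - r⁻² n²` applied to `y`, where `Δ_r = d²/dr² + r⁻¹ d/dr`. -/
def radialLap (n : ℤ) (y : ℝ → ℂ) (r : ℝ) : ℂ :=
  deriv (deriv y) r + (r : ℂ)⁻¹ * deriv y r - (n : ℂ) ^ 2 / (r : ℂ) ^ 2 * y r

/-- `(yp, ym)` is a classical solution on `(0, ∞)` of the radial system with spectral parameter `z`
and twist index `j`. -/
structure IsRadialSolution (h : ℝ → ℝ) (ω : ℝ) (m : ℤ) (w : ℝ → ℝ) (z : ℂ) (j : ℤ)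
    (yp ym : ℝ → ℂ) : Prop where
  contDiffOn_plus : ContDiffOn ℝ 2 yp (Ioi 0)
  contDiffOn_minus : ContDiffOn ℝ 2 ym (Ioi 0)
  eq_plus : ∀ r : ℝ, 0 < r →
    (Complex.I * z - ω + alpha h (w r)) * yp r + radialLap (j + m) yp r
      + beta h (w r) * ym r = 0
  eq_minus : ∀ r : ℝ, 0 < r →
    (-Complex.I * z - ω + alpha h (w r)) * ym r + radialLap (j - m) ym r
      + beta h (w r) * yp r = 0

/-- The boundary conditions: a finite limit at `0⁺` and limit zero at infinity. -/
def BoundaryCondition (y : ℝ → ℂ) : Prop :=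
  (∃ l : ℂ, Tendsto y (𝓝[>] 0) (𝓝 l)) ∧ Tendsto y atTop (𝓝 0)

end SpinningWave

end

/-! Diagonalise `J`. For `σ = ±1` put `p_σ = v₀ + σ i v₁`; on `p_σ` the matrix `J` acts as `σ i`,
while `e^{2mθJ} R` sends the pair to `e^{2iσmθ} p_{-σ}`. The eigenvalue equation becomes the scalar
system `Δ p_σ = (ω - σ i z - α) p_σ - β e^{2iσmθ} p_{-σ}`, and on functions `p_σ = e^{i(j+σm)θ}
y_σ(r)` it reduces to the radial system with index `j`.

From eigenvector to radial solution: in dimension two `H²` embeds in the continuous functions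
vanishing at infinity (`exists_continuous_of_memSobolev`), so every angular Fourier mode of `p_σ`
has a limit at `0` and tends to `0` at infinity. Testing against `ψ(log r) e^{inθ}` shows that the
modes solve the radial equations weakly in `t = log r`; since the coefficients are continuous, the
lemma of du Bois-Reymond makes them classical solutions. Some mode is nonzero by completeness of the
trigonometric system.

From radial solution to eigenvector: the boundary conditions make `y_±` bounded. Two things need
proof. (1) `p_σ = e^{i(j+σm)θ} y_σ(r)` solves the equation as a distribution on the whole plane,
origin included. This is Green's identity in the variable `t` (`integral_green`): boundedness of
`y_σ` is enough to kill the boundary terms. (2) `p_σ` is square integrable. Since `α, β = O(s²)` and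
`w` decays exponentially, `(Δ - k) p_σ` is in `L²` for `k = ω - σ i z`, and `Δ - k` can be inverted
by a bounded Fourier multiplier as soon as `k ∉ (-∞, 0]` (`memSobolev_zero_of_helmholtz`). The
excluded values of `z` are `-σ i (ω + κ²)`, and these lie in the essential spectrum because
approximate plane waves are Weyl sequences there (`mem_specEss_linearization`). Then `Δ p_σ` is in
`L²` too, so the vector with components `p_σ` belongs to `H²`. -/

noncomputable section
namespace SpinningWave

/-! ### Sobolev spaces and the Helmholtz operator through Fourier multipliers -/

section Fourier

open FourierTransform TemperedDistribution
open scoped Real ContDiff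

variable {E F : Type*} [NormedAddCommGroup E] [InnerProductSpace ℝ E] [FiniteDimensional ℝ E]
  [MeasurableSpace E] [BorelSpace E] [NormedAddCommGroup F]

/-- Two locally integrable functions with the same integrals against Schwartz functions agree
almost everywhere. -/
theorem ae_eq_of_integral_schwartz_smul_eq [NormedSpace ℂ F] [CompleteSpace F] {f g : E → F}
    (hf : LocallyIntegrable f) (hg : LocallyIntegrable g)
    (h : ∀ φ : 𝓢(E, ℂ), ∫ x, φ x • f x = ∫ x, φ x • g x) : f =ᵐ[volume] g := by
  refine ae_eq_of_integral_contDiff_smul_eq hf hg fun ψ hψ hc => ?_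
  have h1 : HasCompactSupport (Complex.ofRealCLM ∘ ψ) := hc.comp_left rfl
  have h2 : ContDiff ℝ ∞ (Complex.ofRealCLM ∘ ψ) := by fun_prop
  simpa using h (h1.toSchwartzMap h2)

/-- The Sobolev embedding of `H^s`, `s > d / 2`, into the continuous functions that vanish at
infinity. -/
theorem exists_continuous_of_memSobolev [InnerProductSpace ℂ F] [CompleteSpace F] {s : ℝ}
    (hs : Module.finrank ℝ E < 2 * s) (u : Lp F 2 (volume : Measure E))
    (hu : MemSobolev s 2 (u : 𝓢'(E, F))) :
    ∃ g : E → F, Continuous g ∧ Tendsto g (cocompact E) (𝓝 0) ∧ u =ᵐ[volume] g := by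
  -- For `s > d/2` the transform `v` of `u` is integrable. The continuous representative is its
  -- inverse transform, written as the transform of `v (-ξ)`, and the Riemann–Lebesgue lemma gives
  -- the limit at infinity.
  obtain ⟨v, hv⟩ := hu.fourier_memL1 hs
  have hvi : Integrable v := memLp_one_iff_integrable.mp (Lp.memLp v)
  have hgc : Continuous (𝓕 (fun ξ => v (-ξ))) :=
    VectorFourier.fourierIntegral_continuous Real.continuous_fourierChar
      (by exact continuous_inner) hvi.comp_neg
  refine ⟨𝓕 (fun ξ => v (-ξ)), hgc, tendsto_integral_exp_inner_smul_cocompact _, ?_⟩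
  refine ae_eq_of_integral_schwartz_smul_eq
    ((Lp.memLp u).locallyIntegrable (by norm_num)) hgc.locallyIntegrable fun φ => ?_
  have h1 : (𝓕 (u : 𝓢'(E, F))) (𝓕⁻ φ) = ∫ x, φ x • u x := by
    rw [TemperedDistribution.fourier_apply, fourier_fourierInv_eq,
      Lp.toTemperedDistribution_apply]
  rw [← h1, hv, Lp.toTemperedDistribution_apply]
  have h2 : ∫ ξ, (𝓕⁻ φ : 𝓢(E, ℂ)) ξ • v ξ = ∫ ξ, 𝓕 (φ : E → ℂ) ξ • v (-ξ) := by
    rw [← integral_neg_eq_self]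
    refine integral_congr_ae (Eventually.of_forall fun ξ => ?_)
    simp only [SchwartzMap.fourierInv_coe, Real.fourierInv_eq_fourier_neg, neg_neg]
  rw [h2]
  exact VectorFourier.integral_fourierIntegral_smul_eq_flip (L := innerₗ E)
    Real.continuous_fourierChar continuous_inner φ.integrable hvi.comp_neg |>.trans (by
      simp only [flip_innerₗ]; rfl)

/-- A function in `L²` with distributional Laplacian in `L²` belongs to `H²`. -/
theorem memSobolev_two_of_laplacian [NormedSpace ℂ F] [CompleteSpace F] {p : ℝ≥0∞}
    [Fact (1 ≤ p)] (u f : Lp F p (volume : Measure E))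
    (h : Δ (u : 𝓢'(E, F)) = (f : 𝓢'(E, F))) : MemSobolev 2 p (u : 𝓢'(E, F)) := by
  -- The Bessel potential of order `2` has symbol `1 + |x|²` and `Δ` has symbol `-(2π)² |x|²`, so
  -- the potential of `u` is `u - (2π)⁻² Δ u`.
  refine ⟨u - ((((2 * π) ^ 2)⁻¹ : ℝ) : ℂ) • f, ?_⟩
  have h1 : (fun x : E => (((1 + ‖x‖ ^ 2) ^ ((2 : ℝ) / 2) : ℝ) : ℂ))
      = (fun _ => (1 : ℂ)) + fun x => ((‖x‖ ^ 2 : ℝ) : ℂ) := by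
    ext x; simp
  have h2 : besselPotential E F 2 (u : 𝓢'(E, F)) = (u : 𝓢'(E, F)) +
      fourierMultiplierCLM F (fun x => ((‖x‖ ^ 2 : ℝ) : ℂ)) (u : 𝓢'(E, F)) := by
    rw [besselPotential, h1, fourierMultiplierCLM_apply, smulLeftCLM_add (by fun_prop)
      (by fun_prop), add_apply, FourierTransform.fourierInv_add,
      ← fourierMultiplierCLM_apply, ← fourierMultiplierCLM_apply, fourierMultiplierCLM_const]
    simp
  have h3 : fourierMultiplierCLM F (fun x => ((‖x‖ ^ 2 : ℝ) : ℂ)) (u : 𝓢'(E, F))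
      = -(((((2 * π) ^ 2)⁻¹ : ℝ) : ℂ) • (f : 𝓢'(E, F))) := by
    rw [← h, laplacian_eq_fourierMultiplierCLM, Complex.coe_smul, neg_smul, smul_neg, neg_neg,
      smul_smul, inv_mul_cancel₀ (by positivity), one_smul]
  rw [h2, h3, ← Lp.toTemperedDistributionCLM_apply, ← Lp.toTemperedDistributionCLM_apply,
    ← Lp.toTemperedDistributionCLM_apply, map_sub, map_smul, sub_eq_add_neg]

/-- The inverse of the symbol `k + c |x|²` has temperate growth when `k ∉ (-∞, 0]`. -/
theorem hasTemperateGrowth_inv_symbol {E : Type*} [NormedAddCommGroup E]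
    [InnerProductSpace ℝ E] {k : ℂ} (hk : k ∈ Complex.slitPlane) {c : ℝ} (hc : 0 < c) :
    (fun x : E => (k + ((c * ‖x‖ ^ 2 : ℝ) : ℂ))⁻¹).HasTemperateGrowth := by
  by_cases him : k.im = 0
  · have hre : 0 < k.re := by
      rcases Complex.mem_slitPlane_iff.mp hk with h | h
      · exact h
      · exact absurd him h
    -- For real `k > 0` the inverse symbol is a rescaling of `(1 + |x|²)⁻¹`.
    have hb := (Function.hasTemperateGrowth_one_add_norm_sq_rpow E (-1)).comp
      (show (fun x : E => Real.sqrt (c / k.re) • x).HasTemperateGrowth by fun_prop)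
    have : (fun x : E => (k + ((c * ‖x‖ ^ 2 : ℝ) : ℂ))⁻¹) = fun x : E =>
        ((k.re⁻¹ * (1 + ‖Real.sqrt (c / k.re) • x‖ ^ 2) ^ (-1 : ℝ) : ℝ) : ℂ) := by
      ext x
      have hkr : k = (k.re : ℂ) := Complex.ext rfl (by simp [him])
      rw [hkr, ← Complex.ofReal_add, ← Complex.ofReal_inv, norm_smul, mul_pow, Real.norm_eq_abs,
        sq_abs, Real.sq_sqrt (by positivity), Real.rpow_neg_one]
      simp only [Complex.ofReal_re]
      congr 1
      rw [← mul_inv]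
      congr 1
      field_simp
    rw [this]
    simp only [Function.comp_def] at hb
    fun_prop
  -- For non-real `k`, multiply by the conjugate: the denominator is `(Im k)² (1 + ((Re k + c|x|²) /
  -- Im k)²)`.
  · have hb := (Function.hasTemperateGrowth_one_add_norm_sq_rpow ℝ (-1)).comp
      (show (fun x : E => (k.re + c * ‖x‖ ^ 2) / k.im).HasTemperateGrowth by
        simp only [div_eq_mul_inv]; fun_prop)
    have : (fun x : E => (k + ((c * ‖x‖ ^ 2 : ℝ) : ℂ))⁻¹) = fun x : E =>
        ((starRingEnd ℂ) k + ((c * ‖x‖ ^ 2 : ℝ) : ℂ)) *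
        (((k.im ^ 2)⁻¹ * (1 + ‖(k.re + c * ‖x‖ ^ 2) / k.im‖ ^ 2) ^ (-1 : ℝ) : ℝ) : ℂ) := by
      ext x
      rw [Complex.inv_def]
      congr 1
      · simp
      · congr 1
        rw [Real.rpow_neg_one, ← mul_inv]
        congr 1
        rw [Complex.normSq_apply, Real.norm_eq_abs, sq_abs]
        simp only [Complex.add_re, Complex.add_im, Complex.ofReal_re, Complex.ofReal_im]
        field_simp
        ring
    rw [this]
    simp only [Function.comp_def] at hb
    fun_prop

/-- The symbol `k + t`, `t ≥ 0`, is bounded below when `k ∉ (-∞, 0]`. -/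
theorem exists_le_norm_add {k : ℂ} (hk : k ∈ Complex.slitPlane) :
    ∃ δ > 0, ∀ t : ℝ, 0 ≤ t → δ ≤ ‖k + (t : ℂ)‖ := by
  by_cases him : k.im = 0
  · have hre : 0 < k.re := by
      rcases Complex.mem_slitPlane_iff.mp hk with h | h
      · exact h
      · exact absurd him h
    refine ⟨k.re, hre, fun t ht => ?_⟩
    calc k.re ≤ (k + (t : ℂ)).re := by simpa using ht
      _ ≤ _ := Complex.re_le_norm _
  · refine ⟨|k.im|, abs_pos.mpr him, fun t _ => ?_⟩
    simpa using Complex.abs_im_le_norm (k + (t : ℂ))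

/-- If `(Δ - k) T` is in `L²` and `k ∉ (-∞, 0]`, then the tempered distribution `T` is in `L²`. -/
theorem memSobolev_zero_of_helmholtz [InnerProductSpace ℂ F] [CompleteSpace F] {k : ℂ}
    (hk : k ∈ Complex.slitPlane) {T : 𝓢'(E, F)} (f : Lp F 2 (volume : Measure E))
    (h : Δ T - k • T = (f : 𝓢'(E, F))) : MemSobolev 0 2 T := by
  have hc : (0 : ℝ) < (2 * π) ^ 2 := by positivity
  set s : E → ℂ := fun x => k + (((2 * π) ^ 2 * ‖x‖ ^ 2 : ℝ) : ℂ) with hs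
  have hst : s.HasTemperateGrowth := by fun_prop
  have hit := hasTemperateGrowth_inv_symbol (E := E) hk hc
  obtain ⟨δ, hδ, hle⟩ := exists_le_norm_add hk
  have hsn : ∀ x, δ ≤ ‖s x‖ := fun x => hle _ (by positivity)
  have h1 : fourierMultiplierCLM F s T = -(f : 𝓢'(E, F)) := by
    have : s = (fun _ => k) + ((((2 * π) ^ 2 : ℝ) : ℂ) • fun x : E => ((‖x‖ ^ 2 : ℝ) : ℂ)) := by
      ext x; simp [hs]
    rw [this, fourierMultiplierCLM_apply, smulLeftCLM_add (by fun_prop)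
      (by apply Function.HasTemperateGrowth.smul <;> fun_prop),
      add_apply, FourierTransform.fourierInv_add,
      ← fourierMultiplierCLM_apply, ← fourierMultiplierCLM_apply, fourierMultiplierCLM_const,
      fourierMultiplierCLM_smul (by fun_prop), ← h, laplacian_eq_fourierMultiplierCLM]
    simp only [smul_apply, ContinuousLinearMap.id_apply, Complex.coe_smul,
      neg_smul]
    abel
  -- Temperate growth of `1/s` allows division by the symbol for any tempered `T`; the bound `|1/s|
  -- ≤ 1/δ` then preserves `L²`.
  have h2 : T = fourierMultiplierCLM F (fun x => (s x)⁻¹) (-(f : 𝓢'(E, F))) := by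
    rw [← h1, fourierMultiplierCLM_fourierMultiplierCLM_apply hst hit]
    have : s * (fun x => (s x)⁻¹) = fun _ => 1 := by
      ext x
      exact mul_inv_cancel₀ (norm_pos_iff.mp (hδ.trans_le (hsn x)))
    rw [this, fourierMultiplierCLM_const]
    simp
  rw [h2]
  refine (memSobolev_zero_iff.mpr ⟨f, rfl⟩).neg.fourierMultiplierCLM_of_bounded hit
    ⟨δ⁻¹, fun x => ?_⟩
  rw [norm_inv]
  exact inv_anti₀ hδ (hsn x)

end Fourier

/-! ### Quadratic vanishing of the coefficients and their decay along the wave -/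

section Decay

variable {h w : ℝ → ℝ} {ω : ℝ} {m : ℤ}

/-- The hypothesis on `g'` gives the bound near `0`, and compactness of `[-C, C]` extends it. The
quotient `g(s)/s` inherits the bound from `g'` by the mean value inequality, as `g(0) = 0`. -/
theorem exists_quadratic_bound (hw : IsStandingWave h ω m w) (C : ℝ) :
    ∃ K : ℝ, 0 ≤ K ∧ ∀ s : ℝ, |s| ≤ C → |alpha h s| ≤ K * s ^ 2 ∧ |beta h s| ≤ K * s ^ 2 := by
  obtain ⟨K₁, hK₁, hb₁⟩ := hw.deriv_nonlin.exists_pos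
  obtain ⟨δ, hδ, hb₁⟩ := Metric.eventually_nhds_iff.mp hb₁.bound
  have hcd : Continuous (deriv (realNonlin h)) := hw.contDiff_nonlin.continuous_deriv le_rfl
  obtain ⟨M, hM⟩ := (isCompact_Icc (a := -C) (b := C)).exists_bound_of_continuousOn
    hcd.continuousOn
  -- Where `|s| ≥ δ`, the bound `M` on `g'` is at most `(|M| / δ²) s²`.
  set K := max K₁ (|M| / δ ^ 2) with hK
  have hK0 : 0 ≤ K := hK₁.le.trans (le_max_left _ _)
  have hd : ∀ s : ℝ, |s| ≤ C → |deriv (realNonlin h) s| ≤ K * s ^ 2 := fun s hs => by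
    by_cases hsd : |s| < δ
    · have := hb₁ (y := s) (by simpa using hsd)
      rw [Real.norm_eq_abs, Real.norm_eq_abs, abs_of_nonneg (sq_nonneg s)] at this
      exact this.trans (mul_le_mul_of_nonneg_right (le_max_left _ _) (sq_nonneg s))
    · have h1 := (hM s (abs_le.mp hs)).trans (le_abs_self M)
      have h2 : δ ^ 2 ≤ s ^ 2 := by
        rw [← sq_abs s]; exact pow_le_pow_left₀ hδ.le (not_lt.mp hsd) 2
      calc |deriv (realNonlin h) s| ≤ |M| / δ ^ 2 * δ ^ 2 := by
            rw [div_mul_cancel₀ _ (by positivity)]; exact h1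
        _ ≤ K * s ^ 2 := mul_le_mul (le_max_right _ _) h2 (by positivity) hK0
  have hq : ∀ s : ℝ, |s| ≤ C → |realNonlin h s / s| ≤ K * s ^ 2 := fun s hs => by
    have := (convex_Icc (-|s|) |s|).norm_image_sub_le_of_norm_deriv_le
      (f := realNonlin h) (C := K * s ^ 2) (x := 0) (y := s)
      (fun x _ => (hw.contDiff_nonlin.differentiable one_ne_zero) x)
      (fun x hx => (hd x ((abs_le.mpr hx).trans hs)).trans
        (mul_le_mul_of_nonneg_left (sq_le_sq.mpr (abs_le.mpr hx)) hK0))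
      ⟨by simp, by simp⟩ (abs_le.mp le_rfl)
    have h00 : realNonlin h 0 = 0 := by simp [realNonlin]
    rw [h00, sub_zero, sub_zero, Real.norm_eq_abs, Real.norm_eq_abs] at this
    rw [abs_div]
    exact div_le_of_le_mul₀ (abs_nonneg _) (by positivity) this
  refine ⟨K, hK0, fun s hs => ?_⟩
  have h1 := abs_le.mp (hd s hs)
  have h2 := abs_le.mp (hq s hs)
  have h3 : 0 ≤ K * s ^ 2 := by positivity
  constructor
  · unfold alpha
    split_ifs
    · simpa using h3
    · rw [abs_le]; constructor <;> linarith [h1.1, h1.2, h2.1, h2.2]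
  · unfold beta
    split_ifs
    · simpa using h3
    · rw [abs_le]; constructor <;> linarith [h1.1, h1.2, h2.1, h2.2]

/-- Serves both `α` and `β`: the quadratic bound makes the prescribed value `0` at `s = 0` the right
one for continuity. -/
theorem continuous_of_quadratic_bound {f F : ℝ → ℝ} {K : ℝ}
    (hb : ∀ s : ℝ, |s| ≤ 1 → |f s| ≤ K * s ^ 2) (hF : ∀ s, s ≠ 0 → f s = F s)
    (hc : ∀ s, s ≠ 0 → ContinuousAt F s) : Continuous f := by
  refine continuous_iff_continuousAt.mpr fun s => ?_
  by_cases hs : s = 0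
  · subst hs
    have h0 : f 0 = 0 := by simpa using hb 0 (by simp)
    rw [ContinuousAt, h0]
    refine squeeze_zero_norm' (a := fun s => K * s ^ 2) ?_ ?_
    · filter_upwards [Metric.ball_mem_nhds (0 : ℝ) one_pos] with s hs
      exact hb s (by simpa using (mem_ball_zero_iff.mp hs).le)
    · have : Continuous fun s : ℝ => K * s ^ 2 := by fun_prop
      simpa using this.tendsto 0
  · refine (hc s hs).congr ?_
    filter_upwards [isOpen_ne.mem_nhds hs] with t ht
    exact (hF t ht).symm

theorem continuous_alpha (hw : IsStandingWave h ω m w) : Continuous (alpha h) := by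
  obtain ⟨K, -, hK⟩ := exists_quadratic_bound hw 1
  have h1 : Continuous (deriv (realNonlin h)) := hw.contDiff_nonlin.continuous_deriv le_rfl
  have h2 : Continuous (realNonlin h) := hw.contDiff_nonlin.continuous
  refine continuous_of_quadratic_bound (fun s hs => (hK s hs).1)
    (F := fun s => (deriv (realNonlin h) s + realNonlin h s / s) / 2)
    (fun s hs => by simp [alpha, hs]) fun s hs => ?_
  exact (h1.continuousAt.add (h2.continuousAt.div continuousAt_id hs)).div_const 2

theorem continuous_beta (hw : IsStandingWave h ω m w) : Continuous (beta h) := by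
  obtain ⟨K, -, hK⟩ := exists_quadratic_bound hw 1
  have h1 : Continuous (deriv (realNonlin h)) := hw.contDiff_nonlin.continuous_deriv le_rfl
  have h2 : Continuous (realNonlin h) := hw.contDiff_nonlin.continuous
  refine continuous_of_quadratic_bound (fun s hs => (hK s hs).2)
    (F := fun s => (deriv (realNonlin h) s - realNonlin h s / s) / 2)
    (fun s hs => by simp [beta, hs]) fun s hs => ?_
  exact (h1.continuousAt.sub (h2.continuousAt.div continuousAt_id hs)).div_const 2

/-- On the positive half-axis the polar angle is `0`, so there the profile is `w` itself. For `r <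
0` nothing is known about `w`. -/
theorem continuousOn_profile (hw : IsStandingWave h ω m w) : ContinuousOn w (Ici 0) := by
  have e : Continuous fun r : ℝ => (profile m w (WithLp.toLp 2 ![r, 0])).re := by
    have e1 : Continuous fun r : ℝ => (WithLp.toLp 2 ![r, 0] : Plane) :=
      (PiLp.continuous_toLp 2 _).comp (by fun_prop)
    exact Complex.continuous_re.comp (hw.contDiff_profile.continuous.comp e1)
  refine e.continuousOn.congr fun r hr => ?_
  have hr0 : 0 ≤ r := hr
  have ha : angle (WithLp.toLp 2 ![r, 0]) = 0 := by
    simp only [angle]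
    exact Complex.arg_ofReal_of_nonneg hr0
  have hn : ‖(WithLp.toLp 2 ![r, 0] : Plane)‖ = r := by
    simp [EuclideanSpace.norm_eq, Real.sqrt_sq hr0]
  simp [profile, ha, hn]

/-- Comparison with `(1 + |x|)⁻³`, integrable in dimension two; the factor `6 = 3!` comes from the
cubic term of the exponential series. -/
theorem integrable_exp_neg_norm {a : ℝ} (ha : 0 < a) :
    Integrable fun x : Plane => Real.exp (-(a * ‖x‖)) := by
  have hi := (integrable_one_add_norm (E := Plane) (μ := volume) (r := 3)
    (by norm_num)).const_mul (Real.exp a * 6 / a ^ 3)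
  refine hi.mono' (by fun_prop) (Eventually.of_forall fun x => ?_)
  have h1 : 0 < 1 + ‖x‖ := by positivity
  have h2 := Real.pow_div_factorial_le_exp (x := a * (1 + ‖x‖)) (by positivity) 3
  have h3 : Real.exp (-(a * ‖x‖)) = Real.exp a * (Real.exp (a * (1 + ‖x‖)))⁻¹ := by
    rw [← Real.exp_neg, ← Real.exp_add]; congr 1; ring
  rw [Real.norm_eq_abs, abs_of_pos (Real.exp_pos _), h3, Real.rpow_neg h1.le]
  have h4 : ((1 + ‖x‖) ^ (3 : ℝ)) = (1 + ‖x‖) ^ 3 := by norm_cast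
  rw [h4]
  have h5 : (Real.exp (a * (1 + ‖x‖)))⁻¹ ≤ ((a * (1 + ‖x‖)) ^ 3 / 6)⁻¹ :=
    inv_anti₀ (by positivity) (by simpa [Nat.factorial] using h2)
  calc Real.exp a * (Real.exp (a * (1 + ‖x‖)))⁻¹
      ≤ Real.exp a * ((a * (1 + ‖x‖)) ^ 3 / 6)⁻¹ := by gcongr
    _ = _ := by field_simp

/-- The coefficients `α(w(r))`, `β(w(r))` are dominated by a square integrable function. -/
theorem exists_memLp_bound (hw : IsStandingWave h ω m w) :
    ∃ W : Plane → ℝ, MemLp W 2 ∧ (∀ x, 0 ≤ W x) ∧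
      ∀ x, |alpha h (w ‖x‖)| ≤ W x ∧ |beta h (w ‖x‖)| ≤ W x := by
  obtain ⟨C, hC, κ, hκ, hb⟩ := hw.localized
  obtain ⟨K, hK0, hK⟩ := exists_quadratic_bound hw C
  refine ⟨fun x => K * (C * Real.exp (-(κ * ‖x‖))) ^ 2, ?_, fun x => by positivity, fun x => ?_⟩
  · rw [memLp_two_iff_integrable_sq (by fun_prop)]
    refine ((integrable_exp_neg_norm (a := 4 * κ) (by positivity)).const_mul (K ^ 2 * C ^ 4)).congr
      (Eventually.of_forall fun x => ?_)
    have : Real.exp (-(4 * κ * ‖x‖)) = Real.exp (-(κ * ‖x‖)) ^ 4 := by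
      rw [← Real.exp_nat_mul]; congr 1; push_cast; ring
    simp only [this]; ring
  · have h1 := hb ‖x‖ (norm_nonneg x)
    have h2 : |w ‖x‖| ≤ C := h1.trans (by
      have : Real.exp (-(κ * ‖x‖)) ≤ 1 := Real.exp_le_one_iff.mpr (by
        have := norm_nonneg x; nlinarith)
      nlinarith)
    have h3 : K * w ‖x‖ ^ 2 ≤ K * (C * Real.exp (-(κ * ‖x‖))) ^ 2 := by
      rw [← sq_abs (w ‖x‖)]; gcongr
    exact ⟨(hK _ h2).1.trans h3, (hK _ h2).2.trans h3⟩

end Decay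

/-! ### Approximate plane waves -/

section PlaneWave

open FourierTransform
open scoped Real ContDiff

theorem lapL2_eq {u : sobolevH2} {f : L2}
    (h : Δ ((u : L2) : 𝓢'(Plane, C2)) = (f : 𝓢'(Plane, C2))) : lapL2 u = f :=
  toTemperedDistribution_injective ((exists_laplacian u).choose_spec.symm.trans h)

theorem laplacian_lapL2 (u : sobolevH2) :
    Δ ((u : L2) : 𝓢'(Plane, C2)) = (lapL2 u : 𝓢'(Plane, C2)) :=
  (exists_laplacian u).choose_spec

theorem norm_fourierInv_toLp_two (f : 𝓢(Plane, ℂ)) : ‖(𝓕⁻ f).toLp 2‖ = ‖f.toLp 2‖ := by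
  rw [← SchwartzMap.norm_fourier_toL2_eq (𝓕⁻ f), fourier_fourierInv_eq]

/-- Schwartz functions concentrated in a small ball have small `L¹` norm compared with the `L²`
norm. -/
theorem exists_schwartz_in_ball (ξ₀ : Plane) {r : ℝ} (hr : 0 < r) :
    ∃ η : 𝓢(Plane, ℂ), (∀ x ∉ Metric.ball ξ₀ r, η x = 0) ∧ 0 < ‖η.toLp 2‖ ∧
      ‖η.toLp 1‖ ≤ 2 * √π * r * ‖η.toLp 2‖ := by
  -- The bump is `1` on the ball of radius `r/2` and supported in that of radius `r`: its `L¹` norm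
  -- is at most `π r²`, its `L²` norm at least `√π r / 2`.
  let b : ContDiffBump ξ₀ := ⟨r / 2, r, by positivity, by linarith⟩
  have hc : HasCompactSupport (Complex.ofRealCLM ∘ b) := b.hasCompactSupport.comp_left rfl
  have hs : ContDiff ℝ ∞ (Complex.ofRealCLM ∘ b) := Complex.ofRealCLM.contDiff.comp b.contDiff
  obtain ⟨η, hηb⟩ : ∃ η : 𝓢(Plane, ℂ), ∀ x, η x = (b x : ℂ) :=
    ⟨hc.toSchwartzMap hs, fun x => rfl⟩
  have hnη : ∀ x, ‖η x‖ = b x := fun x => by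
    rw [hηb, Complex.norm_real, Real.norm_eq_abs, abs_of_nonneg b.nonneg]
  have hvol : ∀ ρ : ℝ, 0 ≤ ρ → volume.real (Metric.ball ξ₀ ρ) = π * ρ ^ 2 := fun ρ hρ => by
    rw [Measure.real, EuclideanSpace.volume_ball_fin_two, ENNReal.toReal_mul, ENNReal.toReal_pow,
      ENNReal.toReal_ofReal hρ]
    simp [mul_comm, Real.pi_pos.le]
  have hL1 : ‖η.toLp 1‖ ≤ π * r ^ 2 := by
    rw [SchwartzMap.norm_toLp_one]
    have : ∀ x, ‖η x‖ ≤ (Metric.ball ξ₀ r).indicator (fun _ => (1 : ℝ)) x := fun x => by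
      by_cases hx : x ∈ Metric.ball ξ₀ r
      · rw [indicator_of_mem hx, hnη]; exact b.le_one
      · rw [indicator_of_notMem hx, hnη]
        exact (b.zero_of_le_dist (by simpa using hx)).le
    calc ∫ x, ‖η x‖ ≤ ∫ x, (Metric.ball ξ₀ r).indicator (fun _ => (1 : ℝ)) x :=
          integral_mono η.integrable.norm
            ((integrable_indicator_iff measurableSet_ball).mpr
              (integrableOn_const measure_ball_lt_top.ne)) this
      _ = _ := by
          rw [integral_indicator measurableSet_ball, setIntegral_const, hvol r hr.le]; simp
  have hL2 : √π * r / 2 ≤ ‖η.toLp 2‖ := by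
    have h1 : ‖η.toLp 2‖ ^ 2 = ∫ x, ‖η x‖ ^ 2 := by
      rw [SchwartzMap.norm_toLp' (by norm_num) (by norm_num)]
      have h0 : 0 ≤ ∫ x : Plane, ‖η x‖ ^ 2 := integral_nonneg fun x => by positivity
      simp only [ENNReal.toReal_ofNat, Real.rpow_ofNat]
      rw [← Real.rpow_natCast, ← Real.rpow_mul h0]
      norm_num
    have h2 : π * (r / 2) ^ 2 ≤ ‖η.toLp 2‖ ^ 2 := by
      rw [h1, ← hvol _ (by positivity)]
      have : volume.real (Metric.ball ξ₀ (r / 2)) =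
          ∫ x, (Metric.ball ξ₀ (r / 2)).indicator (fun _ => (1 : ℝ)) x := by
        rw [integral_indicator measurableSet_ball, setIntegral_const]; simp
      rw [this]
      refine integral_mono ((integrable_indicator_iff measurableSet_ball).mpr
        (integrableOn_const measure_ball_lt_top.ne))
        ((memLp_two_iff_integrable_sq_norm η.continuous.aestronglyMeasurable).mp (η.memLp 2))
        fun x => ?_
      by_cases hx : x ∈ Metric.ball ξ₀ (r / 2)
      · simp only [indicator_of_mem hx, hnη]
        rw [b.one_of_mem_closedBall (Metric.ball_subset_closedBall hx)]; norm_num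
      · simp only [indicator_of_notMem hx]; positivity
    refine le_of_sq_le_sq ?_ (norm_nonneg _)
    calc (√π * r / 2) ^ 2 = √π ^ 2 * (r / 2) ^ 2 := by ring
      _ = π * (r / 2) ^ 2 := by rw [Real.sq_sqrt (by positivity)]
      _ ≤ _ := h2
  refine ⟨η, fun x hx => ?_, lt_of_lt_of_le (by positivity) hL2, ?_⟩
  · rw [hηb, b.zero_of_le_dist (by simpa using hx)]; simp
  · have key : ∀ N : ℝ, √π * r / 2 ≤ N → π * r ^ 2 ≤ 2 * √π * r * N := fun N hN => by
      calc π * r ^ 2 = √π ^ 2 * r ^ 2 := by rw [Real.sq_sqrt (by positivity)]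
        _ = 2 * √π * r * (√π * r / 2) := by ring
        _ ≤ 2 * √π * r * N := by gcongr
    exact hL1.trans (key _ hL2)

/-- Approximate plane waves: Schwartz functions that nearly solve `Δφ = -κ² φ` in `L²` and that are
uniformly small compared with their `L²` norm. -/
theorem exists_approximate_planeWave {κ : ℝ} (hκ : 0 ≤ κ) {ε : ℝ} (hε : 0 < ε) :
    ∃ φ : 𝓢(Plane, ℂ), 0 < ‖φ.toLp 2‖ ∧
      ‖(Δ φ + ((κ ^ 2 : ℝ) : ℂ) • φ).toLp 2‖ ≤ ε * ‖φ.toLp 2‖ ∧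
      ∀ x, ‖φ x‖ ≤ ε * ‖φ.toLp 2‖ := by
  -- The symbol `-(2π)² |ξ|²` of `Δ` equals `-κ²` at this frequency.
  set ξ₀ : Plane := EuclideanSpace.single 0 (κ / (2 * π)) with hξ₀
  have hξn : ‖ξ₀‖ = κ / (2 * π) := by
    rw [hξ₀, PiLp.norm_single, Real.norm_eq_abs, abs_of_nonneg (by positivity)]
  -- The first quantity bounds the symbol of `Δ + κ²` on the ball of radius `r` about `ξ₀`. The
  -- second is the ratio of the `L¹` to the `L²` norm of the bump, and the `L¹` norm in frequency
  -- controls the supremum in space.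
  obtain ⟨r, hr, hr1, hr2⟩ : ∃ r > 0, 4 * π ^ 2 * (r * (2 * ‖ξ₀‖ + r)) ≤ ε ∧
      2 * √π * r ≤ ε := by
    have e1 : Tendsto (fun r : ℝ => 4 * π ^ 2 * (r * (2 * ‖ξ₀‖ + r))) (𝓝[>] 0) (𝓝 0) := by
      have : Continuous fun r : ℝ => 4 * π ^ 2 * (r * (2 * ‖ξ₀‖ + r)) := by fun_prop
      simpa using (this.tendsto 0).mono_left nhdsWithin_le_nhds
    have e2 : Tendsto (fun r : ℝ => 2 * √π * r) (𝓝[>] 0) (𝓝 0) := by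
      have : Continuous fun r : ℝ => 2 * √π * r := by fun_prop
      simpa using (this.tendsto 0).mono_left nhdsWithin_le_nhds
    obtain ⟨r, h1, h2, h3⟩ := ((e1.eventually (eventually_le_nhds hε)).and
      ((e2.eventually (eventually_le_nhds hε)).and self_mem_nhdsWithin)).exists
    exact ⟨r, h3, h1, h2⟩
  obtain ⟨η, hηz, hpos, hL1⟩ := exists_schwartz_in_ball ξ₀ hr
  refine ⟨𝓕⁻ η, by rwa [norm_fourierInv_toLp_two], ?_, fun x => ?_⟩
  · have hg : (fun x : Plane => ‖x‖ ^ 2).HasTemperateGrowth := by fun_prop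
    have h1 : Δ (𝓕⁻ η) + ((κ ^ 2 : ℝ) : ℂ) • 𝓕⁻ η = 𝓕⁻ (-(2 * π) ^ 2 •
        SchwartzMap.smulLeftCLM ℂ (fun x : Plane => ‖x‖ ^ 2) η + ((κ ^ 2 : ℝ) : ℂ) • η) := by
      rw [SchwartzMap.laplacian_eq_fourierMultiplierCLM, SchwartzMap.fourierMultiplierCLM_apply,
        fourier_fourierInv_eq, FourierTransform.fourierInv_add, FourierTransform.fourierInv_smul,
        FourierTransform.fourierInv_smul]
    rw [h1, norm_fourierInv_toLp_two, norm_fourierInv_toLp_two]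
    refine Lp.norm_le_mul_norm_of_ae_le_mul ?_
    filter_upwards [SchwartzMap.coeFn_toLp η 2, SchwartzMap.coeFn_toLp (-(2 * π) ^ 2 •
        SchwartzMap.smulLeftCLM ℂ (fun x : Plane => ‖x‖ ^ 2) η + ((κ ^ 2 : ℝ) : ℂ) • η) 2]
      with x hx1 hx2
    rw [hx1, hx2]
    have h2 : (-(2 * π) ^ 2 • SchwartzMap.smulLeftCLM ℂ (fun x : Plane => ‖x‖ ^ 2) η +
        ((κ ^ 2 : ℝ) : ℂ) • η) x = ((4 * π ^ 2 * (‖ξ₀‖ ^ 2 - ‖x‖ ^ 2) : ℝ) : ℂ) * η x := by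
      have : κ ^ 2 = 4 * π ^ 2 * ‖ξ₀‖ ^ 2 := by rw [hξn]; field_simp; ring
      rw [add_apply, smul_apply, smul_apply,
        SchwartzMap.smulLeftCLM_apply_apply hg, this]
      simp only [Complex.real_smul, smul_eq_mul]
      push_cast; ring
    rw [h2, norm_mul, Complex.norm_real, Real.norm_eq_abs]
    by_cases hx : x ∈ Metric.ball ξ₀ r
    · refine mul_le_mul_of_nonneg_right ?_ (norm_nonneg _)
      refine le_trans ?_ hr1
      rw [abs_mul, abs_of_nonneg (by positivity : 0 ≤ 4 * π ^ 2)]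
      refine mul_le_mul_of_nonneg_left ?_ (by positivity)
      have h3 : |‖x‖ - ‖ξ₀‖| ≤ r :=
        (abs_norm_sub_norm_le x ξ₀).trans (mem_ball_iff_norm.mp hx).le
      have h4 := abs_le.mp h3
      have h5 : ‖ξ₀‖ ^ 2 - ‖x‖ ^ 2 = (‖ξ₀‖ - ‖x‖) * (‖ξ₀‖ + ‖x‖) := by ring
      rw [h5, abs_mul, abs_sub_comm, abs_of_nonneg (by positivity : 0 ≤ ‖ξ₀‖ + ‖x‖)]
      exact mul_le_mul h3 (by linarith) (by positivity) hr.le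
    · simp [hηz x hx]
  · rw [norm_fourierInv_toLp_two]
    have h1 : ‖(𝓕⁻ η) x‖ ≤ ‖η.toLp 1‖ := by
      have := SchwartzMap.norm_fourier_apply_le_toLp_one η (-x)
      rwa [SchwartzMap.fourier_coe, ← Real.fourierInv_eq_fourier_neg,
        ← SchwartzMap.fourierInv_coe] at this
    exact h1.trans (hL1.trans (mul_le_mul_of_nonneg_right hr2 (norm_nonneg _)))

end PlaneWave

/-! ### The half-lines `±i[ω, ∞)` lie in the essential spectrum -/

section Weyl

variable {h w : ℝ → ℝ} {ω : ℝ} {m : ℤ}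

theorem norm_potential_apply_le (x : Plane) (i j : Fin 2) :
    ‖potential h m w x i j‖ ≤ |alpha h (w ‖x‖)| + |beta h (w ‖x‖)| := by
  have hc : ‖(expJ (2 * m * angle x) * matR) i j‖ ≤ 1 := by
    have hcos := Real.abs_cos_le_one (2 * m * angle x)
    have hsin := Real.abs_sin_le_one (2 * m * angle x)
    fin_cases i <;> fin_cases j <;>
      simp [expJ, matJ, matR, Matrix.mul_apply, Fin.sum_univ_two,
        -Complex.ofReal_cos, -Complex.ofReal_sin, hcos, hsin]
  have h1 : ‖(1 : Matrix (Fin 2) (Fin 2) ℂ) i j‖ ≤ 1 := by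
    fin_cases i <;> fin_cases j <;> simp
  simp only [potential, Matrix.add_apply, Matrix.smul_apply, smul_eq_mul]
  refine (norm_add_le _ _).trans (add_le_add ?_ ?_)
  · rw [norm_mul, Complex.norm_real]
    exact mul_le_of_le_one_right (abs_nonneg _) h1
  · rw [norm_mul, Complex.norm_real]
    exact mul_le_of_le_one_right (abs_nonneg _) hc

theorem norm_toEuclideanCLM_le {M : Matrix (Fin 2) (Fin 2) ℂ} {K : ℝ} (hK : ∀ i j, ‖M i j‖ ≤ K)
    (v : C2) : ‖Matrix.toEuclideanCLM (n := Fin 2) (𝕜 := ℂ) M v‖ ≤ 4 * K * ‖v‖ := by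
  have hK0 : 0 ≤ K := (norm_nonneg _).trans (hK 0 0)
  have hcomp : ∀ i, ‖(Matrix.toEuclideanCLM (n := Fin 2) (𝕜 := ℂ) M v) i‖ ≤ 2 * K * ‖v‖ := by
    intro i
    have : (Matrix.toEuclideanCLM (n := Fin 2) (𝕜 := ℂ) M v) i = ∑ j, M i j * v j := by
      rw [Matrix.ofLp_toEuclideanCLM]; rfl
    rw [this]
    refine (norm_sum_le _ _).trans ?_
    rw [Fin.sum_univ_two, norm_mul, norm_mul]
    have := mul_le_mul (hK i 0) (PiLp.norm_apply_le v 0) (norm_nonneg _) hK0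
    have := mul_le_mul (hK i 1) (PiLp.norm_apply_le v 1) (norm_nonneg _) hK0
    linarith
  have hB : 0 ≤ 2 * K * ‖v‖ := by positivity
  refine le_of_sq_le_sq ?_ (by positivity)
  rw [EuclideanSpace.norm_sq_eq, Fin.sum_univ_two]
  have a0 := pow_le_pow_left₀ (norm_nonneg _) (hcomp 0) 2
  have a1 := pow_le_pow_left₀ (norm_nonneg _) (hcomp 1) 2
  nlinarith [sq_nonneg (K * ‖v‖)]

theorem norm_potential_le {W : Plane → ℝ}
    (hW : ∀ x, |alpha h (w ‖x‖)| ≤ W x ∧ |beta h (w ‖x‖)| ≤ W x) (x : Plane) (v : C2) :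
    ‖Matrix.toEuclideanCLM (n := Fin 2) (𝕜 := ℂ) (potential h m w x) v‖ ≤ 8 * W x * ‖v‖ := by
  have := norm_toEuclideanCLM_le (M := potential h m w x) (K := 2 * W x) (fun i j =>
    (norm_potential_apply_le x i j).trans (by linarith [(hW x).1, (hW x).2])) v
  linarith

/-- Schwartz functions with values in a line of `ℂ²` lie in `H²`. -/
def lineSchwartz (e : C2) : 𝓢(Plane, ℂ) →L[ℂ] 𝓢(Plane, C2) :=
  SchwartzMap.postcompCLM ((ContinuousLinearMap.id ℂ ℂ).smulRight e)

theorem lineSchwartz_apply (e : C2) (φ : 𝓢(Plane, ℂ)) (x : Plane) :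
    lineSchwartz e φ x = φ x • e := by
  simp [lineSchwartz]

theorem laplacian_lineSchwartz (e : C2) (φ : 𝓢(Plane, ℂ)) :
    Δ (lineSchwartz e φ) = lineSchwartz e (Δ φ) := by
  ext1 x
  rw [lineSchwartz_apply, SchwartzMap.laplacian_apply, SchwartzMap.laplacian_apply]
  have h1 : (lineSchwartz e φ : Plane → C2) =
      ((ContinuousLinearMap.id ℂ ℂ).smulRight e).restrictScalars ℝ ∘ φ := by
    ext1 y; simp [lineSchwartz_apply]
  rw [h1, ContDiffAt.laplacian_CLM_comp_left (φ.contDiffAt 2)]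
  simp

theorem norm_lineSchwartz_toLp (e : C2) (φ : 𝓢(Plane, ℂ)) :
    ‖(lineSchwartz e φ).toLp 2‖ = ‖φ.toLp 2‖ * ‖e‖ := by
  rw [SchwartzMap.norm_toLp, SchwartzMap.norm_toLp]
  have : (lineSchwartz e φ : Plane → C2) = fun x => φ x • e := by
    ext1 y; exact lineSchwartz_apply e φ y
  have h2 : eLpNorm (fun x => φ x • e) 2 volume = eLpNorm (fun x => ‖e‖ • φ x) 2 volume := by
    refine eLpNorm_congr_norm_ae (Eventually.of_forall fun x => ?_)
    simp [norm_smul, mul_comm]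
  have h3 := eLpNorm_const_smul (‖e‖) (φ : Plane → ℂ) 2 volume
  rw [this, h2]
  erw [h3]
  simp [mul_comm]

theorem toEuclideanCLM_matJ_zero (v : C2) :
    (Matrix.toEuclideanCLM (n := Fin 2) (𝕜 := ℂ) matJ v) 0 = -v 1 := by
  rw [Matrix.ofLp_toEuclideanCLM]
  simp [matJ, Matrix.mulVec, dotProduct, Fin.sum_univ_two]

theorem toEuclideanCLM_matJ_one (v : C2) :
    (Matrix.toEuclideanCLM (n := Fin 2) (𝕜 := ℂ) matJ v) 1 = v 0 := by
  rw [Matrix.ofLp_toEuclideanCLM]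
  simp [matJ, Matrix.mulVec, dotProduct, Fin.sum_univ_two]

/-- The eigenvector of `J` for the eigenvalue `σ i`, `σ = ±1`. -/
def eigvecJ (σ : ℂ) : C2 := WithLp.toLp 2 ![1, -(σ * Complex.I)]

theorem eigvecJ_ne_zero (σ : ℂ) : eigvecJ σ ≠ 0 := fun h0 => by
  have := congrArg (fun v : C2 => v 0) h0
  simp [eigvecJ] at this

theorem toEuclideanCLM_matJ_eigvecJ {σ : ℂ} (hσ : σ ^ 2 = 1) :
    Matrix.toEuclideanCLM (n := Fin 2) (𝕜 := ℂ) matJ (eigvecJ σ) =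
      (σ * Complex.I) • eigvecJ σ := by
  ext i
  fin_cases i
  · refine (toEuclideanCLM_matJ_zero _).trans ?_
    simp [eigvecJ]
  · refine (toEuclideanCLM_matJ_one _).trans ?_
    simp only [eigvecJ, PiLp.smul_apply, smul_eq_mul, Fin.mk_one]
    simp only [Matrix.cons_val_zero, Matrix.cons_val_one]
    linear_combination (-1 : ℂ) * hσ + σ ^ 2 * Complex.I_sq

/-- Left multiplication by `J` on `L²`. -/
def mulJ : L2 →L[ℂ] L2 :=
  (Matrix.toEuclideanCLM (n := Fin 2) (𝕜 := ℂ) matJ).compLpL 2 (volume : Measure Plane)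

theorem linearization_apply (hw : IsStandingWave h ω m w) (u : sobolevH2) :
    linearization hw u = mulJ (lapL2 u - (ω : ℂ) • (u : L2) + potentialL2 hw (u : L2)) := rfl

theorem coeFn_mulJ (u : L2) :
    mulJ u =ᵐ[volume] fun x => Matrix.toEuclideanCLM (n := Fin 2) (𝕜 := ℂ) matJ (u x) :=
  ContinuousLinearMap.coeFn_compLpL _ u

theorem mulJ_lineSchwartz {σ : ℂ} (hσ : σ ^ 2 = 1) (ψ : 𝓢(Plane, ℂ)) :
    mulJ ((lineSchwartz (eigvecJ σ) ψ).toLp 2 (volume : Measure Plane)) =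
      (σ * Complex.I) • (lineSchwartz (eigvecJ σ) ψ).toLp 2 (volume : Measure Plane) := by
  refine Lp.ext ?_
  filter_upwards [coeFn_mulJ ((lineSchwartz (eigvecJ σ) ψ).toLp 2 (volume : Measure Plane)),
    Lp.coeFn_smul (σ * Complex.I) ((lineSchwartz (eigvecJ σ) ψ).toLp 2 (volume : Measure Plane)),
    SchwartzMap.coeFn_toLp (lineSchwartz (eigvecJ σ) ψ) 2] with x h1 h2 h3
  rw [h1, h2, Pi.smul_apply, h3, lineSchwartz_apply, map_smul, toEuclideanCLM_matJ_eigvecJ hσ,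
    smul_comm]

theorem mem_sobolevH2 {u : L2} :
    u ∈ sobolevH2 ↔ TemperedDistribution.MemSobolev 2 2 (u : 𝓢'(Plane, C2)) := Iff.rfl

theorem toLp_mem_sobolevH2 (U : 𝓢(Plane, C2)) : U.toLp 2 (volume : Measure Plane) ∈ sobolevH2 := by
  rw [mem_sobolevH2, Lp.toTemperedDistribution_toLp_eq]
  exact SchwartzMap.memSobolev U

/-- A Schwartz function as an element of `H²`. -/
def schwartzH2 (U : 𝓢(Plane, C2)) : sobolevH2 :=
  ⟨U.toLp 2 (volume : Measure Plane), toLp_mem_sobolevH2 U⟩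

theorem coe_schwartzH2 (U : 𝓢(Plane, C2)) : (schwartzH2 U : L2) = U.toLp 2 := rfl

theorem lapL2_schwartzH2 (U : 𝓢(Plane, C2)) :
    lapL2 (schwartzH2 U) = (Δ U).toLp 2 (volume : Measure Plane) := by
  apply lapL2_eq
  rw [coe_schwartzH2, Lp.toTemperedDistribution_toLp_eq, Lp.toTemperedDistribution_toLp_eq,
    TemperedDistribution.laplacian_toTemperedDistributionCLM_eq]

/-- On an eigenvector of `J` the free part `J (Δ - ω)` is scalar, so the error of an approximate
plane wave splits into its Helmholtz defect and the potential term. -/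
theorem linearization_sub_smul_lineSchwartz (hw : IsStandingWave h ω m w) (κ : ℝ) {σ : ℂ}
    (hσ : σ ^ 2 = 1) (φ : 𝓢(Plane, ℂ)) :
    linearization hw (schwartzH2 (lineSchwartz (eigvecJ σ) φ)) -
        (-(σ * Complex.I * ((ω + κ ^ 2 : ℝ) : ℂ))) •
          (schwartzH2 (lineSchwartz (eigvecJ σ) φ) : L2) =
      (σ * Complex.I) • (lineSchwartz (eigvecJ σ) (Δ φ + ((κ ^ 2 : ℝ) : ℂ) • φ)).toLp 2 (volume : Measure Plane) +
        mulJ (potentialL2 hw (schwartzH2 (lineSchwartz (eigvecJ σ) φ) : L2)) := by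
  have h2 : (lineSchwartz (eigvecJ σ) (Δ φ + ((κ ^ 2 : ℝ) : ℂ) • φ)).toLp 2 (volume : Measure Plane) =
      (lineSchwartz (eigvecJ σ) (Δ φ)).toLp 2 (volume : Measure Plane) +
        ((κ ^ 2 : ℝ) : ℂ) • (lineSchwartz (eigvecJ σ) φ).toLp 2 (volume : Measure Plane) := by
    rw [map_add, map_smul]
    exact ((SchwartzMap.toLpCLM ℂ C2 2 (volume : Measure Plane)).map_add _ _).trans
      (congrArg _ ((SchwartzMap.toLpCLM ℂ C2 2 (volume : Measure Plane)).map_smul _ _))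
  rw [linearization_apply, map_add, map_sub, map_smul, lapL2_schwartzH2, laplacian_lineSchwartz,
    coe_schwartzH2, mulJ_lineSchwartz hσ, mulJ_lineSchwartz hσ, h2]
  push_cast
  module

/-- The `L²` norm is put on the potential and the supremum on `u`: a spread-out wave barely sees a
localized potential, so the Weyl sequence need not be translated to infinity. -/
theorem norm_potentialL2_le (hw : IsStandingWave h ω m w) {W : Plane → ℝ} (hWL : MemLp W 2)
    (hW0 : ∀ x, 0 ≤ W x) (hW : ∀ x, |alpha h (w ‖x‖)| ≤ W x ∧ |beta h (w ‖x‖)| ≤ W x) {u : L2}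
    {B : ℝ} (hu : ∀ᵐ x, ‖u x‖ ≤ B) : ‖potentialL2 hw u‖ ≤ 8 * B * ‖hWL.toLp W‖ := by
  refine Lp.norm_le_mul_norm_of_ae_le_mul ?_
  filter_upwards [(memLp_potential hw u).coeFn_toLp, hWL.coeFn_toLp, hu] with x h1 h2 h3
  change ‖((memLp_potential hw u).toLp _ : L2) x‖ ≤ _
  rw [h1, h2]
  refine (norm_potential_le hW x _).trans ?_
  rw [Real.norm_eq_abs, abs_of_nonneg (hW0 x)]
  nlinarith [hW0 x, mul_le_mul_of_nonneg_left h3 (hW0 x)]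

/-- The arithmetic of the Weyl argument: `P` is the `L²` norm of the wave, `Q` that of its Helmholtz
defect, `V` that of the potential term and `R` that of its image under `J`, `s` the norm of the
supposed resolvent, `e` the length of the eigenvector of `J`. Division by `P` leaves a bound of
order `ε` for `e`. -/
theorem le_of_resolvent_estimate {P Q R s j e N c ε V : ℝ} (hP : 0 < P) (hs : 0 ≤ s) (hc : 0 ≤ c)
    (he : 0 ≤ e) (hj : 0 ≤ j) (h : P * e ≤ s * (c * (Q * e) + R)) (hQ : Q ≤ ε * P)
    (hR : R ≤ j * V) (hV : V ≤ 8 * (ε * P * e) * N) :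
    e ≤ s * (c * e + j * (8 * e * N)) * ε := by
  have h1 : c * (Q * e) ≤ c * (ε * P * e) := by gcongr
  have h2 : R ≤ j * (8 * (ε * P * e) * N) := hR.trans (mul_le_mul_of_nonneg_left hV hj)
  refine le_of_mul_le_mul_left ?_ hP
  calc P * e ≤ s * (c * (ε * P * e) + j * (8 * (ε * P * e) * N)) :=
        h.trans (mul_le_mul_of_nonneg_left (add_le_add h1 h2) hs)
    _ = _ := by ring

/-- The points `±i(ω + κ²)` belong to the spectrum of the linearization. -/
theorem mem_spec_linearization (hw : IsStandingWave h ω m w) {κ : ℝ} (hκ : 0 ≤ κ) {σ : ℂ}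
    (hσ : σ ^ 2 = 1) : -(σ * Complex.I * ((ω + κ ^ 2 : ℝ) : ℂ)) ∈ spec (linearization hw) := by
  rintro ⟨S, -, hS⟩
  obtain ⟨W, hWL, hW0, hW⟩ := exists_memLp_bound hw
  have hen : 0 < ‖eigvecJ σ‖ := norm_pos_iff.mpr (eigvecJ_ne_zero σ)
  generalize hN : ‖hWL.toLp W‖ = N
  have hN0 : 0 ≤ N := hN ▸ norm_nonneg _
  obtain ⟨D, hD⟩ : ∃ D, D = ‖σ * Complex.I‖ * ‖eigvecJ σ‖ + ‖mulJ‖ * (8 * ‖eigvecJ σ‖ * N) :=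
    ⟨_, rfl⟩
  have hD0 : 0 ≤ D := by rw [hD]; positivity
  -- A bounded left inverse `S` would force `‖eigvecJ σ‖ ≤ ‖S‖ D ε`; this `ε` rules that out.
  obtain ⟨ε, hε, hεD⟩ : ∃ ε > 0, ‖S‖ * D * ε < ‖eigvecJ σ‖ := by
    refine ⟨‖eigvecJ σ‖ / (‖S‖ * D + 1), by positivity, ?_⟩
    have : 0 < ‖S‖ * D + 1 := by positivity
    rw [mul_div_assoc', div_lt_iff₀ this]
    nlinarith
  obtain ⟨φ, hφ0, hφ1, hφ2⟩ := exists_approximate_planeWave hκ hε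
  have hid := linearization_sub_smul_lineSchwartz hw κ hσ φ
  have hV := norm_potentialL2_le hw hWL hW0 hW
    (u := (schwartzH2 (lineSchwartz (eigvecJ σ) φ) : L2))
    (B := ε * ‖φ.toLp 2 (volume : Measure Plane)‖ * ‖eigvecJ σ‖) (by
      filter_upwards [SchwartzMap.coeFn_toLp (lineSchwartz (eigvecJ σ) φ) 2] with x hx
      rw [coe_schwartzH2, hx, lineSchwartz_apply, norm_smul]
      exact mul_le_mul_of_nonneg_right (hφ2 x) (norm_nonneg _))
  have h1 := hS (schwartzH2 (lineSchwartz (eigvecJ σ) φ))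
  rw [hid] at h1
  have h2 := congrArg norm h1
  rw [coe_schwartzH2, norm_lineSchwartz_toLp] at h2
  have h3 := (h2.symm.le.trans (S.le_opNorm _)).trans (mul_le_mul_of_nonneg_left
    (norm_add_le _ _) (norm_nonneg S))
  rw [norm_smul, norm_lineSchwartz_toLp] at h3
  rw [coe_schwartzH2] at hV
  have h4 := mulJ.le_opNorm
    (potentialL2 hw ((lineSchwartz (eigvecJ σ) φ).toLp 2 (volume : Measure Plane)))
  refine absurd (le_of_resolvent_estimate hφ0 (norm_nonneg S) (norm_nonneg _) hen.le
    (norm_nonneg mulJ) h3 hφ1 h4 hV) (not_le.mpr ?_)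
  rwa [hN, ← hD]

/-- The points fill a half-line as `κ` varies, so none of them is isolated in the spectrum.
Replacing `κ²` by `κ² + ε/2` moves the point by exactly `ε/2`. -/
theorem mem_specEss_linearization (hw : IsStandingWave h ω m w) {κ : ℝ} (hκ : 0 ≤ κ) {σ : ℂ}
    (hσ : σ ^ 2 = 1) :
    -(σ * Complex.I * ((ω + κ ^ 2 : ℝ) : ℂ)) ∈ specEss (linearization hw) := by
  refine ⟨mem_spec_linearization hw hκ hσ, fun hd => ?_⟩
  obtain ⟨-, ⟨ε, hε, hiso⟩, -⟩ := hd
  have hσn : ‖σ‖ = 1 := by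
    have := congrArg norm hσ
    rw [norm_pow, norm_one] at this
    exact (pow_eq_one_iff_of_nonneg (norm_nonneg _) two_ne_zero).mp this
  have hs : 0 ≤ κ ^ 2 + ε / 2 := by positivity
  have h1 := mem_spec_linearization hw (Real.sqrt_nonneg (κ ^ 2 + ε / 2)) hσ
  rw [Real.sq_sqrt hs] at h1
  have hdiff : -(σ * Complex.I * ((ω + (κ ^ 2 + ε / 2) : ℝ) : ℂ)) -
      -(σ * Complex.I * ((ω + κ ^ 2 : ℝ) : ℂ)) = -(σ * Complex.I * ((ε / 2 : ℝ) : ℂ)) := by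
    push_cast; ring
  have hn : ‖-(σ * Complex.I * ((ε / 2 : ℝ) : ℂ))‖ = ε / 2 := by
    rw [norm_neg, norm_mul, norm_mul, hσn, Complex.norm_I, Complex.norm_real, Real.norm_eq_abs,
      abs_of_pos (by positivity)]
    ring
  have h2 := hiso _ h1 (by rw [hdiff, hn]; linarith)
  rw [← sub_eq_zero, hdiff, ← norm_eq_zero, hn] at h2
  linarith

/-- Off the essential spectrum, `ω ∓ iz` avoids the half-line `(-∞, 0]`. -/
theorem mem_slitPlane_of_notMem_specEss (hw : IsStandingWave h ω m w) {z : ℂ}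
    (hz : z ∉ specEss (linearization hw)) {σ : ℂ} (hσ : σ ^ 2 = 1) :
    ω - σ * Complex.I * z ∈ Complex.slitPlane := by
  by_contra hk
  rw [Complex.mem_slitPlane_iff, not_or, not_lt, not_not] at hk
  set k := (ω : ℂ) - σ * Complex.I * z with hkdef
  refine hz ?_
  -- If `k ≤ 0`, write `k = -κ²`; then `σ i z = ω + κ²`, and `σ² = 1` gives `z = -σ i (ω + κ²)`.
  have h1 := mem_specEss_linearization hw (Real.sqrt_nonneg (-k.re)) hσ
  rw [Real.sq_sqrt (by linarith [hk.1])] at h1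
  have h2 : k = (k.re : ℂ) := Complex.ext rfl (by simp [hk.2])
  have h3 : z = -(σ * Complex.I * ((ω + -k.re : ℝ) : ℂ)) := by
    push_cast
    rw [← h2, hkdef]
    linear_combination (-z) * hσ + (-(σ ^ 2 * z)) * (-Complex.I_sq)
  rwa [h3]

end Weyl

/-! ### Logarithmic polar coordinates: integration and the Laplacian -/

section LogPolar

open scoped Real

/-- Logarithmic polar coordinates on the punctured plane. -/
def logPolar (t θ : ℝ) : Plane := WithLp.toLp 2 ![Real.exp t * Real.cos θ, Real.exp t * Real.sin θ]

/-- The rotation of `logPolar t θ` by a right angle. -/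
def logPolarPerp (t θ : ℝ) : Plane :=
  WithLp.toLp 2 ![-(Real.exp t * Real.sin θ), Real.exp t * Real.cos θ]

theorem logPolar_zero (t θ : ℝ) : logPolar t θ 0 = Real.exp t * Real.cos θ := rfl

theorem logPolar_one (t θ : ℝ) : logPolar t θ 1 = Real.exp t * Real.sin θ := rfl

theorem norm_logPolar (t θ : ℝ) : ‖logPolar t θ‖ = Real.exp t := by
  rw [EuclideanSpace.norm_eq, Fin.sum_univ_two, logPolar_zero, logPolar_one]
  simp only [Real.norm_eq_abs, sq_abs]
  rw [show (Real.exp t * Real.cos θ) ^ 2 + (Real.exp t * Real.sin θ) ^ 2 = Real.exp t ^ 2 by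
    linear_combination Real.exp t ^ 2 * Real.cos_sq_add_sin_sq θ]
  exact Real.sqrt_sq (Real.exp_pos t).le

theorem angle_logPolar (t : ℝ) {θ : ℝ} (hθ : θ ∈ Ioc (-π) π) : angle (logPolar t θ) = θ := by
  have := Complex.arg_mul_cos_add_sin_mul_I (Real.exp_pos t) hθ
  refine Eq.trans ?_ this
  rw [angle, logPolar_zero, logPolar_one, Complex.mk_eq_add_mul_I]
  congr 1
  push_cast
  ring

theorem logPolar_log_norm_angle {x : Plane} (hx : x ≠ 0) :
    logPolar (Real.log ‖x‖) (angle x) = x := by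
  have hn : 0 < ‖x‖ := norm_pos_iff.mpr hx
  set c : ℂ := ⟨x 0, x 1⟩ with hc
  have hcn : ‖c‖ = ‖x‖ := by
    rw [EuclideanSpace.norm_eq, Fin.sum_univ_two, Complex.norm_def, Complex.normSq_apply]
    simp [hc, sq]
  have hc0 : c ≠ 0 := norm_pos_iff.mp (hcn ▸ hn)
  ext i
  fin_cases i
  · change Real.exp (Real.log ‖x‖) * Real.cos (Complex.arg c) = x 0
    rw [Real.exp_log hn, Complex.cos_arg hc0, hcn, mul_div_cancel₀ _ hn.ne']
  · change Real.exp (Real.log ‖x‖) * Real.sin (Complex.arg c) = x 1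
    rw [Real.exp_log hn, Complex.sin_arg, hcn, mul_div_cancel₀ _ hn.ne']

theorem continuous_logPolar : Continuous fun p : ℝ × ℝ => logPolar p.1 p.2 := by
  refine (PiLp.continuous_toLp 2 _).comp (continuous_pi fun i => ?_)
  fin_cases i <;> simp <;> fun_prop

theorem continuous_logPolarPerp : Continuous fun p : ℝ × ℝ => logPolarPerp p.1 p.2 := by
  refine (PiLp.continuous_toLp 2 _).comp (continuous_pi fun i => ?_)
  fin_cases i <;> simp <;> fun_prop

theorem hasDerivAt_toLp {f : ℝ → Fin 2 → ℝ} {f' : Fin 2 → ℝ} {t : ℝ} (hf : HasDerivAt f f' t) :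
    HasDerivAt (fun s => (WithLp.toLp 2 (f s) : Plane)) (WithLp.toLp 2 f') t :=
  (PiLp.continuousLinearEquiv 2 ℝ (fun _ : Fin 2 => ℝ)).symm.hasFDerivAt.comp_hasDerivAt t hf

theorem hasDerivAt_logPolar_left (t θ : ℝ) :
    HasDerivAt (fun s => logPolar s θ) (logPolar t θ) t := by
  refine hasDerivAt_toLp (hasDerivAt_pi.mpr fun i => ?_)
  fin_cases i
  · exact (Real.hasDerivAt_exp t).mul_const _
  · exact (Real.hasDerivAt_exp t).mul_const _

theorem hasDerivAt_logPolar_right (t θ : ℝ) :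
    HasDerivAt (fun s => logPolar t s) (logPolarPerp t θ) θ := by
  refine hasDerivAt_toLp (hasDerivAt_pi.mpr fun i => ?_)
  fin_cases i
  · simpa using (Real.hasDerivAt_cos θ).const_mul (Real.exp t)
  · simpa using (Real.hasDerivAt_sin θ).const_mul (Real.exp t)

theorem hasDerivAt_logPolarPerp_right (t θ : ℝ) :
    HasDerivAt (fun s => logPolarPerp t s) (-logPolar t θ) θ := by
  have : -logPolar t θ =
      WithLp.toLp 2 ![-(Real.exp t * Real.cos θ), -(Real.exp t * Real.sin θ)] := by
    ext i; fin_cases i <;> simp [logPolar]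
  rw [this]
  refine hasDerivAt_toLp (hasDerivAt_pi.mpr fun i => ?_)
  fin_cases i
  · exact ((Real.hasDerivAt_sin θ).const_mul (Real.exp t)).neg
  · simpa using (Real.hasDerivAt_cos θ).const_mul (Real.exp t)

section Integration

variable {F : Type*} [NormedAddCommGroup F] [NormedSpace ℝ F]

/-- The measurable identification of `ℝ × ℝ` with the plane. -/
def prodPlane : ℝ × ℝ ≃ᵐ Plane :=
  MeasurableEquiv.finTwoArrow.symm.trans (MeasurableEquiv.toLp 2 (Fin 2 → ℝ))

theorem measurePreserving_prodPlane : MeasurePreserving prodPlane :=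
  (PiLp.volume_preserving_toLp (Fin 2)).comp ((volume_preserving_finTwoArrow ℝ).symm _)

theorem prodPlane_polar (t θ : ℝ) :
    prodPlane (polarCoord.symm (Real.exp t, θ)) = logPolar t θ := by
  ext i; fin_cases i <;> rfl

/-- Polar coordinates composed with `r = e^t`: the Jacobian is `r · e^t = e^{2t}`, and the omitted
ray is a null set. The statement on integrability is what Fubini needs afterwards. -/
theorem logPolar_change_of_variables (f : Plane → F) :
    (Integrable f ↔ IntegrableOn (fun p : ℝ × ℝ => Real.exp (2 * p.1) • f (logPolar p.1 p.2))
      (univ ×ˢ Ioo (-π) π)) ∧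
    ∫ x, f x = ∫ p in (univ : Set ℝ) ×ˢ Ioo (-π) π,
      Real.exp (2 * p.1) • f (logPolar p.1 p.2) := by
  set s : Set (ℝ × ℝ) := univ ×ˢ Ioo (-π) π with hs
  have hsm : MeasurableSet s := MeasurableSet.univ.prod measurableSet_Ioo
  set L : ℝ × ℝ → ℝ × ℝ := fun p => polarCoord.symm (Real.exp p.1, p.2) with hL
  set E' : ℝ × ℝ → ℝ × ℝ →L[ℝ] ℝ × ℝ := fun p =>
    (ContinuousLinearMap.toSpanSingleton ℝ (Real.exp p.1)).prodMap (ContinuousLinearMap.id ℝ ℝ)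
    with hE'
  set L' : ℝ × ℝ → ℝ × ℝ →L[ℝ] ℝ × ℝ := fun p =>
    (fderivPolarCoordSymm (Real.exp p.1, p.2)).comp (E' p) with hL'
  have hd : ∀ p ∈ s, HasFDerivWithinAt L (L' p) s p := fun p _ => by
    refine HasFDerivAt.hasFDerivWithinAt ?_
    have h1 : HasFDerivAt (fun p : ℝ × ℝ => (Real.exp p.1, p.2)) (E' p) p := by
      have h2 : HasFDerivAt Real.exp (ContinuousLinearMap.toSpanSingleton ℝ (Real.exp p.1)) p.1 :=
        (Real.hasDerivAt_exp p.1).hasFDerivAt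
      exact HasFDerivAt.prodMap p h2 (hasFDerivAt_id p.2)
    exact (hasFDerivAt_polarCoord_symm _).comp p h1
  have hdet : ∀ p, |(L' p).det| = Real.exp (2 * p.1) := fun p => by
    have h1 : (L' p).det = (fderivPolarCoordSymm (Real.exp p.1, p.2)).det * (E' p).det :=
      LinearMap.det_comp _ _
    have h2 : (E' p).det = Real.exp p.1 := by
      rw [hE', ContinuousLinearMap.det]
      have : ((((ContinuousLinearMap.toSpanSingleton ℝ (Real.exp p.1)).prodMap
          (ContinuousLinearMap.id ℝ ℝ)) : ℝ × ℝ →L[ℝ] ℝ × ℝ) : ℝ × ℝ →ₗ[ℝ] ℝ × ℝ) =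
          LinearMap.prodMap (Real.exp p.1 • LinearMap.id) LinearMap.id := by
        ext <;> simp
      rw [this, LinearMap.det_prodMap, LinearMap.det_smul]
      simp
    rw [h1, h2, det_fderivPolarCoordSymm, ← Real.exp_add, abs_of_pos (Real.exp_pos _)]
    congr 1; ring
  have hmaps : MapsTo (fun p : ℝ × ℝ => (Real.exp p.1, p.2)) s polarCoord.target :=
    fun p hp => ⟨Real.exp_pos _, hp.2⟩
  have hinj : InjOn L s := by
    refine polarCoord.symm.injOn.comp ?_ hmaps
    rintro ⟨a, b⟩ - ⟨c, d⟩ - h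
    simp only [Prod.mk.injEq, Real.exp_eq_exp] at h
    exact Prod.ext h.1 h.2
  have himg : L '' s = polarCoord.source := by
    have h1 : (fun p : ℝ × ℝ => (Real.exp p.1, p.2)) '' s = polarCoord.target := by
      refine (hmaps.image_subset).antisymm fun q hq => ?_
      exact ⟨(Real.log q.1, q.2), ⟨trivial, hq.2⟩, Prod.ext (Real.exp_log hq.1) rfl⟩
    have h2 : L '' s = polarCoord.symm '' ((fun p : ℝ × ℝ => (Real.exp p.1, p.2)) '' s) := by
      rw [image_image]
    rw [h2, h1]
    exact polarCoord.symm.image_source_eq_target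
  have hfun : (fun p : ℝ × ℝ => |(L' p).det| • (f ∘ prodPlane) (L p)) =
      fun p => Real.exp (2 * p.1) • f (logPolar p.1 p.2) := by
    funext p
    rw [hdet, Function.comp_apply, hL, prodPlane_polar]
  have hr : (volume : Measure (ℝ × ℝ)).restrict polarCoord.source = volume := by
    rw [Measure.restrict_congr_set polarCoord_source_ae_eq_univ, Measure.restrict_univ]
  constructor
  · rw [← measurePreserving_prodPlane.integrable_comp_emb prodPlane.measurableEmbedding, ← hfun,
      ← integrableOn_image_iff_integrableOn_abs_det_fderiv_smul volume hsm hd hinj, himg,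
      IntegrableOn, hr]
  · rw [← measurePreserving_prodPlane.integral_comp prodPlane.measurableEmbedding, ← hfun,
      ← integral_image_eq_integral_abs_det_fderiv_smul volume hsm hd hinj, himg, hr]
    rfl

theorem integrable_logPolar {f : Plane → F} (hf : Integrable f) :
    Integrable fun t => ∫ θ in (-π)..π, Real.exp (2 * t) • f (logPolar t θ) := by
  have h1 := (logPolar_change_of_variables f).1.mp hf
  rw [IntegrableOn, Measure.volume_eq_prod, ← Measure.prod_restrict, Measure.restrict_univ] at h1
  refine h1.integral_prod_left.congr (Eventually.of_forall fun t => ?_)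
  simp only
  rw [intervalIntegral.integral_of_le (by linarith [Real.pi_pos]), integral_Ioc_eq_integral_Ioo]

theorem integral_logPolar {f : Plane → F} (hf : Integrable f) :
    ∫ x, f x = ∫ t, ∫ θ in (-π)..π, Real.exp (2 * t) • f (logPolar t θ) := by
  have h1 := (logPolar_change_of_variables f).1.mp hf
  rw [(logPolar_change_of_variables f).2]
  rw [IntegrableOn, Measure.volume_eq_prod, ← Measure.prod_restrict, Measure.restrict_univ] at h1
  rw [Measure.volume_eq_prod, ← Measure.prod_restrict, Measure.restrict_univ, integral_prod _ h1]
  refine integral_congr_ae (Eventually.of_forall fun t => ?_)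
  simp only
  rw [intervalIntegral.integral_of_le (by linarith [Real.pi_pos]), integral_Ioc_eq_integral_Ioo]

end Integration

section Laplacian

variable {φ : Plane → ℂ}

/-- The first radial derivative in logarithmic polar coordinates. -/
def radialD (φ : Plane → ℂ) (t θ : ℝ) : ℂ := fderiv ℝ φ (logPolar t θ) (logPolar t θ)

/-- The second radial derivative in logarithmic polar coordinates. -/
def radialDD (φ : Plane → ℂ) (t θ : ℝ) : ℂ :=
  fderiv ℝ (fderiv ℝ φ) (logPolar t θ) (logPolar t θ) (logPolar t θ) + radialD φ t θ

/-- The first angular derivative. -/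
def angularD (φ : Plane → ℂ) (t θ : ℝ) : ℂ := fderiv ℝ φ (logPolar t θ) (logPolarPerp t θ)

/-- The second angular derivative. -/
def angularDD (φ : Plane → ℂ) (t θ : ℝ) : ℂ :=
  fderiv ℝ (fderiv ℝ φ) (logPolar t θ) (logPolarPerp t θ) (logPolarPerp t θ) - radialD φ t θ

theorem hasDerivAt_radial (hφ : ContDiff ℝ 2 φ) (t θ : ℝ) :
    HasDerivAt (fun s => φ (logPolar s θ)) (radialD φ t θ) t :=
  ((hφ.differentiable two_ne_zero) _).hasFDerivAt.comp_hasDerivAt t (hasDerivAt_logPolar_left t θ)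

theorem hasDerivAt_angular (hφ : ContDiff ℝ 2 φ) (t θ : ℝ) :
    HasDerivAt (fun s => φ (logPolar t s)) (angularD φ t θ) θ :=
  ((hφ.differentiable two_ne_zero) _).hasFDerivAt.comp_hasDerivAt θ (hasDerivAt_logPolar_right t θ)

theorem contDiff_fderiv (hφ : ContDiff ℝ 2 φ) : ContDiff ℝ 1 (fderiv ℝ φ) :=
  hφ.fderiv_right (by norm_num)

theorem hasDerivAt_radialD (hφ : ContDiff ℝ 2 φ) (t θ : ℝ) :
    HasDerivAt (fun s => radialD φ s θ) (radialDD φ t θ) t := by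
  have h1 := ((contDiff_fderiv hφ).differentiable one_ne_zero (logPolar t θ)).hasFDerivAt
    |>.comp_hasDerivAt t (hasDerivAt_logPolar_left t θ)
  exact h1.clm_apply (hasDerivAt_logPolar_left t θ)

theorem hasDerivAt_angularD (hφ : ContDiff ℝ 2 φ) (t θ : ℝ) :
    HasDerivAt (fun s => angularD φ t s) (angularDD φ t θ) θ := by
  have h1 := ((contDiff_fderiv hφ).differentiable one_ne_zero (logPolar t θ)).hasFDerivAt
    |>.comp_hasDerivAt θ (hasDerivAt_logPolar_right t θ)
  have h2 := h1.clm_apply (hasDerivAt_logPolarPerp_right t θ)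
  rw [map_neg, ← sub_eq_add_neg] at h2
  exact h2

theorem continuous_radialD (hφ : ContDiff ℝ 2 φ) :
    Continuous fun p : ℝ × ℝ => radialD φ p.1 p.2 :=
  ((contDiff_fderiv hφ).continuous.comp continuous_logPolar).clm_apply continuous_logPolar

theorem continuous_radialDD (hφ : ContDiff ℝ 2 φ) :
    Continuous fun p : ℝ × ℝ => radialDD φ p.1 p.2 :=
  (((((contDiff_fderiv hφ).continuous_fderiv one_ne_zero).comp continuous_logPolar).clm_apply
    continuous_logPolar).clm_apply continuous_logPolar).add (continuous_radialD hφ)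

theorem continuous_angularDD (hφ : ContDiff ℝ 2 φ) :
    Continuous fun p : ℝ × ℝ => angularDD φ p.1 p.2 :=
  (((((contDiff_fderiv hφ).continuous_fderiv one_ne_zero).comp continuous_logPolar).clm_apply
    continuous_logPolarPerp).clm_apply continuous_logPolarPerp).sub (continuous_radialD hφ)

/-- The Laplacian is conformally invariant: in logarithmic polar coordinates it is
`e^{-2t} (∂_t² + ∂_θ²)`. -/
theorem radialDD_add_angularDD (φ : Plane → ℂ) (t θ : ℝ) :
    radialDD φ t θ + angularDD φ t θ = Real.exp (2 * t) • (Δ φ) (logPolar t θ) := by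
  set B := fderiv ℝ (fderiv ℝ φ) (logPolar t θ) with hB
  set e₀ : Plane := EuclideanSpace.single 0 1
  set e₁ : Plane := EuclideanSpace.single 1 1
  have h1 : logPolar t θ = (Real.exp t * Real.cos θ) • e₀ + (Real.exp t * Real.sin θ) • e₁ := by
    ext i; fin_cases i <;> simp [logPolar, e₀, e₁]
  have h2 : logPolarPerp t θ =
      -(Real.exp t * Real.sin θ) • e₀ + (Real.exp t * Real.cos θ) • e₁ := by
    ext i; fin_cases i <;> simp [logPolarPerp, e₀, e₁]
  have h3 : (Δ φ) (logPolar t θ) = B e₀ e₀ + B e₁ e₁ := by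
    rw [InnerProductSpace.laplacian_eq_iteratedFDeriv_orthonormalBasis φ
      (EuclideanSpace.basisFun (Fin 2) ℝ)]
    simp [Fin.sum_univ_two, iteratedFDeriv_two_apply, e₀, e₁, hB]
  rw [radialDD, angularDD, h3, ← hB]
  rw [show Real.exp (2 * t) = Real.exp t ^ 2 by rw [← Real.exp_nat_mul]; norm_num]
  -- The two vectors are an orthonormal frame scaled by `e^t`, and the trace is rotation invariant.
  -- The mixed terms cancel in the sum, so symmetry of `B` is not needed; the first-order terms of
  -- `radialDD` and `angularDD` cancel as well.
  have h4 : B (logPolar t θ) (logPolar t θ) + B (logPolarPerp t θ) (logPolarPerp t θ) =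
      Real.exp t ^ 2 • (B e₀ e₀ + B e₁ e₁) := by
    rw [h1, h2]
    simp only [map_add, map_smul, add_apply, smul_apply, Complex.real_smul]
    push_cast
    have hcs : (Real.cos θ : ℂ) ^ 2 + (Real.sin θ : ℂ) ^ 2 = 1 := by
      exact_mod_cast Real.cos_sq_add_sin_sq θ
    push_cast at hcs
    linear_combination (Complex.exp t ^ 2 * (B e₀ e₀ + B e₁ e₁)) * hcs
  linear_combination h4

end Laplacian

end LogPolar

/-! ### Angular Fourier modes, Green's identity and the removable origin -/

section Modes

open scoped Real

/-- The angular Fourier mode `∫ e^{inθ} F(t, θ) dθ`. -/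
def mode (n : ℤ) (F : ℝ → ℝ → ℂ) (t : ℝ) : ℂ :=
  -- The exponent is not conjugated: up to `2π` this is the coefficient of `e^{-inθ}`.
  ∫ θ in (-π)..π, Complex.exp (Complex.I * (n * θ)) * F t θ

theorem continuous_angular_exp (n : ℤ) :
    Continuous fun θ : ℝ => Complex.exp (Complex.I * (n * θ)) := by
  fun_prop

theorem norm_angular_exp (n : ℤ) (θ : ℝ) : ‖Complex.exp (Complex.I * (n * θ))‖ = 1 := by
  rw [mul_comm, show ((n : ℂ) * θ) = ((n * θ : ℝ) : ℂ) by push_cast; ring,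
    Complex.norm_exp_ofReal_mul_I]

theorem norm_mode_le {n : ℤ} {F : ℝ → ℝ → ℂ} {t B : ℝ} (hB : ∀ θ, ‖F t θ‖ ≤ B) :
    ‖mode n F t‖ ≤ 2 * π * B := by
  have := intervalIntegral.norm_integral_le_of_norm_le_const (a := -π) (b := π) (C := B)
    (f := fun θ => Complex.exp (Complex.I * (n * θ)) * F t θ) (fun θ _ => by
      rw [norm_mul, norm_angular_exp, one_mul]; exact hB θ)
  refine this.trans (le_of_eq ?_)
  rw [abs_of_pos (by linarith [Real.pi_pos])]
  ring

theorem mode_add {n : ℤ} {F G : ℝ → ℝ → ℂ} {t : ℝ} (hF : Continuous (F t)) (hG : Continuous (G t)) :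
    mode n (fun t θ => F t θ + G t θ) t = mode n F t + mode n G t := by
  rw [mode, mode, mode, ← intervalIntegral.integral_add]
  · simp only [mul_add]
  · exact ((continuous_angular_exp n).mul hF).intervalIntegrable _ _
  · exact ((continuous_angular_exp n).mul hG).intervalIntegrable _ _

theorem hasDerivAt_mode (n : ℤ) {F F' : ℝ → ℝ → ℂ}
    (hF : Continuous fun p : ℝ × ℝ => F p.1 p.2) (hF' : Continuous fun p : ℝ × ℝ => F' p.1 p.2)
    (hd : ∀ t θ, HasDerivAt (fun s => F s θ) (F' t θ) t) (t : ℝ) :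
    HasDerivAt (mode n F) (mode n F' t) t := by
  have hc : ∀ t, Continuous fun θ : ℝ => Complex.exp (Complex.I * (n * θ)) * F t θ := fun t =>
    (continuous_angular_exp n).mul (hF.comp (by fun_prop : Continuous fun θ : ℝ => (t, θ)))
  have hc' : ∀ t, Continuous fun θ : ℝ => Complex.exp (Complex.I * (n * θ)) * F' t θ := fun t =>
    (continuous_angular_exp n).mul (hF'.comp (by fun_prop : Continuous fun θ : ℝ => (t, θ)))
  obtain ⟨C, hC⟩ := ((isCompact_Icc (a := t - 1) (b := t + 1)).prod
    (isCompact_Icc (a := -π) (b := π))).exists_bound_of_continuousOn hF'.continuousOn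
  refine (intervalIntegral.hasDerivAt_integral_of_dominated_loc_of_deriv_le
    (F' := fun t θ => Complex.exp (Complex.I * (n * θ)) * F' t θ) (bound := fun _ => C)
    (Icc_mem_nhds (by linarith : t - 1 < t) (by linarith : t < t + 1))
    (Eventually.of_forall fun t => (hc t).aestronglyMeasurable) ((hc t).intervalIntegrable _ _)
    (hc' t).aestronglyMeasurable (Eventually.of_forall fun θ hθ s hs => ?_)
    intervalIntegrable_const (Eventually.of_forall fun θ _ s _ => (hd s θ).const_mul _)).2
  rw [norm_mul, norm_angular_exp, one_mul]
  rw [uIoc_of_le (by linarith [Real.pi_pos])] at hθ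
  exact hC (s, θ) ⟨hs, Ioc_subset_Icc_self hθ⟩

theorem logPolar_periodic (t : ℝ) : logPolar t (-π) = logPolar t π := by
  ext i; fin_cases i <;> simp [logPolar]

theorem logPolarPerp_periodic (t : ℝ) : logPolarPerp t (-π) = logPolarPerp t π := by
  ext i; fin_cases i <;> simp [logPolarPerp]

theorem angular_exp_periodic (n : ℤ) :
    Complex.exp (Complex.I * (n * ((-π : ℝ) : ℂ))) = Complex.exp (Complex.I * (n * (π : ℂ))) := by
  rw [Complex.exp_eq_exp_iff_exists_int]
  exact ⟨-n, by push_cast; ring⟩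

theorem hasDerivAt_angular_exp (n : ℤ) (θ : ℝ) :
    HasDerivAt (fun s : ℝ => Complex.exp (Complex.I * (n * s)))
      (Complex.I * n * Complex.exp (Complex.I * (n * θ))) θ := by
  have h1 : HasDerivAt (fun s : ℝ => Complex.I * ((n : ℂ) * (s : ℂ))) (Complex.I * n) θ := by
    have := (Complex.ofRealCLM.hasDerivAt (x := θ)).const_mul (Complex.I * (n : ℂ))
    simpa [mul_assoc] using this
  simpa [mul_comm] using h1.cexp

/-- Two integrations by parts over a full period, done at once through the primitive `e^{inθ} ∂_θ φ
- i n e^{inθ} φ`, which takes equal values at `±π`. -/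
theorem mode_angularDD {φ : Plane → ℂ} (hφ : ContDiff ℝ 2 φ) (n : ℤ) (t : ℝ) :
    mode n (angularDD φ) t = -(n : ℂ) ^ 2 * mode n (fun t θ => φ (logPolar t θ)) t := by
  have hs : Continuous fun θ : ℝ => (t, θ) := by fun_prop
  have hΦ : Continuous fun θ : ℝ => φ (logPolar t θ) :=
    hφ.continuous.comp (continuous_logPolar.comp hs)
  have hB : Continuous fun θ : ℝ => angularDD φ t θ := (continuous_angularDD hφ).comp hs
  have hd : ∀ θ : ℝ, HasDerivAt
      (fun s : ℝ => Complex.exp (Complex.I * (n * s)) * angularD φ t s -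
        Complex.I * n * (Complex.exp (Complex.I * (n * s)) * φ (logPolar t s)))
      (Complex.exp (Complex.I * (n * θ)) * angularDD φ t θ +
        (n : ℂ) ^ 2 * (Complex.exp (Complex.I * (n * θ)) * φ (logPolar t θ))) θ := fun θ => by
    have := ((hasDerivAt_angular_exp n θ).mul (hasDerivAt_angularD hφ t θ)).sub
      (((hasDerivAt_angular_exp n θ).mul (hasDerivAt_angular hφ t θ)).const_mul (Complex.I * n))
    refine this.congr_deriv ?_
    linear_combination -(n : ℂ) ^ 2 * Complex.exp (Complex.I * (n * θ)) * φ (logPolar t θ) *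
      Complex.I_sq
  have i1 : IntervalIntegrable (fun θ : ℝ => Complex.exp (Complex.I * (n * θ)) * angularDD φ t θ)
      volume (-π) π := ((continuous_angular_exp n).mul hB).intervalIntegrable _ _
  have i2 : IntervalIntegrable (fun θ : ℝ => (n : ℂ) ^ 2 *
      (Complex.exp (Complex.I * (n * θ)) * φ (logPolar t θ))) volume (-π) π :=
    (((continuous_angular_exp n).mul hΦ).const_mul ((n : ℂ) ^ 2)).intervalIntegrable _ _
  have := intervalIntegral.integral_eq_sub_of_hasDerivAt (fun θ _ => hd θ) (i1.add i2)
  rw [intervalIntegral.integral_add i1 i2, intervalIntegral.integral_const_mul] at this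
  have hz : angularD φ t (-π) = angularD φ t π := by
    rw [angularD, angularD, logPolar_periodic, logPolarPerp_periodic]
  rw [angular_exp_periodic, hz, logPolar_periodic, sub_self] at this
  rw [mode, mode]
  linear_combination this

/-- A derivative with nonzero limit would make `f` grow linearly. -/
theorem eq_zero_of_tendsto_deriv_atTop {f f' : ℝ → ℂ} {M : ℝ} {c : ℂ}
    (hf : ∀ t, HasDerivAt f (f' t) t) (hM : ∀ t, ‖f t‖ ≤ M) (hc : Tendsto f' atTop (𝓝 c)) :
    c = 0 := by
  by_contra hc0
  have hcn : 0 < ‖c‖ := norm_pos_iff.mpr hc0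
  obtain ⟨a, ha⟩ := eventually_atTop.mp (Metric.tendsto_nhds.mp hc (‖c‖ / 2) (by positivity))
  have hd : ∀ t, HasDerivAt (fun s : ℝ => f s - (s : ℂ) * c) (f' t - c) t := fun t => by
    have h1 : HasDerivAt (fun s : ℝ => (s : ℂ) * c) c t := by
      simpa using (Complex.ofRealCLM.hasDerivAt (x := t)).mul_const c
    exact (hf t).sub h1
  have hM0 : 0 ≤ M := (norm_nonneg _).trans (hM 0)
  -- Over this length `f` moves by at least half of `4M + ‖c‖`, more than the `2M` allowed.
  set b := a + (4 * M / ‖c‖ + 1) with hb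
  have hab : 0 < 4 * M / ‖c‖ + 1 := by positivity
  have h1 := (convex_Ici a).norm_image_sub_le_of_norm_hasDerivWithin_le
    (fun t _ => (hd t).hasDerivWithinAt) (fun t ht => by
      rw [← dist_eq_norm]; exact (ha t ht).le) (mem_Ici.mpr le_rfl)
    (mem_Ici.mpr (by linarith : a ≤ b))
  have h2 : (f b - (b : ℂ) * c - (f a - (a : ℂ) * c)) = (f b - f a) - ((b - a : ℝ) : ℂ) * c := by
    push_cast; ring
  rw [h2] at h1
  have h3 : ‖((b - a : ℝ) : ℂ) * c‖ = (4 * M / ‖c‖ + 1) * ‖c‖ := by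
    rw [norm_mul, Complex.norm_real, Real.norm_eq_abs, hb, add_sub_cancel_left, abs_of_pos hab]
  have h4 : ‖b - a‖ = 4 * M / ‖c‖ + 1 := by
    rw [hb, add_sub_cancel_left, Real.norm_eq_abs, abs_of_pos hab]
  have h5 := norm_sub_norm_le (((b - a : ℝ) : ℂ) * c) (f b - f a)
  rw [norm_sub_rev _ (f b - f a), h3] at h5
  rw [h4] at h1
  have h6 : ‖f b - f a‖ ≤ 2 * M := (norm_sub_le _ _).trans (by linarith [hM a, hM b])
  have h7 : (4 * M / ‖c‖ + 1) * ‖c‖ = 4 * M + ‖c‖ := by field_simp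
  nlinarith

theorem eq_zero_of_tendsto_deriv_atBot {f f' : ℝ → ℂ} {M : ℝ} {c : ℂ}
    (hf : ∀ t, HasDerivAt f (f' t) t) (hM : ∀ t, ‖f t‖ ≤ M) (hc : Tendsto f' atBot (𝓝 c)) :
    c = 0 := by
  have h1 : ∀ t, HasDerivAt (fun s => f (-s)) (-f' (-t)) t := fun t => by
    have h := (hf (-t)).scomp t (hasDerivAt_neg t)
    rw [neg_one_smul] at h
    exact h
  have h2 := eq_zero_of_tendsto_deriv_atTop h1 (fun t => hM (-t))
    ((hc.comp tendsto_neg_atTop_atBot).neg)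
  simpa using h2

/-- Green's identity on the line for bounded functions, one of which has a derivative that tends
to zero at both ends. -/
theorem integral_green {Y Y' Y'' Φ Φ' Φ'' : ℝ → ℂ} (q : ℂ)
    (hY : ∀ t, HasDerivAt Y (Y' t) t) (hY' : ∀ t, HasDerivAt Y' (Y'' t) t)
    (hΦ : ∀ t, HasDerivAt Φ (Φ' t) t) (hΦ' : ∀ t, HasDerivAt Φ' (Φ'' t) t)
    {M B : ℝ} (hM : ∀ t, ‖Y t‖ ≤ M) (hB : ∀ t, ‖Φ t‖ ≤ B)
    (hbot : Tendsto Φ' atBot (𝓝 0)) (htop : Tendsto Φ' atTop (𝓝 0))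
    (h1 : Integrable fun t => Y t * (Φ'' t - q * Φ t))
    (h2 : Integrable fun t => (Y'' t - q * Y t) * Φ t) :
    ∫ t, Y t * (Φ'' t - q * Φ t) = ∫ t, (Y'' t - q * Y t) * Φ t := by
  have hg : ∀ t, HasDerivAt (fun t => Y t * Φ' t - Y' t * Φ t)
      (Y t * (Φ'' t - q * Φ t) - (Y'' t - q * Y t) * Φ t) t := fun t =>
    (((hY t).mul (hΦ' t)).sub ((hY' t).mul (hΦ t))).congr_deriv (by ring)
  have hi := h1.sub h2
  have hp : ∀ t, HasDerivAt (fun t => Y t * Φ t) (Y' t * Φ t + Y t * Φ' t) t := fun t =>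
    (hY t).mul (hΦ t)
  have hpb : ∀ t, ‖Y t * Φ t‖ ≤ M * B := fun t => by
    rw [norm_mul]
    exact mul_le_mul (hM t) (hB t) (norm_nonneg _) ((norm_nonneg _).trans (hM t))
  -- Nothing is known about `Y'` at the ends. The Wronskian `Y Φ' - Y' Φ` has a limit `L` there
  -- because its derivative is integrable. Since `Y Φ' → 0`, the derivative of the bounded function
  -- `Y Φ` tends to `-L`, hence `L = 0`.
  have key : ∀ {l : Filter ℝ} {L : ℂ}, Tendsto Φ' l (𝓝 0) →
      Tendsto (fun t => Y t * Φ' t - Y' t * Φ t) l (𝓝 L) →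
      Tendsto (fun t => Y' t * Φ t + Y t * Φ' t) l (𝓝 (-L)) := fun {l L} h0 hL => by
    have h3 : Tendsto (fun t => Y t * Φ' t) l (𝓝 0) := by
      refine squeeze_zero_norm (a := fun t => M * ‖Φ' t‖) (fun t => ?_) ?_
      · rw [norm_mul]; exact mul_le_mul_of_nonneg_right (hM t) (norm_nonneg _)
      · simpa using h0.norm.const_mul M
    have h4 := (h3.const_mul 2).sub hL
    rw [mul_zero, zero_sub] at h4
    exact h4.congr fun t => by ring
  have ht := tendsto_limUnder_of_hasDerivAt_of_integrableOn_Ioi (a := 0) (fun t _ => hg t)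
    hi.integrableOn
  have hb := tendsto_limUnder_of_hasDerivAt_of_integrableOn_Iic (a := 0) (fun t _ => hg t)
    hi.integrableOn
  rw [neg_eq_zero.mp (eq_zero_of_tendsto_deriv_atTop hp hpb (key htop ht))] at ht
  rw [neg_eq_zero.mp (eq_zero_of_tendsto_deriv_atBot hp hpb (key hbot hb))] at hb
  have := integral_of_hasDerivAt_of_tendsto hg hi hb ht
  rw [sub_zero] at this
  rw [← sub_eq_zero, ← integral_sub h1 h2]
  exact this

theorem exists_schwartz_fderiv_bound (φ : 𝓢(Plane, ℂ)) :
    ∃ C, ∀ x, ‖fderiv ℝ φ x‖ ≤ C ∧ ‖x‖ ^ 2 * ‖fderiv ℝ φ x‖ ≤ C := by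
  obtain ⟨C₀, -, h₀⟩ := φ.decay 0 1
  obtain ⟨C₂, -, h₂⟩ := φ.decay 2 1
  refine ⟨max C₀ C₂, fun x => ⟨?_, ?_⟩⟩
  · simpa [norm_iteratedFDeriv_one] using (h₀ x).trans (le_max_left C₀ C₂)
  · simpa [norm_iteratedFDeriv_one] using (h₂ x).trans (le_max_right C₀ C₂)

/-- The derivative `r ∂_r φ` is at most `C r`, and also at most `C / r` because `r² |∇φ|` is
bounded. -/
theorem tendsto_mode_radialD (φ : 𝓢(Plane, ℂ)) (n : ℤ) :
    Tendsto (mode n (radialD φ)) atBot (𝓝 0) ∧ Tendsto (mode n (radialD φ)) atTop (𝓝 0) := by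
  obtain ⟨C, hC⟩ := exists_schwartz_fderiv_bound φ
  have h1 : ∀ t θ, ‖radialD φ t θ‖ ≤ C * Real.exp t := fun t θ => by
    refine (ContinuousLinearMap.le_opNorm _ _).trans ?_
    rw [norm_logPolar]
    exact mul_le_mul_of_nonneg_right (hC _).1 (Real.exp_pos t).le
  have h2 : ∀ t θ, ‖radialD φ t θ‖ ≤ C * Real.exp (-t) := fun t θ => by
    refine (ContinuousLinearMap.le_opNorm _ _).trans ?_
    have := (hC (logPolar t θ)).2
    rw [norm_logPolar] at this ⊢
    have h3 : Real.exp t * Real.exp (-t) = 1 := by rw [← Real.exp_add]; simp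
    calc ‖fderiv ℝ φ (logPolar t θ)‖ * Real.exp t
        = Real.exp t ^ 2 * ‖fderiv ℝ φ (logPolar t θ)‖ * Real.exp (-t) := by
          linear_combination (-‖fderiv ℝ φ (logPolar t θ)‖ * Real.exp t) * h3
      _ ≤ _ := mul_le_mul_of_nonneg_right this (Real.exp_pos _).le
  constructor
  · refine squeeze_zero_norm (a := fun t => 2 * π * (C * Real.exp t))
      (fun t => norm_mode_le (h1 t)) ?_
    simpa using (Real.tendsto_exp_atBot.const_mul C).const_mul (2 * π)
  · refine squeeze_zero_norm (a := fun t => 2 * π * (C * Real.exp (-t)))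
      (fun t => norm_mode_le (h2 t)) ?_
    have := Real.tendsto_exp_atBot.comp tendsto_neg_atTop_atBot
    simpa using (this.const_mul C).const_mul (2 * π)

/-- In logarithmic polar coordinates the Laplacian of `φ` acts on the `n`-th Fourier mode as
`∂_t² - n²`. -/
theorem mode_laplacian {φ : Plane → ℂ} (hφ : ContDiff ℝ 2 φ) (n : ℤ) (t : ℝ) :
    mode n (fun t θ => Real.exp (2 * t) • (Δ φ) (logPolar t θ)) t =
      mode n (radialDD φ) t - (n : ℂ) ^ 2 * mode n (fun t θ => φ (logPolar t θ)) t := by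
  have hs : Continuous fun θ : ℝ => (t, θ) := by fun_prop
  have h1 := mode_add (n := n) (t := t) (F := radialDD φ) (G := angularDD φ)
    ((continuous_radialDD hφ).comp hs) ((continuous_angularDD hφ).comp hs)
  simp only [radialDD_add_angularDD] at h1
  rw [h1, mode_angularDD hφ]
  ring

section RadialChange

variable {y : ℝ → ℂ}

theorem hasDerivAt_comp_exp (hy : ContDiffOn ℝ 2 y (Ioi 0)) (t : ℝ) :
    HasDerivAt (fun s => y (Real.exp s)) (Real.exp t • deriv y (Real.exp t)) t := by
  have h1 : DifferentiableAt ℝ y (Real.exp t) :=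
    (hy.differentiableOn two_ne_zero).differentiableAt (Ioi_mem_nhds (Real.exp_pos t))
  exact h1.hasDerivAt.scomp t (Real.hasDerivAt_exp t)

theorem hasDerivAt_exp_smul_deriv_comp_exp (hy : ContDiffOn ℝ 2 y (Ioi 0)) (t : ℝ) :
    HasDerivAt (fun s => Real.exp s • deriv y (Real.exp s))
      (Real.exp t • (Real.exp t • deriv (deriv y) (Real.exp t)) +
        Real.exp t • deriv y (Real.exp t)) t := by
  have hd : ContDiffOn ℝ 1 (deriv y) (Ioi 0) := hy.deriv_of_isOpen isOpen_Ioi (by norm_num)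
  have h1 : DifferentiableAt ℝ (deriv y) (Real.exp t) :=
    (hd.differentiableOn one_ne_zero).differentiableAt (Ioi_mem_nhds (Real.exp_pos t))
  exact (Real.hasDerivAt_exp t).smul (h1.hasDerivAt.scomp t (Real.hasDerivAt_exp t))

/-- With `r = e^t` one has `r ∂_r = ∂_t` and `r² Δ_r = ∂_t²`, which removes the first-order term and
the singular coefficient. -/
theorem exp_smul_radialLap (n : ℤ) (y : ℝ → ℂ) (t : ℝ) :
    (Real.exp t • (Real.exp t • deriv (deriv y) (Real.exp t)) +
        Real.exp t • deriv y (Real.exp t)) - (n : ℂ) ^ 2 * y (Real.exp t) =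
      Real.exp (2 * t) • radialLap n y (Real.exp t) := by
  have h0 : (Real.exp t : ℂ) ≠ 0 := by exact_mod_cast (Real.exp_pos t).ne'
  have h1 : Real.exp (2 * t) = Real.exp t ^ 2 := by rw [← Real.exp_nat_mul]; norm_num
  simp only [radialLap, Complex.real_smul, h1, Complex.ofReal_pow]
  field_simp

/-- A bounded classical solution of the radial equation gives a distributional solution on the
whole plane: the origin is a removable singularity. -/
theorem integral_laplacian_mul_of_radial {n : ℤ} {y f : ℝ → ℂ} {p F : Plane → ℂ} {M : ℝ}
    (hy : ContDiffOn ℝ 2 y (Ioi 0)) (hlap : ∀ r, 0 < r → radialLap n y r = f r)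
    (hM : ∀ r, 0 < r → ‖y r‖ ≤ M)
    (hp : ∀ t, ∀ θ ∈ Ioc (-π) π, p (logPolar t θ) =
      Complex.exp (Complex.I * (n * θ)) * y (Real.exp t))
    (hF : ∀ t, ∀ θ ∈ Ioc (-π) π, F (logPolar t θ) =
      Complex.exp (Complex.I * (n * θ)) * f (Real.exp t))
    (φ : 𝓢(Plane, ℂ)) (hip : Integrable fun x => Δ φ x * p x)
    (hiF : Integrable fun x => φ x * F x) :
    ∫ x, Δ φ x * p x = ∫ x, φ x * F x := by
  have hφ : ContDiff ℝ 2 φ := φ.smooth 2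
  -- As `p` carries the single phase `e^{inθ}`, the angular integral sees only the `n`-th mode of
  -- the test function.
  have e1 : ∀ t, ∫ θ in (-π)..π, Real.exp (2 * t) • (Δ φ (logPolar t θ) * p (logPolar t θ)) =
      y (Real.exp t) * (mode n (radialDD φ) t -
        (n : ℂ) ^ 2 * mode n (fun t θ => φ (logPolar t θ)) t) := fun t => by
    rw [← mode_laplacian hφ, mode, ← intervalIntegral.integral_const_mul]
    refine intervalIntegral.integral_congr_ae (Eventually.of_forall fun θ hθ => ?_)
    rw [uIoc_of_le (by linarith [Real.pi_pos])] at hθ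
    simp only [SchwartzMap.laplacian_apply, hp t θ hθ, Complex.real_smul]
    ring
  have e2 : ∀ t, ∫ θ in (-π)..π, Real.exp (2 * t) • (φ (logPolar t θ) * F (logPolar t θ)) =
      ((Real.exp t • (Real.exp t • deriv (deriv y) (Real.exp t)) +
        Real.exp t • deriv y (Real.exp t)) - (n : ℂ) ^ 2 * y (Real.exp t)) *
        mode n (fun t θ => φ (logPolar t θ)) t := fun t => by
    rw [exp_smul_radialLap, hlap _ (Real.exp_pos t), mode, ← intervalIntegral.integral_const_mul]
    refine intervalIntegral.integral_congr_ae (Eventually.of_forall fun θ hθ => ?_)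
    rw [uIoc_of_le (by linarith [Real.pi_pos])] at hθ
    simp only [hF t θ hθ, Complex.real_smul]
    ring
  have i1 := integrable_logPolar hip
  have i2 := integrable_logPolar hiF
  rw [integral_logPolar hip, integral_logPolar hiF]
  simp only [e1, e2] at i1 i2 ⊢
  obtain ⟨B, -, hB⟩ := φ.decay 0 0
  have hcont : Continuous fun p : ℝ × ℝ => φ (logPolar p.1 p.2) :=
    φ.continuous.comp continuous_logPolar
  -- Only boundedness of `y` is used at both ends; the vanishing boundary derivatives are those of
  -- the test function.
  refine integral_green ((n : ℂ) ^ 2) (hasDerivAt_comp_exp hy)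
    (hasDerivAt_exp_smul_deriv_comp_exp hy)
    (hasDerivAt_mode n hcont (continuous_radialD hφ) (hasDerivAt_radial hφ))
    (hasDerivAt_mode n (continuous_radialD hφ) (continuous_radialDD hφ) (hasDerivAt_radialD hφ))
    (fun t => hM _ (Real.exp_pos t))
    (fun t => norm_mode_le (B := B) fun θ => by simpa using hB (logPolar t θ))
    (tendsto_mode_radialD φ n).1 (tendsto_mode_radialD φ n).2 i1 i2

end RadialChange

end Modes

/-! ### From weak to classical derivatives on the line -/

section WeakDerivative

open scoped ContDiff

variable {F : Type*} [NormedAddCommGroup F] [NormedSpace ℝ F]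

theorem integrable_smul_of_hasCompactSupport {ψ : ℝ → ℝ} {W : ℝ → F} (hψ : Continuous ψ)
    (hc : HasCompactSupport ψ) (hW : Continuous W) : Integrable fun t => ψ t • W t :=
  (hψ.smul hW).integrable_of_hasCompactSupport hc.smul_right

theorem contDiff_infty_deriv {ψ : ℝ → ℝ} (hψ : ContDiff ℝ ∞ ψ) : ContDiff ℝ ∞ (deriv ψ) :=
  (contDiff_infty_iff_deriv.mp hψ).2

/-- A test function on the line with vanishing integral is the derivative of a test function. -/
theorem exists_deriv_eq_of_integral_eq_zero {χ : ℝ → ℝ} (hχ : ContDiff ℝ ∞ χ)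
    (hc : HasCompactSupport χ) (h0 : ∫ t, χ t = 0) :
    ∃ ψ : ℝ → ℝ, ContDiff ℝ ∞ ψ ∧ HasCompactSupport ψ ∧ deriv ψ = χ := by
  obtain ⟨R, hR⟩ := hc.isCompact.isBounded.subset_closedBall 0
  have hz : ∀ t, R < |t| → χ t = 0 := fun t ht => by
    by_contra h
    have := hR (subset_tsupport χ h)
    rw [mem_closedBall_zero_iff, Real.norm_eq_abs] at this
    linarith
  have hi : ∀ a b, IntervalIntegrable χ volume a b :=
    fun a b => hχ.continuous.intervalIntegrable a b
  -- The primitive starts left of the support. It vanishes right of the support because the total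
  -- integral is zero. The `+ 1` keeps the support strictly inside the half-open interval.
  have hd : ∀ t, HasDerivAt (fun t => ∫ s in (-(|R| + 1))..t, χ s) (χ t) t := fun t =>
    intervalIntegral.integral_hasDerivAt_right (hi _ _)
      (hχ.continuous.stronglyMeasurableAtFilter _ _) hχ.continuous.continuousAt
  have hde : deriv (fun t => ∫ s in (-(|R| + 1))..t, χ s) = χ := funext fun t => (hd t).deriv
  have hRR := le_abs_self R
  have hneg : ∀ t, t ≤ -(|R| + 1) → (∫ s in (-(|R| + 1))..t, χ s) = 0 := fun t ht => by
    rw [intervalIntegral.integral_symm, intervalIntegral.integral_congr (g := fun _ => 0),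
      intervalIntegral.integral_zero, neg_zero]
    intro s hs
    rw [uIcc_of_le ht] at hs
    exact hz s (by rw [lt_abs]; right; linarith [hs.2])
  have hsupp : tsupport χ ⊆ Ioc (-(|R| + 1)) (|R| + 1) := fun s hs => by
    have := hR hs
    rw [mem_closedBall_zero_iff, Real.norm_eq_abs, abs_le] at this
    constructor <;> linarith [this.1, this.2]
  have hpos : ∀ t, |R| + 1 ≤ t → (∫ s in (-(|R| + 1))..t, χ s) = 0 := fun t ht => by
    rw [← h0]
    refine intervalIntegral.integral_eq_integral_of_support_subset ((subset_tsupport χ).trans ?_)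
    exact hsupp.trans (Ioc_subset_Ioc_right ht)
  refine ⟨_, ?_, HasCompactSupport.intro (isCompact_Icc (a := -(|R| + 1)) (b := |R| + 1)) ?_, hde⟩
  · rw [contDiff_infty_iff_deriv, hde]
    exact ⟨fun t => (hd t).differentiableAt, hχ⟩
  · intro t ht
    rcases le_or_gt t (-(|R| + 1)) with h | h
    · exact hneg t h
    · rcases le_or_gt (|R| + 1) t with h' | h'
      · exact hpos t h'
      · exact absurd ⟨h.le, h'.le⟩ ht

theorem exists_testFunction_integral_eq_one :
    ∃ ρ : ℝ → ℝ, ContDiff ℝ ∞ ρ ∧ HasCompactSupport ρ ∧ ∫ t, ρ t = 1 := by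
  let b : ContDiffBump (0 : ℝ) := ⟨1, 2, one_pos, one_lt_two⟩
  exact ⟨b.normed volume, b.contDiff_normed, b.hasCompactSupport_normed, b.integral_normed⟩

/-- The test function `χ - (∫ χ) ρ` is a derivative. -/
theorem exists_deriv_eq_sub {χ ρ : ℝ → ℝ} (hχ : ContDiff ℝ ∞ χ) (hc : HasCompactSupport χ)
    (hρ : ContDiff ℝ ∞ ρ) (hρc : HasCompactSupport ρ) (hρ1 : ∫ t, ρ t = 1) :
    ∃ ψ : ℝ → ℝ, ContDiff ℝ ∞ ψ ∧ HasCompactSupport ψ ∧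
      deriv ψ = fun t => χ t - (∫ s, χ s) * ρ t := by
  refine exists_deriv_eq_of_integral_eq_zero (hχ.sub (contDiff_const.mul hρ))
    (hc.sub hρc.mul_left) ?_
  rw [integral_sub (hχ.continuous.integrable_of_hasCompactSupport hc)
    ((hρ.continuous.integrable_of_hasCompactSupport hρc).const_mul _), integral_const_mul, hρ1,
    mul_one, sub_self]

theorem integral_sub_smul {f g : ℝ → F} (hf : Integrable f) (hg : Integrable g) (a : ℝ) :
    ∫ t, f t - a • g t = (∫ t, f t) - a • ∫ t, g t := by
  rw [← integral_smul]
  exact integral_sub hf (hg.smul a)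

theorem integral_deriv_smul_primitive {G P : ℝ → F} (hG : Continuous G)
    (hP : ∀ t, HasDerivAt P (G t) t) {ψ : ℝ → ℝ} (hψ : ContDiff ℝ ∞ ψ)
    (hc : HasCompactSupport ψ) : ∫ t, deriv ψ t • P t = -∫ t, ψ t • G t := by
  have hPc : Continuous P := continuous_iff_continuousAt.mpr fun t => (hP t).continuousAt
  have h1 := integral_bilinear_hasDerivAt_right_eq_neg_left_of_integrable
    (L := ContinuousLinearMap.lsmul ℝ ℝ) (u := ψ) (u' := deriv ψ) (v := P) (v' := G)
    (fun t _ => (hψ.differentiable (by simp) t).hasDerivAt) (fun t _ => hP t)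
    (integrable_smul_of_hasCompactSupport hψ.continuous hc hG)
    (integrable_smul_of_hasCompactSupport (contDiff_infty_deriv hψ).continuous hc.deriv hPc)
    (integrable_smul_of_hasCompactSupport hψ.continuous hc hPc)
  simp only [ContinuousLinearMap.lsmul_apply] at h1
  rw [h1, neg_neg]

variable [CompleteSpace F]

/-- The lemma of du Bois-Reymond. -/
theorem exists_eq_const_of_integral_deriv_smul {W : ℝ → F} (hW : Continuous W)
    (h : ∀ ψ : ℝ → ℝ, ContDiff ℝ ∞ ψ → HasCompactSupport ψ → ∫ t, deriv ψ t • W t = 0) :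
    ∃ c, ∀ t, W t = c := by
  obtain ⟨ρ, hρ, hρc, hρ1⟩ := exists_testFunction_integral_eq_one
  -- Testing with `χ - (∫ χ) ρ`, which is a derivative, gives `∫ χ W = (∫ χ)(∫ ρ W)` for every `χ`.
  refine ⟨∫ t, ρ t • W t, fun t => ?_⟩
  have h1 : ∀ᵐ t : ℝ, W t = ∫ t, ρ t • W t := by
    refine ae_eq_of_integral_contDiff_smul_eq hW.locallyIntegrable
      continuous_const.locallyIntegrable fun χ hχ hc => ?_
    obtain ⟨ψ, hψ, hψc, hd⟩ := exists_deriv_eq_sub hχ hc hρ hρc hρ1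
    have h2 := h ψ hψ hψc
    simp only [hd, sub_smul, mul_smul] at h2
    rw [integral_sub_smul (integrable_smul_of_hasCompactSupport hχ.continuous hc hW)
      (integrable_smul_of_hasCompactSupport hρ.continuous hρc hW), sub_eq_zero] at h2
    rw [h2, integral_smul_const]
  exact congrFun (Continuous.ae_eq_iff_eq volume hW continuous_const |>.mp h1) t

theorem hasDerivAt_primitive {G : ℝ → F} (hG : Continuous G) (t : ℝ) :
    HasDerivAt (fun t => ∫ s in (0 : ℝ)..t, G s) (G t) t :=
  intervalIntegral.integral_hasDerivAt_right (hG.intervalIntegrable _ _)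
    (hG.stronglyMeasurableAtFilter _ _) hG.continuousAt

/-- A continuous function whose weak derivative is continuous is differentiable. -/
theorem hasDerivAt_of_integral_deriv_smul {Y G : ℝ → F} (hY : Continuous Y) (hG : Continuous G)
    (h : ∀ ψ : ℝ → ℝ, ContDiff ℝ ∞ ψ → HasCompactSupport ψ →
      ∫ t, deriv ψ t • Y t = -∫ t, ψ t • G t) (t : ℝ) : HasDerivAt Y (G t) t := by
  set P : ℝ → F := fun t => ∫ s in (0 : ℝ)..t, G s with hPdef
  have hP : ∀ t, HasDerivAt P (G t) t := hasDerivAt_primitive hG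
  have hPc : Continuous P := continuous_iff_continuousAt.mpr fun t => (hP t).continuousAt
  -- Subtracting a primitive of `G` leaves a function with zero weak derivative.
  obtain ⟨c, hcst⟩ := exists_eq_const_of_integral_deriv_smul (W := fun t => Y t - P t)
    (hY.sub hPc) fun ψ hψ hc => by
      simp only [smul_sub]
      have hd := (contDiff_infty_deriv hψ).continuous
      rw [integral_sub (integrable_smul_of_hasCompactSupport hd hc.deriv hY)
        (integrable_smul_of_hasCompactSupport hd hc.deriv hPc), h ψ hψ hc,
        integral_deriv_smul_primitive hG hP hψ hc, sub_self]
  have : Y = fun t => P t + c := funext fun t => by rw [← hcst t]; abel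
  rw [this]
  exact (hP t).add_const c

/-- A continuous function whose second weak derivative is continuous is twice differentiable. -/
theorem exists_hasDerivAt_of_integral_deriv_deriv_smul {Y G : ℝ → F} (hY : Continuous Y)
    (hG : Continuous G)
    (h : ∀ ψ : ℝ → ℝ, ContDiff ℝ ∞ ψ → HasCompactSupport ψ →
      ∫ t, deriv (deriv ψ) t • Y t = ∫ t, ψ t • G t) :
    ∃ Y' : ℝ → F, (∀ t, HasDerivAt Y (Y' t) t) ∧ ∀ t, HasDerivAt Y' (G t) t := by
  obtain ⟨ρ, hρ, hρc, hρ1⟩ := exists_testFunction_integral_eq_one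
  set P : ℝ → F := fun t => ∫ s in (0 : ℝ)..t, G s with hPdef
  have hP : ∀ t, HasDerivAt P (G t) t := hasDerivAt_primitive hG
  have hPc : Continuous P := continuous_iff_continuousAt.mpr fun t => (hP t).continuousAt
  have hρd := contDiff_infty_deriv hρ
  -- The weak derivative of `Y` must be `P - c`; testing this with `ρ`, of integral `1`, determines
  -- `c`.
  set c : F := (∫ t, deriv ρ t • Y t) + ∫ t, ρ t • P t with hc
  refine ⟨fun t => P t - c, hasDerivAt_of_integral_deriv_smul hY (hPc.sub continuous_const)
    fun χ hχ hχc => ?_, fun t => (hP t).sub_const c⟩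
  have hχd := contDiff_infty_deriv hχ
  obtain ⟨ψ, hψ, hψc, hd⟩ := exists_deriv_eq_sub hχ hχc hρ hρc hρ1
  have h1 := h ψ hψ hψc
  have h2 := integral_deriv_smul_primitive hG hP hψ hψc
  have hdd : deriv (deriv ψ) = fun t => deriv χ t - (∫ s, χ s) * deriv ρ t := by
    rw [hd]
    funext t
    exact ((hχ.differentiable (by simp) t).hasDerivAt.sub
      ((hρ.differentiable (by simp) t).hasDerivAt.const_mul _)).deriv
  simp only [hdd, sub_smul, mul_smul] at h1
  simp only [hd, sub_smul, mul_smul] at h2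
  rw [integral_sub_smul (integrable_smul_of_hasCompactSupport hχd.continuous hχc.deriv hY)
    (integrable_smul_of_hasCompactSupport hρd.continuous hρc.deriv hY)] at h1
  rw [integral_sub_smul (integrable_smul_of_hasCompactSupport hχ.continuous hχc hPc)
    (integrable_smul_of_hasCompactSupport hρ.continuous hρc hPc), ← h1] at h2
  simp only [smul_sub]
  rw [integral_sub (integrable_smul_of_hasCompactSupport hχ.continuous hχc hPc)
    (integrable_smul_of_hasCompactSupport hχ.continuous hχc continuous_const),
    integral_smul_const, hc, smul_add, sub_eq_iff_eq_add.mp h2]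
  abel

end WeakDerivative

/-! ### Return from `t = log r` to the radial variable -/

section RadialChangeInverse

variable {Y Y' Y'' : ℝ → ℂ}

theorem hasDerivAt_comp_log (hY : ∀ t, HasDerivAt Y (Y' t) t) {r : ℝ} (hr : 0 < r) :
    HasDerivAt (fun r => Y (Real.log r)) (r⁻¹ • Y' (Real.log r)) r :=
  (hY _).scomp r (Real.hasDerivAt_log hr.ne')

theorem contDiffOn_comp_log (hY : ContDiff ℝ 2 Y) :
    ContDiffOn ℝ 2 (fun r => Y (Real.log r)) (Ioi 0) :=
  hY.comp_contDiffOn fun _ hr => (Real.contDiffAt_log.mpr (ne_of_gt hr)).contDiffWithinAt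

theorem contDiff_two_of_hasDerivAt (hY : ∀ t, HasDerivAt Y (Y' t) t)
    (hY' : ∀ t, HasDerivAt Y' (Y'' t) t) (hc : Continuous Y'') : ContDiff ℝ 2 Y := by
  rw [show (2 : WithTop ℕ∞) = 1 + 1 by norm_num, contDiff_succ_iff_deriv,
    show deriv Y = Y' from funext fun t => (hY t).deriv]
  refine ⟨fun t => (hY t).differentiableAt, by simp, ?_⟩
  rw [contDiff_one_iff_deriv, show deriv Y' = Y'' from funext fun t => (hY' t).deriv]
  exact ⟨fun t => (hY' t).differentiableAt, hc⟩

theorem radialLap_comp_log (hY : ∀ t, HasDerivAt Y (Y' t) t)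
    (hY' : ∀ t, HasDerivAt Y' (Y'' t) t) (n : ℤ) {r : ℝ} (hr : 0 < r) :
    radialLap n (fun r => Y (Real.log r)) r =
      ((r : ℂ) ^ 2)⁻¹ * (Y'' (Real.log r) - (n : ℂ) ^ 2 * Y (Real.log r)) := by
  have h1 : deriv (fun r => Y (Real.log r)) =ᶠ[𝓝 r] fun r => r⁻¹ • Y' (Real.log r) := by
    filter_upwards [Ioi_mem_nhds hr] with s hs
    exact (hasDerivAt_comp_log hY hs).deriv
  have h2 := ((hasDerivAt_inv hr.ne').smul (hasDerivAt_comp_log hY' hr)).deriv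
  rw [radialLap, h1.deriv_eq, h1.eq_of_nhds]
  have h3 : deriv (fun r : ℝ => r⁻¹ • Y' (Real.log r)) r = _ := h2
  rw [h3]
  have hr0 : (r : ℂ) ≠ 0 := by exact_mod_cast hr.ne'
  simp only [Complex.real_smul]
  push_cast
  field_simp
  ring

end RadialChangeInverse

/-! ### Separated test functions and completeness of the modes -/

section AngularTestFunction

open scoped Real ContDiff

/-- The unit complex number `e^{iθ}` at the point with polar angle `θ`. -/
def direction (x : Plane) : ℂ := ((x 0 : ℂ) + (x 1 : ℂ) * Complex.I) / (‖x‖ : ℂ)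

theorem direction_logPolar (t θ : ℝ) :
    direction (logPolar t θ) = Complex.exp (Complex.I * θ) := by
  have h0 : (Real.exp t : ℂ) ≠ 0 := by exact_mod_cast (Real.exp_pos t).ne'
  rw [direction, norm_logPolar, logPolar_zero, logPolar_one, mul_comm Complex.I,
    Complex.exp_mul_I, ← Complex.ofReal_cos, ← Complex.ofReal_sin]
  push_cast at h0 ⊢
  field_simp

theorem direction_ne_zero {x : Plane} (hx : x ≠ 0) : direction x ≠ 0 := by
  rw [← logPolar_log_norm_angle hx, direction_logPolar]
  exact Complex.exp_ne_zero _

/-- The function `ψ(log r) e^{inθ}`. -/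
def angularTest (n : ℤ) (ψ : ℝ → ℝ) (x : Plane) : ℂ :=
  -- For `n = 0` the bare formula would give `ψ 0` at the origin, since `Real.log 0 = 0`.
  if x = 0 then 0 else (ψ (Real.log ‖x‖) : ℂ) * direction x ^ n

variable {n : ℤ} {ψ : ℝ → ℝ}

theorem logPolar_ne_zero (t θ : ℝ) : logPolar t θ ≠ 0 := by
  rw [← norm_pos_iff, norm_logPolar]
  exact Real.exp_pos t

/-- Valid for every `θ`: the use of `direction` instead of `angle` avoids a branch cut. -/
theorem angularTest_logPolar (n : ℤ) (ψ : ℝ → ℝ) (t θ : ℝ) :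
    angularTest n ψ (logPolar t θ) = ψ t * Complex.exp (Complex.I * (n * θ)) := by
  rw [angularTest, if_neg (logPolar_ne_zero t θ), norm_logPolar, Real.log_exp, direction_logPolar,
    ← Complex.exp_int_mul]
  congr 2
  ring

theorem contDiffAt_direction_zpow (n : ℤ) {x : Plane} (hx : x ≠ 0) :
    ContDiffAt ℝ ∞ (fun x => direction x ^ n) x := by
  have h1 : ContDiffAt ℝ ∞ direction x := by
    have hn : ContDiffAt ℝ ∞ (fun x : Plane => ((‖x‖ : ℝ) : ℂ)) x :=
      Complex.ofRealCLM.contDiff.contDiffAt.comp x (contDiffAt_norm ℝ hx)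
    have hi : ∀ i, ContDiffAt ℝ ∞ (fun x : Plane => ((x i : ℝ) : ℂ)) x := fun i =>
      Complex.ofRealCLM.contDiff.contDiffAt.comp x
        (EuclideanSpace.proj (𝕜 := ℝ) i).contDiff.contDiffAt
    refine ((hi 0).add ((hi 1).mul contDiffAt_const)).mul (hn.inv ?_)
    exact_mod_cast (norm_pos_iff.mpr hx).ne'
  have h2 : AnalyticAt ℝ (fun c : ℂ => c ^ n) (direction x) :=
    analyticAt_id.zpow (direction_ne_zero hx)
  exact h2.contDiffAt.comp x h1

/-- Compact support in `log r` keeps the function away from the origin, where the direction is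
singular. -/
theorem contDiff_angularTest (hψ : ContDiff ℝ ∞ ψ) (hc : HasCompactSupport ψ) :
    ContDiff ℝ ∞ (angularTest n ψ) := by
  obtain ⟨R, hR⟩ := hc.isCompact.isBounded.subset_closedBall 0
  refine contDiff_iff_contDiffAt.mpr fun x => ?_
  by_cases hx : x = 0
  · subst hx
    refine (contDiffAt_const (c := (0 : ℂ))).congr_of_eventuallyEq ?_
    filter_upwards [Metric.ball_mem_nhds (0 : Plane) (Real.exp_pos (-R))] with x hx
    rw [angularTest]
    split_ifs with h0
    · rfl
    · have hz : ψ (Real.log ‖x‖) = 0 := by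
        by_contra h
        have h1 := hR (subset_tsupport ψ h)
        rw [mem_closedBall_zero_iff, Real.norm_eq_abs, abs_le] at h1
        have h2 := (Real.log_lt_iff_lt_exp (norm_pos_iff.mpr h0)).mpr (mem_ball_zero_iff.mp hx)
        linarith [h1.1]
      rw [hz, Complex.ofReal_zero, zero_mul]
  · have h1 : ContDiffAt ℝ ∞ (fun x : Plane => ((ψ (Real.log ‖x‖) : ℝ) : ℂ)) x :=
      Complex.ofRealCLM.contDiff.contDiffAt.comp x (hψ.contDiffAt.comp x
        ((contDiffAt_norm ℝ hx).log (norm_ne_zero_iff.mpr hx)))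
    refine (h1.mul (contDiffAt_direction_zpow n hx)).congr_of_eventuallyEq ?_
    filter_upwards [isOpen_ne.mem_nhds hx] with y hy
    exact if_neg hy

theorem hasCompactSupport_angularTest (hc : HasCompactSupport ψ) :
    HasCompactSupport (angularTest n ψ) := by
  obtain ⟨R, hR⟩ := hc.isCompact.isBounded.subset_closedBall 0
  refine HasCompactSupport.intro (isCompact_closedBall (0 : Plane) (Real.exp R)) fun x hx => ?_
  rw [mem_closedBall_zero_iff, not_le] at hx
  have hn : 0 < ‖x‖ := (Real.exp_pos R).trans hx
  have hz : ψ (Real.log ‖x‖) = 0 := by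
    by_contra h
    have h1 := hR (subset_tsupport ψ h)
    rw [mem_closedBall_zero_iff, Real.norm_eq_abs, abs_le] at h1
    have h2 := (Real.lt_log_iff_exp_lt hn).mpr hx
    linarith [h1.2]
  rw [angularTest, if_neg (norm_pos_iff.mp hn), hz, Complex.ofReal_zero, zero_mul]

/-- The function is a product in `(t, θ)`, so uniqueness of derivatives along coordinate lines
identifies each term of `∂_t² + ∂_θ²`. -/
theorem laplacian_angularTest (hψ : ContDiff ℝ ∞ ψ) (hc : HasCompactSupport ψ) (t θ : ℝ) :
    Real.exp (2 * t) • (Δ (angularTest n ψ)) (logPolar t θ) =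
      (((deriv (deriv ψ) t : ℝ) : ℂ) - (n : ℂ) ^ 2 * ψ t) * Complex.exp (Complex.I * (n * θ)) := by
  have hφ : ContDiff ℝ 2 (angularTest n ψ) := contDiff_infty.mp (contDiff_angularTest hψ hc) 2
  have hψd := contDiff_infty_deriv hψ
  have r1 : ∀ t, radialD (angularTest n ψ) t θ =
      ((deriv ψ t : ℝ) : ℂ) * Complex.exp (Complex.I * (n * θ)) := fun t => by
    refine (hasDerivAt_radial hφ t θ).unique ?_
    simp only [angularTest_logPolar]
    exact (hψ.differentiable (by simp) t).hasDerivAt.ofReal_comp.mul_const _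
  have r2 : radialDD (angularTest n ψ) t θ =
      ((deriv (deriv ψ) t : ℝ) : ℂ) * Complex.exp (Complex.I * (n * θ)) := by
    refine (hasDerivAt_radialD hφ t θ).unique ?_
    simp only [r1]
    exact (hψd.differentiable (by simp) t).hasDerivAt.ofReal_comp.mul_const _
  have a1 : ∀ θ, angularD (angularTest n ψ) t θ =
      ψ t * (Complex.I * n * Complex.exp (Complex.I * (n * θ))) := fun θ => by
    refine (hasDerivAt_angular hφ t θ).unique ?_
    simp only [angularTest_logPolar]
    exact (hasDerivAt_angular_exp n θ).const_mul _
  have a2 : angularDD (angularTest n ψ) t θ =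
      ψ t * (Complex.I * n * (Complex.I * n * Complex.exp (Complex.I * (n * θ)))) := by
    refine (hasDerivAt_angularD hφ t θ).unique ?_
    simp only [a1]
    exact ((hasDerivAt_angular_exp n θ).const_mul _).const_mul _
  rw [← radialDD_add_angularDD, r2, a2]
  linear_combination (ψ t : ℂ) * n ^ 2 * Complex.exp (Complex.I * (n * θ)) * Complex.I_sq

theorem integrable_schwartz_mul (φ : 𝓢(Plane, ℂ)) {p : Plane → ℂ}
    (hp : AEStronglyMeasurable p) {M : ℝ} (hM : ∀ x, ‖p x‖ ≤ M) :
    Integrable fun x => φ x * p x :=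
  φ.integrable.mul_bdd hp (Eventually.of_forall hM)

theorem continuous_mode {n : ℤ} {F : ℝ → ℝ → ℂ} (hF : Continuous fun p : ℝ × ℝ => F p.1 p.2) :
    Continuous (mode n F) := by
  refine intervalIntegral.continuous_parametric_intervalIntegral_of_continuous' ?_ _ _
  exact ((continuous_angular_exp n).comp continuous_snd).mul hF

/-- The angular Fourier modes of a distributional solution of `Δ p = F` solve the corresponding
ordinary differential equations, here in the variable `t = log r`. -/
theorem exists_hasDerivAt_mode {p F : Plane → ℂ} {M M' : ℝ} {G : ℝ → ℂ} (hp : Continuous p)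
    (hM : ∀ x, ‖p x‖ ≤ M) (hF : AEStronglyMeasurable F) (hM' : ∀ x, ‖F x‖ ≤ M')
    (hG : Continuous G) (hGF : ∀ t, mode n (fun t θ => F (logPolar t θ)) t = G t)
    (h : ∀ φ : 𝓢(Plane, ℂ), ∫ x, Δ φ x * p x = ∫ x, φ x * F x) :
    ∃ Y' : ℝ → ℂ, (∀ t, HasDerivAt (mode n fun t θ => p (logPolar t θ)) (Y' t) t) ∧
      ∀ t, HasDerivAt Y' ((n : ℂ) ^ 2 * mode n (fun t θ => p (logPolar t θ)) t +
        Real.exp (2 * t) • G t) t := by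
  have hY : Continuous (mode n fun t θ => p (logPolar t θ)) :=
    continuous_mode (hp.comp continuous_logPolar)
  refine exists_hasDerivAt_of_integral_deriv_deriv_smul hY (by fun_prop) fun ψ hψ hc => ?_
  -- Pairing with `ψ(log r) e^{inθ}` isolates the `n`-th mode and leaves `ψ` as a free test function
  -- in `t`.
  obtain ⟨φ, hφ⟩ : ∃ φ : 𝓢(Plane, ℂ), (φ : Plane → ℂ) = angularTest n ψ :=
    ⟨(hasCompactSupport_angularTest hc).toSchwartzMap (contDiff_angularTest hψ hc), rfl⟩
  have h1 := h φ
  rw [integral_logPolar (integrable_schwartz_mul (Δ φ) hp.aestronglyMeasurable hM),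
    integral_logPolar (integrable_schwartz_mul φ hF hM')] at h1
  have e1 : ∀ t, ∫ θ in (-π)..π, Real.exp (2 * t) • (Δ φ (logPolar t θ) * p (logPolar t θ)) =
      (((deriv (deriv ψ) t : ℝ) : ℂ) - (n : ℂ) ^ 2 * ψ t) * mode n (fun t θ => p (logPolar t θ)) t := by
    intro t
    rw [mode, ← intervalIntegral.integral_const_mul]
    refine intervalIntegral.integral_congr fun θ _ => ?_
    rw [← smul_mul_assoc, SchwartzMap.laplacian_apply, hφ, laplacian_angularTest hψ hc, mul_assoc]
  have e2 : ∀ t, ∫ θ in (-π)..π, Real.exp (2 * t) • (φ (logPolar t θ) * F (logPolar t θ)) =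
      ψ t • (Real.exp (2 * t) • G t) := by
    intro t
    rw [← hGF, mode, ← intervalIntegral.integral_smul, ← intervalIntegral.integral_smul]
    refine intervalIntegral.integral_congr fun θ _ => ?_
    simp only [hφ, angularTest_logPolar, Complex.real_smul]
    ring
  simp only [e1, e2] at h1
  have hψd := contDiff_infty_deriv hψ
  have i1 := integrable_smul_of_hasCompactSupport (contDiff_infty_deriv hψd).continuous
    hc.deriv.deriv hY
  have i2 := integrable_smul_of_hasCompactSupport hψ.continuous hc
    (W := fun t => (n : ℂ) ^ 2 • mode n (fun t θ => p (logPolar t θ)) t) (by fun_prop)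
  have i3 := integrable_smul_of_hasCompactSupport hψ.continuous hc
    (by fun_prop : Continuous fun t => Real.exp (2 * t) • G t)
  have e3 : ∀ t, (((deriv (deriv ψ) t : ℝ) : ℂ) - (n : ℂ) ^ 2 * ψ t) *
      mode n (fun t θ => p (logPolar t θ)) t =
      deriv (deriv ψ) t • mode n (fun t θ => p (logPolar t θ)) t -
        ψ t • ((n : ℂ) ^ 2 • mode n (fun t θ => p (logPolar t θ)) t) := fun t => by
    simp only [Complex.real_smul, smul_eq_mul]
    ring
  simp only [e3] at h1
  rw [integral_sub i1 i2, sub_eq_iff_eq_add] at h1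
  rw [h1, add_comm, ← integral_add i2 i3]
  simp only [smul_add, smul_eq_mul]

/-- Completeness of the trigonometric system. -/
theorem eq_zero_of_forall_integral_exp_eq_zero {f : ℝ → ℂ} (hf : Continuous f)
    (h : ∀ n : ℤ, ∫ θ in (-π)..π, Complex.exp (Complex.I * (n * θ)) * f θ = 0) {θ : ℝ}
    (hθ : θ ∈ Ioo (-π) π) : f θ = 0 := by
  have hπ : -π < π := by linarith [Real.pi_pos]
  have h1 : ∀ n : ℤ, fourierCoeffOn hπ f n = 0 := fun n => by
    rw [fourierCoeffOn_eq_integral]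
    have : ∀ θ : ℝ, fourier (-n) (θ : AddCircle (π - -π)) • f θ =
        Complex.exp (Complex.I * ((-n : ℤ) * θ)) * f θ := fun θ => by
      rw [fourier_coe_apply, smul_eq_mul]
      congr 2
      have hp : (π : ℂ) ≠ 0 := by exact_mod_cast Real.pi_ne_zero
      push_cast
      field_simp
      ring
    simp only [this]
    rw [h, smul_zero]
  have hm : MemLp f 2 (volume.restrict (Ioc (-π) π)) := by
    obtain ⟨C, hC⟩ := (isCompact_Icc (a := -π) (b := π)).exists_bound_of_continuousOn
      hf.continuousOn
    refine MemLp.of_bound hf.aestronglyMeasurable C ?_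
    filter_upwards [ae_restrict_mem measurableSet_Ioc] with x hx
    exact hC x (Ioc_subset_Icc_self hx)
  -- Parseval: all coefficients vanish, so `∫ |f|² = 0`, and continuity excludes a nonzero value.
  have h2 := hasSum_sq_fourierCoeffOn hπ hm
  simp only [h1, norm_zero, ne_eq, OfNat.ofNat_ne_zero, not_false_eq_true, zero_pow] at h2
  have h3 := h2.unique hasSum_zero
  have h4 : ∫ x in (-π)..π, ‖f x‖ ^ 2 = 0 := by
    rw [smul_eq_mul] at h3
    exact (mul_eq_zero.mp h3).resolve_left (inv_ne_zero (by linarith))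
  by_contra hne
  have hcn : Continuous fun x => ‖f x‖ ^ 2 := by fun_prop
  have h5 := intervalIntegral.integral_pos hπ hcn.continuousOn (fun x _ => by positivity)
    ⟨θ, Ioo_subset_Icc_self hθ, by positivity⟩
  linarith

end AngularTestFunction

/-! ### Diagonalisation of `J` and the scalar form of the eigenvalue equation -/

section Spin

variable {h w : ℝ → ℝ} {ω : ℝ} {m : ℤ} {z : ℂ} {σ : ℤ}

theorem eq_one_or_eq_neg_one_of_sq (hσ : σ ^ 2 = 1) : σ = 1 ∨ σ = -1 :=
  sq_eq_sq_iff_eq_or_eq_neg.mp (hσ.trans (one_pow 2).symm)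

/-- The component `v₀ + σ i v₁`, `σ = ±1`, of a vector along the eigenspaces of `J`. -/
def spinPart (σ : ℤ) : C2 →L[ℂ] ℂ :=
  (EuclideanSpace.proj 0 : C2 →L[ℂ] ℂ) +
    ((σ : ℂ) * Complex.I) • (EuclideanSpace.proj 1 : C2 →L[ℂ] ℂ)

theorem spinPart_apply (σ : ℤ) (v : C2) : spinPart σ v = v 0 + σ * Complex.I * v 1 := rfl

theorem norm_spinPart_apply_le (hσ : σ ^ 2 = 1) (v : C2) : ‖spinPart σ v‖ ≤ 2 * ‖v‖ := by
  have hn : ‖(σ : ℂ)‖ = 1 := by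
    rcases eq_one_or_eq_neg_one_of_sq hσ with h | h <;> simp [h]
  rw [spinPart_apply]
  refine (norm_add_le _ _).trans ?_
  rw [norm_mul, norm_mul, hn, Complex.norm_I, one_mul, one_mul, two_mul]
  exact add_le_add (PiLp.norm_apply_le v 0) (PiLp.norm_apply_le v 1)

theorem ext_spinPart {u v : C2} (huv : ∀ σ : ℤ, σ ^ 2 = 1 → spinPart σ u = spinPart σ v) :
    u = v := by
  have h1 := huv 1 (by norm_num)
  have h2 := huv (-1) (by norm_num)
  simp only [spinPart_apply] at h1 h2
  push_cast at h1 h2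
  ext i
  fin_cases i
  · change u 0 = v 0
    linear_combination (h1 + h2) / 2
  · change u 1 = v 1
    linear_combination (-Complex.I / 2) * (h1 - h2) + (u 1 - v 1) * Complex.I_sq

theorem spinPart_matJ (hσ : σ ^ 2 = 1) (v : C2) :
    spinPart σ (Matrix.toEuclideanCLM (n := Fin 2) (𝕜 := ℂ) matJ v) =
      σ * Complex.I * spinPart σ v := by
  have hσ' : (σ : ℂ) ^ 2 = 1 := by exact_mod_cast hσ
  rw [spinPart_apply, spinPart_apply, toEuclideanCLM_matJ_zero, toEuclideanCLM_matJ_one]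
  linear_combination (v 1) * hσ' - (v 1) * (σ : ℂ) ^ 2 * Complex.I_sq

theorem cos_add_sin_mul_I (hσ : σ ^ 2 = 1) (t : ℝ) :
    (Real.cos t : ℂ) + σ * Complex.I * Real.sin t = Complex.exp (Complex.I * (σ * t)) := by
  rw [mul_comm Complex.I, Complex.exp_mul_I]
  rcases eq_one_or_eq_neg_one_of_sq hσ with h | h <;> simp [h] <;> ring

/-- The matrix `R` exchanges the two components and `e^{tJ}` multiplies component `σ` by `e^{iσt}`.
-/
theorem spinPart_potential (hσ : σ ^ 2 = 1) (x : Plane) (v : C2) :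
    spinPart σ (Matrix.toEuclideanCLM (n := Fin 2) (𝕜 := ℂ) (potential h m w x) v) =
      alpha h (w ‖x‖) * spinPart σ v + beta h (w ‖x‖) *
        (Complex.exp (Complex.I * ((2 * σ * m : ℤ) * angle x)) * spinPart (-σ) v) := by
  have hσ' : (σ : ℂ) ^ 2 = 1 := by exact_mod_cast hσ
  have he : Complex.exp (Complex.I * ((2 * σ * m : ℤ) * angle x)) =
      (Real.cos (2 * m * angle x) : ℂ) + σ * Complex.I * Real.sin (2 * m * angle x) := by
    rw [cos_add_sin_mul_I hσ]
    congr 2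
    push_cast
    ring
  rw [he, spinPart_apply, spinPart_apply, spinPart_apply, Matrix.ofLp_toEuclideanCLM]
  simp only [potential, expJ, matJ, matR, Matrix.mulVec, dotProduct, Fin.sum_univ_two,
    Matrix.add_apply, Matrix.smul_apply, Matrix.mul_apply, Matrix.one_apply, smul_eq_mul,
    Matrix.of_apply, Matrix.cons_val_zero, Matrix.cons_val_one, Matrix.cons_val', if_true,
    Fin.isValue, one_ne_zero, zero_ne_one, if_false, Matrix.cons_val_fin_one]
  generalize (Real.cos (2 * m * angle x) : ℂ) = c
  generalize (Real.sin (2 * m * angle x) : ℂ) = s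
  push_cast
  linear_combination -(beta h (w ‖x‖) * s * v 1) * hσ' +
    (beta h (w ‖x‖) * s * v 1) * (σ : ℂ) ^ 2 * Complex.I_sq

/-- The right-hand side of the component with index `σ` of the eigenvalue equation, written in the
form `Δ p = …`. -/
def spinRHS (h : ℝ → ℝ) (ω : ℝ) (m : ℤ) (w : ℝ → ℝ) (z : ℂ) (σ : ℤ) (p p' : Plane → ℂ)
    (x : Plane) : ℂ :=
  (ω - σ * Complex.I * z) * p x - (alpha h (w ‖x‖) * p x + beta h (w ‖x‖) *
    (Complex.exp (Complex.I * ((2 * σ * m : ℤ) * angle x)) * p' x))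

/-- On component `σ`, inverting `J` is multiplication by `-σ i`. -/
theorem matJ_eq_smul_iff (x : Plane) (L : C2) (v : Plane → C2) :
    Matrix.toEuclideanCLM (n := Fin 2) (𝕜 := ℂ) matJ (L - (ω : ℂ) • v x +
        Matrix.toEuclideanCLM (n := Fin 2) (𝕜 := ℂ) (potential h m w x) (v x)) = z • v x ↔
      ∀ σ : ℤ, σ ^ 2 = 1 → spinPart σ L = spinRHS h ω m w z σ (fun x => spinPart σ (v x))
        (fun x => spinPart (-σ) (v x)) x := by
  have key : ∀ σ : ℤ, σ ^ 2 = 1 →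
      (spinPart σ (Matrix.toEuclideanCLM (n := Fin 2) (𝕜 := ℂ) matJ (L - (ω : ℂ) • v x +
        Matrix.toEuclideanCLM (n := Fin 2) (𝕜 := ℂ) (potential h m w x) (v x))) =
          spinPart σ (z • v x) ↔
        spinPart σ L = spinRHS h ω m w z σ (fun x => spinPart σ (v x))
          (fun x => spinPart (-σ) (v x)) x) := fun σ hσ => by
    have hσ' : (σ : ℂ) ^ 2 = 1 := by exact_mod_cast hσ
    rw [spinPart_matJ hσ, map_add, map_sub, map_smul, map_smul, spinPart_potential hσ, spinRHS,
      smul_eq_mul, smul_eq_mul]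
    generalize (alpha h (w ‖x‖) * spinPart σ (v x) + beta h (w ‖x‖) *
        (Complex.exp (Complex.I * ((2 * σ * m : ℤ) * angle x)) * spinPart (-σ) (v x)) : ℂ) = V
    generalize spinPart σ (v x) = p
    generalize spinPart σ L = l
    constructor
    · intro e
      linear_combination (-σ * Complex.I) * e + (-(l - ω * p + V)) * hσ' +
        ((σ : ℂ) ^ 2 * (l - ω * p + V)) * Complex.I_sq
    · intro e
      linear_combination (σ * Complex.I) * e + z * p * hσ' - z * p * (σ : ℂ) ^ 2 * Complex.I_sq
  constructor
  · intro e σ hσ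
    exact (key σ hσ).mp (by rw [e])
  · intro e
    exact ext_spinPart fun σ hσ => (key σ hσ).mpr (e σ hσ)

/-- The eigenvalue equation in components. -/
theorem linearization_eq_smul_iff (hw : IsStandingWave h ω m w) (u : sobolevH2) {v : Plane → C2}
    (hv : (u : L2) =ᵐ[volume] v) :
    linearization hw u = z • (u : L2) ↔ ∀ᵐ x : Plane, ∀ σ : ℤ, σ ^ 2 = 1 →
      spinPart σ (lapL2 u x) = spinRHS h ω m w z σ (fun x => spinPart σ (v x))
        (fun x => spinPart (-σ) (v x)) x := by
  have h1 : linearization hw u =ᵐ[volume] fun x => Matrix.toEuclideanCLM (n := Fin 2) (𝕜 := ℂ) matJ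
      (lapL2 u x - (ω : ℂ) • v x +
        Matrix.toEuclideanCLM (n := Fin 2) (𝕜 := ℂ) (potential h m w x) (v x)) := by
    rw [linearization_apply]
    filter_upwards [coeFn_mulJ (lapL2 u - (ω : ℂ) • (u : L2) + potentialL2 hw (u : L2)),
      Lp.coeFn_add (lapL2 u - (ω : ℂ) • (u : L2)) (potentialL2 hw (u : L2)),
      Lp.coeFn_sub (lapL2 u) ((ω : ℂ) • (u : L2)), Lp.coeFn_smul (ω : ℂ) (u : L2),
      (memLp_potential hw (u : L2)).coeFn_toLp, hv] with x e1 e2 e3 e4 e5 e6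
    have e5' : potentialL2 hw (u : L2) x =
      Matrix.toEuclideanCLM (n := Fin 2) (𝕜 := ℂ) (potential h m w x) ((u : L2) x) := e5
    rw [e1, e2, Pi.add_apply, e3, Pi.sub_apply, e4, Pi.smul_apply, e5', e6]
  have h2 : (z • (u : L2) : L2) =ᵐ[volume] fun x => z • v x := by
    filter_upwards [Lp.coeFn_smul z (u : L2), hv] with x e1 e2
    rw [e1, Pi.smul_apply, e2]
  constructor
  · intro e
    rw [e] at h1
    filter_upwards [h1, h2] with x e1 e2
    exact (matJ_eq_smul_iff x _ v).mp (e1.symm.trans e2)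
  · intro e
    refine Lp.ext ?_
    filter_upwards [h1, h2, e] with x e1 e2 e3
    rw [e1, e2]
    exact (matJ_eq_smul_iff x _ v).mpr e3

theorem measurable_spinRHS (hw : IsStandingWave h ω m w) {p p' : Plane → ℂ} (hp : Measurable p)
    (hp' : Measurable p') : Measurable (spinRHS h ω m w z σ p p') := by
  have h1 : Measurable fun x : Plane => (alpha h (w ‖x‖) : ℂ) :=
    Complex.measurable_ofReal.comp ((measurable_alpha hw).comp (measurable_radial hw))
  have h2 : Measurable fun x : Plane => (beta h (w ‖x‖) : ℂ) :=
    Complex.measurable_ofReal.comp ((measurable_beta hw).comp (measurable_radial hw))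
  have h3 : Measurable fun x : Plane => (angle x : ℂ) :=
    Complex.measurable_ofReal.comp measurable_angle
  unfold spinRHS
  fun_prop

theorem norm_spinRHS_potential_le {p p' : Plane → ℂ} {M W : ℝ} {x : Plane} (hM : ‖p x‖ ≤ M)
    (hM' : ‖p' x‖ ≤ M) (hα : |alpha h (w ‖x‖)| ≤ W) (hβ : |beta h (w ‖x‖)| ≤ W) :
    ‖alpha h (w ‖x‖) * p x + beta h (w ‖x‖) *
      (Complex.exp (Complex.I * ((2 * σ * m : ℤ) * angle x)) * p' x)‖ ≤ 2 * M * W := by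
  have hM0 : 0 ≤ M := (norm_nonneg _).trans hM
  refine (norm_add_le _ _).trans ?_
  rw [norm_mul, norm_mul, norm_mul, norm_angular_exp, one_mul, Complex.norm_real,
    Complex.norm_real, Real.norm_eq_abs, Real.norm_eq_abs]
  have h1 := mul_le_mul hα hM (norm_nonneg _) ((abs_nonneg _).trans hα)
  have h2 := mul_le_mul hβ hM' (norm_nonneg _) ((abs_nonneg _).trans hα)
  linarith

theorem exists_norm_spinRHS_le (hw : IsStandingWave h ω m w) {p p' : Plane → ℂ} {M : ℝ}
    (hM : ∀ x, ‖p x‖ ≤ M) (hM' : ∀ x, ‖p' x‖ ≤ M) :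
    ∃ K, ∀ x, ‖spinRHS h ω m w z σ p p' x‖ ≤ K := by
  obtain ⟨K, hK⟩ := exists_bound hw
  refine ⟨‖(ω - σ * Complex.I * z : ℂ)‖ * M + 2 * M * K, fun x => ?_⟩
  refine (norm_sub_le _ _).trans (add_le_add ?_ (norm_spinRHS_potential_le (hM x) (hM' x)
    (hK _ (norm_nonneg _)).1 (hK _ (norm_nonneg _)).2))
  rw [norm_mul]
  exact mul_le_mul_of_nonneg_left (hM x) (norm_nonneg _)

/-- A scalar component of the distributional Laplacian of an element of `H²`. -/
theorem integral_laplacian_mul_spinPart (u : sobolevH2) (φ : 𝓢(Plane, ℂ)) (σ : ℤ) :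
    ∫ x, Δ φ x * spinPart σ ((u : L2) x) = ∫ x, φ x * spinPart σ (lapL2 u x) := by
  have h1 := congrArg (fun T : 𝓢'(Plane, C2) => spinPart σ (T φ)) (laplacian_lapL2 u)
  simp only [TemperedDistribution.laplacian_apply_apply, Lp.toTemperedDistribution_apply] at h1
  have hi : ∀ (ψ : 𝓢(Plane, ℂ)) (f : L2), Integrable fun x => ψ x • f x := fun ψ f =>
    memLp_one_iff_integrable.mp (MemLp.smul (p := 2) (q := 2) (r := 1) (Lp.memLp f) (ψ.memLp 2))
  rw [← ContinuousLinearMap.integral_comp_comm _ (hi _ _),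
    ← ContinuousLinearMap.integral_comp_comm _ (hi _ _)] at h1
  simpa only [map_smul, smul_eq_mul] using h1

end Spin

/-! ### Eigenvectors give radial solutions -/

section Modes

open scoped Real

variable {p : Plane → ℂ} {M : ℝ} {n : ℤ}

/-- Dominated convergence in `θ`, phrased with filters so that it covers both the origin and
infinity. -/
theorem tendsto_mode_comp_log (hp : Continuous p) (hM : ∀ x, ‖p x‖ ≤ M) {l : Filter ℝ}
    [l.IsCountablyGenerated] {l' : Filter Plane} {c : ℂ}
    (hl : ∀ θ, Tendsto (fun r => logPolar (Real.log r) θ) l l') (hc : Tendsto p l' (𝓝 c)) :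
    Tendsto (fun r => mode n (fun t θ => p (logPolar t θ)) (Real.log r)) l
      (𝓝 (∫ θ in (-π)..π, Complex.exp (Complex.I * (n * θ)) * c)) := by
  refine intervalIntegral.tendsto_integral_filter_of_dominated_convergence (fun _ => M)
    (Eventually.of_forall fun r => ?_) (Eventually.of_forall fun r => ae_of_all _ fun θ _ => ?_)
    (by simp) (ae_of_all _ fun θ _ => tendsto_const_nhds.mul (hc.comp (hl θ)))
  · exact ((continuous_angular_exp n).mul (hp.comp (continuous_logPolar.comp
      (by fun_prop : Continuous fun θ : ℝ => (Real.log r, θ))))).aestronglyMeasurable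
  · rw [norm_mul, norm_angular_exp, one_mul]
    exact hM _

theorem boundaryCondition_mode_comp_log (hp : Continuous p) (hM : ∀ x, ‖p x‖ ≤ M)
    (h0 : Tendsto p (cocompact Plane) (𝓝 0)) :
    BoundaryCondition fun r => mode n (fun t θ => p (logPolar t θ)) (Real.log r) := by
  refine ⟨⟨_, tendsto_mode_comp_log hp hM (fun θ => ?_) (hp.tendsto 0)⟩, ?_⟩
  · rw [tendsto_zero_iff_norm_tendsto_zero]
    have h1 : Tendsto (fun r : ℝ => r) (𝓝[>] 0) (𝓝 0) := nhdsWithin_le_nhds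
    refine h1.congr' ?_
    filter_upwards [self_mem_nhdsWithin] with r hr
    rw [norm_logPolar, Real.exp_log hr]
  · have h1 := tendsto_mode_comp_log (n := n) (l := atTop) (l' := cocompact Plane) hp hM
      (fun θ => ?_) h0
    · simpa using h1
    · refine tendsto_cocompact_of_tendsto_dist_comp_atTop (0 : Plane) ?_
      refine tendsto_id.congr' ?_
      filter_upwards [eventually_gt_atTop 0] with r hr
      rw [dist_zero_right, norm_logPolar, Real.exp_log hr, id]

/-- A function all of whose angular modes vanish is zero away from the origin. -/
theorem eq_zero_of_forall_mode_eq_zero (hp : Continuous p)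
    (h : ∀ n t, mode n (fun t θ => p (logPolar t θ)) t = 0) {x : Plane} (hx : x ≠ 0) : p x = 0 := by
  have hc : Continuous fun θ => p (logPolar (Real.log ‖x‖) θ) :=
    hp.comp (continuous_logPolar.comp (by fun_prop : Continuous fun θ : ℝ => (Real.log ‖x‖, θ)))
  have h1 : EqOn (fun θ => p (logPolar (Real.log ‖x‖) θ)) (fun _ => 0) (Ioo (-π) π) :=
    fun θ hθ => eq_zero_of_forall_integral_exp_eq_zero hc (fun n => h n _) hθ
  -- Completeness was shown on the open interval; the closure adds `θ = π`, a value that `angle`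
  -- takes.
  have h2 := h1.closure hc continuous_const
  rw [closure_Ioo (by linarith [Real.pi_pos])] at h2
  rw [← logPolar_log_norm_angle hx]
  exact h2 (Ioc_subset_Icc_self (Complex.arg_mem_Ioc _))

variable {h w : ℝ → ℝ} {ω : ℝ} {m : ℤ} {z : ℂ} {σ : ℤ}

theorem spinRHS_logPolar (p p' : Plane → ℂ) (t : ℝ) {θ : ℝ} (hθ : θ ∈ Ioc (-π) π) :
    spinRHS h ω m w z σ p p' (logPolar t θ) =
      (ω - σ * Complex.I * z - alpha h (w (Real.exp t))) * p (logPolar t θ) -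
        beta h (w (Real.exp t)) * (Complex.exp (Complex.I * ((2 * σ * m : ℤ) * θ)) *
          p' (logPolar t θ)) := by
  rw [spinRHS, norm_logPolar, angle_logPolar t hθ]
  ring

/-- The phase `e^{2iσmθ}` shifts the mode by `2σm`, and the equation for `-σ` shifts it back: the
modes decouple into pairs. -/
theorem mode_spinRHS {p' : Plane → ℂ} (hp : Continuous p) (hp' : Continuous p') (n : ℤ) (t : ℝ) :
    mode n (fun t θ => spinRHS h ω m w z σ p p' (logPolar t θ)) t =
      (ω - σ * Complex.I * z - alpha h (w (Real.exp t))) *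
          mode n (fun t θ => p (logPolar t θ)) t -
        beta h (w (Real.exp t)) * mode (n + 2 * σ * m) (fun t θ => p' (logPolar t θ)) t := by
  have hs : Continuous fun θ : ℝ => (t, θ) := by fun_prop
  have hpc := hp.comp (continuous_logPolar.comp hs)
  have hpc' := hp'.comp (continuous_logPolar.comp hs)
  simp only [mode]
  rw [← intervalIntegral.integral_const_mul, ← intervalIntegral.integral_const_mul,
    ← intervalIntegral.integral_sub]
  · refine intervalIntegral.integral_congr_ae (ae_of_all _ fun θ hθ => ?_)
    rw [uIoc_of_le (by linarith [Real.pi_pos])] at hθ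
    rw [spinRHS_logPolar p p' t hθ]
    have : Complex.exp (Complex.I * (((n + 2 * σ * m : ℤ) : ℂ) * θ)) =
        Complex.exp (Complex.I * (n * θ)) * Complex.exp (Complex.I * ((2 * σ * m : ℤ) * θ)) := by
      rw [← Complex.exp_add]
      congr 1
      push_cast
      ring
    rw [this]
    ring
  · exact (continuous_const.mul ((continuous_angular_exp n).mul hpc)).intervalIntegrable _ _
  · exact (continuous_const.mul ((continuous_angular_exp _).mul hpc')).intervalIntegrable _ _

theorem continuous_comp_profile_exp (hw : IsStandingWave h ω m w) :
    Continuous fun t => w (Real.exp t) :=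
  (continuousOn_profile hw).comp_continuous Real.continuous_exp fun t => (Real.exp_pos t).le

/-- The angular modes of a bounded solution of the eigenvalue equation solve the radial system. -/
theorem contDiffOn_and_radialLap_mode (hw : IsStandingWave h ω m w) {p' : Plane → ℂ}
    (hp : Continuous p) (hp' : Continuous p') (hM : ∀ x, ‖p x‖ ≤ M) (hM' : ∀ x, ‖p' x‖ ≤ M)
    (heq : ∀ φ : 𝓢(Plane, ℂ), ∫ x, Δ φ x * p x = ∫ x, φ x * spinRHS h ω m w z σ p p' x)
    (n : ℤ) :
    ContDiffOn ℝ 2 (fun r => mode n (fun t θ => p (logPolar t θ)) (Real.log r)) (Ioi 0) ∧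
    ∀ r : ℝ, 0 < r → radialLap n (fun r => mode n (fun t θ => p (logPolar t θ)) (Real.log r)) r =
      (ω - σ * Complex.I * z - alpha h (w r)) *
          mode n (fun t θ => p (logPolar t θ)) (Real.log r) -
        beta h (w r) * mode (n + 2 * σ * m) (fun t θ => p' (logPolar t θ)) (Real.log r) := by
  obtain ⟨K, hK⟩ := exists_norm_spinRHS_le (z := z) (σ := σ) hw hM hM'
  have hwc := continuous_comp_profile_exp hw
  have hα : Continuous fun t => (alpha h (w (Real.exp t)) : ℂ) :=
    Complex.continuous_ofReal.comp ((continuous_alpha hw).comp hwc)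
  have hβ : Continuous fun t => (beta h (w (Real.exp t)) : ℂ) :=
    Complex.continuous_ofReal.comp ((continuous_beta hw).comp hwc)
  have hY := continuous_mode (n := n) (F := fun t θ => p (logPolar t θ))
    (hp.comp continuous_logPolar)
  have hY' := continuous_mode (n := n + 2 * σ * m) (F := fun t θ => p' (logPolar t θ))
    (hp'.comp continuous_logPolar)
  have hG : Continuous fun t => (ω - σ * Complex.I * z - alpha h (w (Real.exp t))) *
      mode n (fun t θ => p (logPolar t θ)) t -
      beta h (w (Real.exp t)) * mode (n + 2 * σ * m) (fun t θ => p' (logPolar t θ)) t :=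
    ((continuous_const.sub hα).mul hY).sub (hβ.mul hY')
  obtain ⟨Y₁, h1, h2⟩ := exists_hasDerivAt_mode hp hM
    (measurable_spinRHS hw hp.measurable hp'.measurable).aestronglyMeasurable hK hG
    (fun t => mode_spinRHS hp hp' n t) heq
  refine ⟨contDiffOn_comp_log (contDiff_two_of_hasDerivAt h1 h2 ?_), fun r hr => ?_⟩
  · exact (hY.const_mul _).add ((by fun_prop : Continuous fun t : ℝ => Real.exp (2 * t)).smul hG)
  · rw [radialLap_comp_log h1 h2 n hr]
    have hr0 : (r : ℂ) ≠ 0 := by exact_mod_cast hr.ne'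
    have he : Real.exp (2 * Real.log r) = r ^ 2 := by
      rw [two_mul, Real.exp_add, Real.exp_log hr, sq]
    simp only [he, Real.exp_log hr, Complex.real_smul, add_sub_cancel_left]
    push_cast
    field_simp

theorem radialLap_neg (n : ℤ) (y : ℝ → ℂ) (r : ℝ) : radialLap (-n) y r = radialLap n y r := by
  simp [radialLap]

theorem exists_mode_ne_zero {u : L2} {g : Plane → C2} (hg : Continuous g)
    (hug : u =ᵐ[volume] g) (hu : u ≠ 0) : ∃ σ : ℤ, σ ^ 2 = 1 ∧ ∃ n t,
      mode n (fun t θ => spinPart σ (g (logPolar t θ))) t ≠ 0 := by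
  by_contra! hall
  refine hu (Lp.ext ?_)
  have hae : ∀ᵐ x : Plane, x ≠ 0 := Measure.ae_ne volume 0
  filter_upwards [hug, hae, Lp.coeFn_zero C2 2 (volume : Measure Plane)] with x e1 e2 e3
  rw [e1, e3]
  refine ext_spinPart fun σ hσ => ?_
  rw [Pi.zero_apply, map_zero]
  have hp : Continuous fun x => spinPart σ (g x) := (spinPart σ).continuous.comp hg
  exact eq_zero_of_forall_mode_eq_zero (p := fun x => spinPart σ (g x)) hp (hall σ hσ) e2

/-- An eigenvector gives a nontrivial solution of the radial system. -/
theorem exists_isRadialSolution_of_eigenvector (hw : IsStandingWave h ω m w)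
    (u : sobolevH2) (hu0 : (u : L2) ≠ 0) (hu : linearization hw u = z • (u : L2)) :
    ∃ (j : ℤ) (yp ym : ℝ → ℂ), IsRadialSolution h ω m w z j yp ym ∧
      BoundaryCondition yp ∧ BoundaryCondition ym ∧
      ∃ r : ℝ, 0 < r ∧ (yp r ≠ 0 ∨ ym r ≠ 0) := by
  obtain ⟨g, hg, hg0, hug⟩ := exists_continuous_of_memSobolev (s := 2) (by simp) (u : L2)
    (mem_sobolevH2.mp u.2)
  obtain ⟨B, hB⟩ : ∃ B, ∀ x, ‖g x‖ ≤ B := by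
    obtain ⟨B, hB⟩ := (ZeroAtInftyContinuousMap.isBounded_range (⟨⟨g, hg⟩, hg0⟩ :
      ZeroAtInftyContinuousMap Plane C2)).exists_norm_le
    exact ⟨B, fun x => hB _ ⟨x, rfl⟩⟩
  have hpc : ∀ σ : ℤ, Continuous fun x => spinPart σ (g x) := fun σ => (spinPart σ).continuous.comp hg
  have hp0 : ∀ σ : ℤ, Tendsto (fun x => spinPart σ (g x)) (cocompact Plane) (𝓝 0) := fun σ => by
    have := ((spinPart σ).continuous.tendsto 0).comp hg0
    rwa [map_zero] at this
  have hpM : ∀ σ : ℤ, σ ^ 2 = 1 → ∀ x, ‖spinPart σ (g x)‖ ≤ 2 * B := fun σ hσ x =>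
    (norm_spinPart_apply_le hσ _).trans (by linarith [hB x])
  have hsq : ∀ σ : ℤ, σ ^ 2 = 1 → (-σ) ^ 2 = 1 := fun σ hσ => by rwa [neg_sq]
  have heq : ∀ σ : ℤ, σ ^ 2 = 1 → ∀ φ : 𝓢(Plane, ℂ), ∫ x, Δ φ x * spinPart σ (g x) =
      ∫ x, φ x * spinRHS h ω m w z σ (fun x => spinPart σ (g x)) (fun x => spinPart (-σ) (g x)) x := by
    intro σ hσ φ
    have h1 := integral_laplacian_mul_spinPart u φ σ
    have h2 : ∫ x, Δ φ x * spinPart σ (g x) = ∫ x, Δ φ x * spinPart σ ((u : L2) x) := by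
      refine integral_congr_ae ?_
      filter_upwards [hug] with x hx
      rw [hx]
    rw [h2, h1]
    refine integral_congr_ae ?_
    filter_upwards [(linearization_eq_smul_iff hw u hug).mp hu] with x hx
    rw [hx σ hσ]
  have hres := fun (σ : ℤ) (hσ : σ ^ 2 = 1) (n : ℤ) => contDiffOn_and_radialLap_mode
    (p := fun x => spinPart σ (g x)) (p' := fun x => spinPart (-σ) (g x)) hw (hpc σ)
    (hpc (-σ)) (hpM σ hσ) (hpM (-σ) (hsq σ hσ)) (heq σ hσ) n
  obtain ⟨σ, hσ, n, t, hne⟩ := exists_mode_ne_zero hg hug hu0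
  -- The minus sign is there because `mode n` extracts the coefficient of `e^{-inθ}`; the radial
  -- operator depends on `n²` only.
  obtain ⟨j, hj⟩ : ∃ j : ℤ, n = -(j + σ * m) := ⟨-n - σ * m, by ring⟩
  have hb : ∀ τ : ℤ, τ ^ 2 = 1 → ∀ n : ℤ, BoundaryCondition
      fun r => mode n (fun t θ => spinPart τ (g (logPolar t θ))) (Real.log r) := fun τ hτ n =>
    boundaryCondition_mode_comp_log (p := fun x => spinPart τ (g x)) (hpc τ) (hpM τ hτ) (hp0 τ)
  refine ⟨j, fun r => mode (-(j + m)) (fun t θ => spinPart 1 (g (logPolar t θ))) (Real.log r),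
    fun r => mode (-(j - m)) (fun t θ => spinPart (-1) (g (logPolar t θ))) (Real.log r),
    ⟨(hres 1 (by norm_num) _).1, (hres (-1) (by norm_num) _).1, fun r hr => ?_, fun r hr => ?_⟩,
    hb 1 (by norm_num) _, hb (-1) (by norm_num) _, Real.exp t, Real.exp_pos t, ?_⟩
  · have e1 := (hres 1 (by norm_num) (-(j + m))).2 r hr
    rw [radialLap_neg, show -(j + m) + 2 * 1 * m = -(j - m) by ring] at e1
    rw [e1]
    push_cast
    ring
  · have e1 := (hres (-1) (by norm_num) (-(j - m))).2 r hr
    rw [radialLap_neg, show -(j - m) + 2 * -1 * m = -(j + m) by ring, neg_neg] at e1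
    rw [e1]
    push_cast
    ring
  · simp only [Real.log_exp]
    rcases eq_one_or_eq_neg_one_of_sq hσ with e | e
    · left
      rwa [hj, e, one_mul] at hne
    · right
      rwa [hj, e, neg_one_mul, ← sub_eq_add_neg] at hne

end Modes

/-! ### Radial solutions give eigenvectors -/

section Reconstruction

variable {h w : ℝ → ℝ} {ω : ℝ} {m : ℤ} {z : ℂ} {σ : ℤ}

/-- The vector of `ℂ²` with components `a σ`, `σ = ±1`, along the eigenspaces of `J`. -/
def ofSpin (a : ℤ → ℂ) : C2 := (a 1 / 2) • eigvecJ 1 + (a (-1) / 2) • eigvecJ (-1)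

theorem spinPart_ofSpin (hσ : σ ^ 2 = 1) (a : ℤ → ℂ) : spinPart σ (ofSpin a) = a σ := by
  have h0 : ∀ τ : ℂ, eigvecJ τ 0 = 1 := fun τ => rfl
  have h1 : ∀ τ : ℂ, eigvecJ τ 1 = -(τ * Complex.I) := fun τ => rfl
  simp only [ofSpin, map_add, map_smul, spinPart_apply, h0, h1, smul_eq_mul]
  rcases eq_one_or_eq_neg_one_of_sq hσ with rfl | rfl
  · push_cast
    linear_combination (a (-1) / 2 - a 1 / 2) * Complex.I_sq
  · push_cast
    linear_combination (a 1 / 2 - a (-1) / 2) * Complex.I_sq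

theorem memLp_ofSpin {p : ℤ → Plane → ℂ} (hp : ∀ σ : ℤ, σ ^ 2 = 1 → MemLp (p σ) 2) :
    MemLp (fun x => ofSpin fun σ => p σ x) 2 := by
  have h1 := ((ContinuousLinearMap.id ℂ ℂ).smulRight ((1 / 2 : ℂ) • eigvecJ 1)).comp_memLp'
    (hp 1 (by norm_num))
  have h2 := ((ContinuousLinearMap.id ℂ ℂ).smulRight ((1 / 2 : ℂ) • eigvecJ (-1))).comp_memLp'
    (hp (-1) (by norm_num))
  refine (h1.add h2).ae_eq (Eventually.of_forall fun x => ?_)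
  simp only [Pi.add_apply, Function.comp_apply, ContinuousLinearMap.smulRight_apply,
    ContinuousLinearMap.id_apply, smul_smul, ofSpin, mul_one_div]

theorem integrable_schwartz_smul (φ : 𝓢(Plane, ℂ)) {f : Plane → C2} (hf : MemLp f 2) :
    Integrable fun x => φ x • f x :=
  memLp_one_iff_integrable.mp (MemLp.smul (p := 2) (q := 2) (r := 1) hf (φ.memLp 2))

/-- A square integrable distributional solution of the eigenvalue equation is an eigenvector. -/
theorem isEigenvalue_of_distributional_solution (hw : IsStandingWave h ω m w)
    {p : ℤ → Plane → ℂ} (hp : ∀ σ : ℤ, σ ^ 2 = 1 → MemLp (p σ) 2)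
    (hF : ∀ σ : ℤ, σ ^ 2 = 1 → MemLp (spinRHS h ω m w z σ (p σ) (p (-σ))) 2)
    (heq : ∀ σ : ℤ, σ ^ 2 = 1 → ∀ φ : 𝓢(Plane, ℂ), ∫ x, Δ φ x * p σ x =
      ∫ x, φ x * spinRHS h ω m w z σ (p σ) (p (-σ)) x)
    (hne : ∃ σ : ℤ, σ ^ 2 = 1 ∧ ¬ p σ =ᵐ[volume] 0) : IsEigenvalue (linearization hw) z := by
  have hv := memLp_ofSpin hp
  have hG := memLp_ofSpin (p := fun σ => spinRHS h ω m w z σ (p σ) (p (-σ))) hF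
  have hlap : Δ ((hv.toLp _ : L2) : 𝓢'(Plane, C2)) = ((hG.toLp _ : L2) : 𝓢'(Plane, C2)) := by
    ext1 φ
    rw [TemperedDistribution.laplacian_apply_apply, Lp.toTemperedDistribution_apply,
      Lp.toTemperedDistribution_apply]
    refine ext_spinPart fun σ hσ => ?_
    rw [← ContinuousLinearMap.integral_comp_comm _ (integrable_schwartz_smul (Δ φ) (Lp.memLp _)),
      ← ContinuousLinearMap.integral_comp_comm _ (integrable_schwartz_smul φ (Lp.memLp _))]
    have e1 : ∫ x, spinPart σ (Δ φ x • (hv.toLp _ : L2) x) = ∫ x, Δ φ x * p σ x := by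
      refine integral_congr_ae ?_
      filter_upwards [hv.coeFn_toLp] with x hx
      rw [hx, map_smul, spinPart_ofSpin hσ, smul_eq_mul]
    have e2 : ∫ x, spinPart σ (φ x • (hG.toLp _ : L2) x) =
        ∫ x, φ x * spinRHS h ω m w z σ (p σ) (p (-σ)) x := by
      refine integral_congr_ae ?_
      filter_upwards [hG.coeFn_toLp] with x hx
      rw [hx, map_smul, spinPart_ofSpin hσ, smul_eq_mul]
    rw [e1, e2, heq σ hσ φ]
  let u : sobolevH2 := ⟨hv.toLp _, mem_sobolevH2.mpr (memSobolev_two_of_laplacian _ _ hlap)⟩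
  have hu : (u : L2) =ᵐ[volume] fun x => ofSpin fun σ => p σ x := hv.coeFn_toLp
  have hlu : lapL2 u = hG.toLp _ := lapL2_eq hlap
  refine ⟨u, fun h0 => ?_, ?_⟩
  · obtain ⟨σ, hσ, hne⟩ := hne
    refine hne ?_
    rw [h0] at hu
    filter_upwards [hu, Lp.coeFn_zero C2 2 (volume : Measure Plane)] with x e1 e2
    rw [← spinPart_ofSpin hσ fun σ => p σ x, ← e1, e2, Pi.zero_apply, map_zero, Pi.zero_apply]
  · refine (linearization_eq_smul_iff hw u hu).mpr ?_
    rw [hlu]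
    filter_upwards [hG.coeFn_toLp] with x hx σ hσ
    have hσ' : (-σ) ^ 2 = 1 := by rwa [neg_sq]
    rw [hx, spinPart_ofSpin hσ]
    simp only [spinRHS, spinPart_ofSpin hσ, spinPart_ofSpin hσ']

/-- A bounded distributional solution of `Δ p = k p + f`, with `f` square integrable and `k` off
the negative real axis, is square integrable. -/
theorem memLp_two_of_integral_laplacian {k : ℂ} (hk : k ∈ Complex.slitPlane) {p f : Plane → ℂ}
    {M M' : ℝ} (hp : AEStronglyMeasurable p) (hM : ∀ x, ‖p x‖ ≤ M) (hf : MemLp f 2)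
    (hM' : ∀ x, ‖f x‖ ≤ M')
    (heq : ∀ φ : 𝓢(Plane, ℂ), ∫ x, Δ φ x * p x = ∫ x, φ x * (k * p x + f x)) : MemLp p 2 := by
  have hpi : MemLp p ∞ := memLp_top_of_bound hp M (Eventually.of_forall hM)
  have hcoe : ∀ φ : 𝓢(Plane, ℂ), ((hpi.toLp p : Lp ℂ ∞ (volume : Measure Plane)) :
      𝓢'(Plane, ℂ)) φ = ∫ x, φ x * p x := fun φ => by
    rw [Lp.toTemperedDistribution_apply]
    refine integral_congr_ae ?_
    filter_upwards [hpi.coeFn_toLp] with x hx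
    rw [hx, smul_eq_mul]
  have hH : Δ ((hpi.toLp p : Lp ℂ ∞ (volume : Measure Plane)) : 𝓢'(Plane, ℂ)) -
      k • ((hpi.toLp p : Lp ℂ ∞ (volume : Measure Plane)) : 𝓢'(Plane, ℂ)) =
      ((hf.toLp f : Lp ℂ 2 (volume : Measure Plane)) : 𝓢'(Plane, ℂ)) := by
    ext1 φ
    have e1 : ((hf.toLp f : Lp ℂ 2 (volume : Measure Plane)) : 𝓢'(Plane, ℂ)) φ =
        ∫ x, φ x * f x := by
      rw [Lp.toTemperedDistribution_apply]
      refine integral_congr_ae ?_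
      filter_upwards [hf.coeFn_toLp] with x hx
      rw [hx, smul_eq_mul]
    rw [sub_apply, smul_apply, TemperedDistribution.laplacian_apply_apply, hcoe, hcoe, e1, heq,
      smul_eq_mul, sub_eq_iff_eq_add, ← integral_const_mul, ← integral_add
        (integrable_schwartz_mul φ hf.1 hM') ((integrable_schwartz_mul φ hp hM).const_mul k)]
    refine integral_congr_ae (Eventually.of_forall fun x => ?_)
    simp only
    ring
  -- So far `p` is a tempered distribution only through `L^∞`; inverting `Δ - k` produces an `L²`
  -- function with the same pairings.
  obtain ⟨v, hv⟩ := TemperedDistribution.memSobolev_zero_iff.mp (memSobolev_zero_of_helmholtz hk _ hH)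
  have hae : p =ᵐ[volume] v := by
    refine ae_eq_of_integral_schwartz_smul_eq (hpi.locallyIntegrable le_top)
      ((Lp.memLp v).locallyIntegrable (by norm_num)) fun φ => ?_
    simp only [smul_eq_mul]
    rw [← hcoe, hv, Lp.toTemperedDistribution_apply]
    rfl
  exact (Lp.memLp v).ae_eq hae.symm

/-- The function `e^{inθ} y(r)` on the punctured plane, with value zero at the origin. -/
def radialExt (n : ℤ) (y : ℝ → ℂ) (x : Plane) : ℂ :=
  Complex.exp (Complex.I * (n * angle x)) * (Ioi 0).indicator y ‖x‖

variable {n : ℤ} {y : ℝ → ℂ}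

theorem radialExt_logPolar (t : ℝ) {θ : ℝ} (hθ : θ ∈ Ioc (-Real.pi) Real.pi) :
    radialExt n y (logPolar t θ) = Complex.exp (Complex.I * (n * θ)) * y (Real.exp t) := by
  rw [radialExt, angle_logPolar t hθ, norm_logPolar, indicator_of_mem (mem_Ioi.mpr (Real.exp_pos t))]

theorem measurable_radialExt (hy : ContinuousOn y (Ioi 0)) : Measurable (radialExt n y) := by
  have h1 : Measurable ((Ioi (0 : ℝ)).indicator y) := by
    classical
    rw [← piecewise_eq_indicator]
    exact hy.measurable_piecewise continuousOn_const measurableSet_Ioi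
  have h3 : Measurable fun x : Plane => (angle x : ℂ) :=
    Complex.measurable_ofReal.comp measurable_angle
  have h4 : Measurable fun x : Plane => (Ioi (0 : ℝ)).indicator y ‖x‖ := h1.comp measurable_norm
  unfold radialExt
  fun_prop

theorem norm_radialExt_le {M : ℝ} (hM0 : 0 ≤ M) (hM : ∀ r, 0 < r → ‖y r‖ ≤ M) (x : Plane) :
    ‖radialExt n y x‖ ≤ M := by
  rw [radialExt, norm_mul, norm_angular_exp, one_mul, indicator]
  split_ifs with hx
  · exact hM _ hx
  · rwa [norm_zero]

/-- By continuity `y(|x|)` is nonzero on a nonempty open set, which has positive measure, and the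
phase never vanishes. -/
theorem not_radialExt_ae_eq_zero (hy : ContinuousOn y (Ioi 0)) {r : ℝ} (hr : 0 < r)
    (hyr : y r ≠ 0) : ¬ radialExt n y =ᵐ[volume] 0 := fun h0 => by
  have hU : IsOpen ({x : Plane | 0 < ‖x‖} ∩ (fun x : Plane => y ‖x‖) ⁻¹' {0}ᶜ) := by
    refine ContinuousOn.isOpen_inter_preimage ?_ (isOpen_lt continuous_const continuous_norm)
      isOpen_compl_singleton
    exact hy.comp continuous_norm.continuousOn fun x hx => hx
  have hne : ({x : Plane | 0 < ‖x‖} ∩ (fun x : Plane => y ‖x‖) ⁻¹' {0}ᶜ).Nonempty := by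
    refine ⟨logPolar (Real.log r) 0, ?_, ?_⟩
    · rw [mem_ofPred_eq, norm_logPolar]
      exact Real.exp_pos _
    · rw [mem_preimage, norm_logPolar, Real.exp_log hr]
      exact hyr
  refine (hU.measure_pos volume hne).ne' (measure_mono_null (fun x hx => ?_) h0)
  rw [mem_compl_iff, mem_ofPred_eq, radialExt, indicator_of_mem (show ‖x‖ ∈ Ioi 0 from hx.1)]
  exact mul_ne_zero (Complex.exp_ne_zero _) hx.2

theorem exists_bound_of_boundaryCondition (hy : ContinuousOn y (Ioi 0))
    (hb : BoundaryCondition y) : ∃ M, ∀ r, 0 < r → ‖y r‖ ≤ M := by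
  obtain ⟨⟨l, hl⟩, htop⟩ := hb
  have h1 : ∀ᶠ r in 𝓝[>] (0 : ℝ), ‖y r‖ < ‖l‖ + 1 :=
    hl.norm.eventually (gt_mem_nhds (lt_add_one _))
  have h2 : ∀ᶠ r in atTop, ‖y r‖ < ‖(0 : ℂ)‖ + 1 :=
    htop.norm.eventually (gt_mem_nhds (lt_add_one _))
  obtain ⟨δ, hδ, hδ'⟩ := mem_nhdsGT_iff_exists_Ioo_subset.mp h1
  obtain ⟨R, hR⟩ := eventually_atTop.mp h2
  obtain ⟨C, hC⟩ := (isCompact_Icc (a := δ) (b := R)).exists_bound_of_continuousOn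
    (hy.mono fun r hr => lt_of_lt_of_le hδ hr.1)
  refine ⟨max (max (‖l‖ + 1) (‖(0 : ℂ)‖ + 1)) C, fun r hr => ?_⟩
  rcases lt_or_ge r δ with h | h
  · exact (le_of_lt (hδ' ⟨hr, h⟩)).trans ((le_max_left _ _).trans (le_max_left _ _))
  · rcases le_or_gt r R with h' | h'
    · exact (hC r ⟨h, h'⟩).trans (le_max_right _ _)
    · exact (hR r h'.le).le.trans ((le_max_right _ _).trans (le_max_left _ _))

/-- A bounded nontrivial solution of the radial system gives an eigenvalue off the essential
spectrum. -/
theorem isEigenvalue_of_radialLap (hw : IsStandingWave h ω m w)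
    (hz : z ∉ specEss (linearization hw)) {j : ℤ} {y : ℤ → ℝ → ℂ} {M : ℝ}
    (hy : ∀ σ : ℤ, σ ^ 2 = 1 → ContDiffOn ℝ 2 (y σ) (Ioi 0))
    (hM : ∀ σ : ℤ, σ ^ 2 = 1 → ∀ r, 0 < r → ‖y σ r‖ ≤ M)
    (heq : ∀ σ : ℤ, σ ^ 2 = 1 → ∀ r : ℝ, 0 < r → radialLap (j + σ * m) (y σ) r =
      (ω - σ * Complex.I * z - alpha h (w r)) * y σ r - beta h (w r) * y (-σ) r)
    (hne : ∃ σ : ℤ, σ ^ 2 = 1 ∧ ∃ r, 0 < r ∧ y σ r ≠ 0) : IsEigenvalue (linearization hw) z := by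
  have hM0 : 0 ≤ M := (norm_nonneg _).trans (hM 1 (by norm_num) 1 one_pos)
  set p : ℤ → Plane → ℂ := fun σ => radialExt (j + σ * m) (y σ) with hpdef
  have hpm : ∀ σ : ℤ, σ ^ 2 = 1 → Measurable (p σ) := fun σ hσ =>
    measurable_radialExt (hy σ hσ).continuousOn
  have hpM : ∀ σ : ℤ, σ ^ 2 = 1 → ∀ x, ‖p σ x‖ ≤ M := fun σ hσ =>
    norm_radialExt_le hM0 (hM σ hσ)
  have hneg : ∀ σ : ℤ, σ ^ 2 = 1 → (-σ) ^ 2 = 1 := fun σ hσ => by rwa [neg_sq]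
  have hdist : ∀ σ : ℤ, σ ^ 2 = 1 → ∀ φ : 𝓢(Plane, ℂ), ∫ x, Δ φ x * p σ x =
      ∫ x, φ x * spinRHS h ω m w z σ (p σ) (p (-σ)) x := fun σ hσ φ => by
    obtain ⟨K, hK⟩ := exists_norm_spinRHS_le (z := z) (σ := σ) hw (hpM σ hσ) (hpM _ (hneg σ hσ))
    refine integral_laplacian_mul_of_radial (hy σ hσ) (heq σ hσ) (hM σ hσ)
      (fun t θ hθ => radialExt_logPolar t hθ) (fun t θ hθ => ?_) φ
      (integrable_schwartz_mul (Δ φ) (hpm σ hσ).aestronglyMeasurable (hpM σ hσ))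
      (integrable_schwartz_mul φ
        (measurable_spinRHS hw (hpm σ hσ) (hpm _ (hneg σ hσ))).aestronglyMeasurable hK)
    rw [spinRHS_logPolar _ _ t hθ]
    simp only [hpdef]
    -- The coupling phase turns the index `j - σm` of the other component into `j + σm`, so a common
    -- phase factors out.
    rw [radialExt_logPolar t hθ, radialExt_logPolar t hθ, ← mul_assoc (Complex.exp _),
      ← Complex.exp_add, show Complex.I * (((2 * σ * m : ℤ) : ℂ) * θ) +
        Complex.I * (((j + -σ * m : ℤ) : ℂ) * θ) = Complex.I * (((j + σ * m : ℤ) : ℂ) * θ) by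
          push_cast; ring]
    ring
  obtain ⟨W, hWL, -, hW⟩ := exists_memLp_bound hw
  obtain ⟨K, hK⟩ := exists_bound hw
  have hf : ∀ σ : ℤ, σ ^ 2 = 1 → MemLp (fun x => -(alpha h (w ‖x‖) * p σ x + beta h (w ‖x‖) *
      (Complex.exp (Complex.I * ((2 * σ * m : ℤ) * angle x)) * p (-σ) x))) 2 := fun σ hσ => by
    refine MemLp.of_le (hWL.const_mul (2 * M)) ?_ (Eventually.of_forall fun x => ?_)
    · have := (measurable_spinRHS (z := z) (σ := σ) hw (hpm σ hσ) (hpm _ (hneg σ hσ))).sub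
        ((hpm σ hσ).const_mul (ω - σ * Complex.I * z))
      refine this.aestronglyMeasurable.congr (Eventually.of_forall fun x => ?_)
      simp only [Pi.sub_apply, spinRHS]
      ring
    · rw [norm_neg]
      exact (norm_spinRHS_potential_le (hpM σ hσ x) (hpM _ (hneg σ hσ) x) (hW x).1 (hW x).2).trans
        (le_abs_self _)
  -- Being off the essential spectrum enters here: it keeps `ω - σ i z` off `(-∞, 0]`.
  have hp2 : ∀ σ : ℤ, σ ^ 2 = 1 → MemLp (p σ) 2 := fun σ hσ => by
    refine memLp_two_of_integral_laplacian (M' := 2 * M * K) (mem_slitPlane_of_notMem_specEss hw hz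
      (σ := σ) (by exact_mod_cast hσ)) (hpm σ hσ).aestronglyMeasurable (hpM σ hσ) (hf σ hσ)
      (fun x => ?_) (fun φ => (hdist σ hσ φ).trans ?_)
    · rw [norm_neg]
      exact norm_spinRHS_potential_le (hpM σ hσ x) (hpM _ (hneg σ hσ) x)
        (hK _ (norm_nonneg _)).1 (hK _ (norm_nonneg _)).2
    · simp only [spinRHS, sub_eq_add_neg]
  refine isEigenvalue_of_distributional_solution hw hp2 (fun σ hσ => ?_) hdist ?_
  · have := ((hp2 σ hσ).const_mul (ω - σ * Complex.I * z)).add (hf σ hσ)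
    refine this.ae_eq (Eventually.of_forall fun x => ?_)
    simp only [Pi.add_apply, spinRHS, sub_eq_add_neg]
  · obtain ⟨σ, hσ, r, hr, hyr⟩ := hne
    exact ⟨σ, hσ, not_radialExt_ae_eq_zero (hy σ hσ).continuousOn hr hyr⟩

theorem isEigenvalue_of_isRadialSolution (hw : IsStandingWave h ω m w)
    (hz : z ∉ specEss (linearization hw)) {j : ℤ} {yp ym : ℝ → ℂ}
    (hs : IsRadialSolution h ω m w z j yp ym) (hbp : BoundaryCondition yp)
    (hbm : BoundaryCondition ym) (hne : ∃ r : ℝ, 0 < r ∧ (yp r ≠ 0 ∨ ym r ≠ 0)) :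
    IsEigenvalue (linearization hw) z := by
  obtain ⟨Mp, hMp⟩ := exists_bound_of_boundaryCondition hs.contDiffOn_plus.continuousOn hbp
  obtain ⟨Mm, hMm⟩ := exists_bound_of_boundaryCondition hs.contDiffOn_minus.continuousOn hbm
  set y : ℤ → ℝ → ℂ := fun σ => if σ = 1 then yp else ym with hydef
  have h1 : y 1 = yp := if_pos rfl
  have h2 : y (-1) = ym := if_neg (by norm_num)
  refine isEigenvalue_of_radialLap (j := j) (y := y) (M := max Mp Mm) hw hz (fun σ hσ => ?_)
    (fun σ hσ r hr => ?_) (fun σ hσ r hr => ?_) ?_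
  · rcases eq_one_or_eq_neg_one_of_sq hσ with rfl | rfl
    · rw [h1]; exact hs.contDiffOn_plus
    · rw [h2]; exact hs.contDiffOn_minus
  · rcases eq_one_or_eq_neg_one_of_sq hσ with rfl | rfl
    · rw [h1]; exact (hMp r hr).trans (le_max_left _ _)
    · rw [h2]; exact (hMm r hr).trans (le_max_right _ _)
  · rcases eq_one_or_eq_neg_one_of_sq hσ with rfl | rfl
    · rw [h1, h2, one_mul]
      push_cast
      linear_combination hs.eq_plus r hr
    · rw [neg_neg, h1, h2, neg_one_mul, ← sub_eq_add_neg]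
      push_cast
      linear_combination hs.eq_minus r hr
  · obtain ⟨r, hr, hyr | hyr⟩ := hne
    · exact ⟨1, by norm_num, r, hr, by rwa [h1]⟩
    · exact ⟨-1, by norm_num, r, hr, by rwa [h2]⟩

end Reconstruction

end SpinningWave
end

theorem proposition3p1 (h w : ℝ → ℝ) (ω : ℝ) (m : ℤ)
    (hw : SpinningWave.IsStandingWave h ω m w) (z : ℂ)
    (hz : z ∉ SpinningWave.specEss (SpinningWave.linearization hw)) :
    SpinningWave.IsEigenvalue (SpinningWave.linearization hw) z ↔
      ∃ (j : ℤ) (yp ym : ℝ → ℂ),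
        SpinningWave.IsRadialSolution h ω m w z j yp ym ∧
        SpinningWave.BoundaryCondition yp ∧ SpinningWave.BoundaryCondition ym ∧
        ∃ r : ℝ, 0 < r ∧ (yp r ≠ 0 ∨ ym r ≠ 0) := by
  constructor
  · rintro ⟨u, hu0, hu⟩
    exact SpinningWave.exists_isRadialSolution_of_eigenvector hw u hu0 hu
  · rintro ⟨j, yp, ym, hs, hbp, hbm, hne⟩
    exact SpinningWave.isEigenvalue_of_isRadialSolution hw hz hs hbp hbm hne
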